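/- A directed clique-width $k$-expression $X$ is built from the operations: creation of a new vertex with label $a$; disjoint union $\oplus$ of two labeled digraphs; insertion $\alpha_{a,b}$ ($a\neq b$) of an arc from every vertex with label $a$ to every vertex with label $b$; and change $\rho_{a\to b}$ of label $a$ into label $b$, where all labels come from a set of $k$ labels. Write $|X|$ for the number of operations in $X$. An oriented $r$-coloring of a digraph $G=(V,E)$ is a map $c:V\to\{1,\dots,r\}$ such that $c(u)\neq c(v)$ for every arc $(u,v)\in E$, and $c(u)\neq c(y)$ for all arcs $(u,v),(x,y)\in E$ with $c(v)=c(x)$ (only oriented graphs, i.e. digraphs without loops and opposite arcs, can have one). **Theorem.** The Oriented Chromatic Number problem on digraphs on $n$ vertices given by a directed clique-width $k$-expression can be solved in $\mathcal{O}(n\cdot k^2\cdot 2^{r(r+k)})$ time, plus time linear in the length of the expression. That is, there are a single algorithm and a constant $C$ such that for all $k$ and $r$, every directed clique-width $k$-expression $X$ and every digraph $G$ on $n$ vertices defined by $X$, the algorithm, given $r$, $k$ and $X$, decides in at most $$C\cdot\bigl(|X|+n\cdot k^2\cdot 2^{r(r+k)}\bigr)$$ steps whether $G$ has an oriented $r$-coloring.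 (In particular the time is $\mathcal{O}(n\cdot k^2\cdot 2^{r(r+k)})$ for expressions with $\mathcal{O}(n\cdot k^2)$ operations.) Here an algorithm is a program of a random access machine that performs one arithmetic operation, comparison or memory access on words per step, and whose words need only hold numbers up to $C\cdot(|X|+n\cdot k^2\cdot 2^{r(r+k)})$. -/

import Mathlib

/-! ### Directed clique-width expressions -/

/-- Directed clique-width `k`-expressions, over the labels `0, …, k - 1`. -/
inductive CWExpr (k : ℕ) : Type
  /-- creation of a new vertex with label `a` -/
  | vertex (a : Fin k) : CWExpr k
  /-- disjoint union -/
  | union (X Y : CWExpr k) : CWExpr k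
  /-- insertion of an arc from every vertex with label `a` to every vertex with label `b` -/
  | arcs (a b : Fin k) (hab : a ≠ b) (X : CWExpr k) : CWExpr k
  /-- change of label `a` into label `b` -/
  | relabel (a b : Fin k) (X : CWExpr k) : CWExpr k

namespace CWExpr

variable {k : ℕ}

/-- The vertices of the digraph defined by an expression: the leaves of its expression tree. -/
def Vertex : CWExpr k → Type
  | vertex _ => Unit
  | union X Y => X.Vertex ⊕ Y.Vertex
  | arcs _ _ _ X => X.Vertex
  | relabel _ _ X => X.Vertex

/-- The labels of the vertices of the digraph defined by an expression. -/
def label : (X : CWExpr k) → X.Vertex → Fin k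
  | vertex a => fun _ => a
  | union X Y => Sum.elim X.label Y.label
  | arcs _ _ _ X => X.label
  | relabel a b X => fun v => if X.label v = a then b else X.label v

/-- The arcs of the digraph defined by an expression. -/
def Arc : (X : CWExpr k) → X.Vertex → X.Vertex → Prop
  | vertex _ => fun _ _ => False
  | union X Y => fun u v =>
      match u, v with
      | Sum.inl u, Sum.inl v => X.Arc u v
      | Sum.inr u, Sum.inr v => Y.Arc u v
      | _, _ => False
  | arcs a b _ X => fun u v => X.Arc u v ∨ (X.label u = a ∧ X.label v = b)
  | relabel _ _ X => X.Arc

/-- `X.Defines G`: the expression `X` defines the digraph `G`, where the bijection says which leaf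
of `X` creates which vertex of `G`. -/
def Defines (X : CWExpr k) {V : Type} (G : Digraph V) : Prop :=
  ∃ e : X.Vertex ≃ V, ∀ u v : X.Vertex, G.Adj (e u) (e v) ↔ X.Arc u v

/-- The number of operations of an expression (the number of nodes of its expression tree). -/
def size : CWExpr k → ℕ
  | vertex _ => 1
  | union X Y => X.size + Y.size + 1
  | arcs _ _ _ X => X.size + 1
  | relabel _ _ X => X.size + 1

/-- An expression written as a word over `ℕ`: its operations in postfix order, each operation as
three numbers (the kind of the operation, followed by its labels, padded with `0`). -/
def code : CWExpr k → List ℕ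
  | vertex a => [0, (a : ℕ), 0]
  | union X Y => X.code ++ Y.code ++ [1, 0, 0]
  | arcs a b _ X => X.code ++ [2, (a : ℕ), (b : ℕ)]
  | relabel a b X => X.code ++ [3, (a : ℕ), (b : ℕ)]

end CWExpr

/-! ### Oriented colorings -/

/-- `c` is an oriented coloring of `G`. (If `G` has a loop or two opposite arcs, that is, if it is
not an oriented graph, then it has no such coloring.) -/
def IsOrientedColoring {V : Type} (G : Digraph V) {r : ℕ} (c : V → Fin r) : Prop :=
  (∀ u v, G.Adj u v → c u ≠ c v) ∧
    ∀ u v x y, G.Adj u v → G.Adj x y → c v = c x → c u ≠ c y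

/-- The question of the Oriented Chromatic Number problem: is there an oriented `r`-coloring? -/
def HasOrientedColoring {V : Type} (G : Digraph V) (r : ℕ) : Prop :=
  ∃ c : V → Fin r, IsOrientedColoring G c

/-! ### The machine model: programs of a random access machine with words of bounded length -/

namespace WordRAM

/-- The arithmetic operations that the machine performs in one step. -/
inductive ArithOp : Type
  | add | sub | mul | div | mod | lt | eq

/-- The value of an arithmetic operation. Subtraction is truncated at `0`, division by `0` gives
`0`, and the comparisons give `1` for true and `0` for false. -/
def ArithOp.eval : ArithOp → ℕ → ℕ → ℕ
  | add, a, b => a + b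
  | sub, a, b => a - b
  | mul, a, b => a * b
  | div, a, b => a / b
  | mod, a, b => a % b
  | lt, a, b => if a < b then 1 else 0
  | eq, a, b => if a = b then 1 else 0

/-- Programs. A program mentions only finitely many registers, by fixed numbers; the memory is
addressed through the contents of registers. -/
inductive Prog : Type
  /-- do nothing -/
  | skip : Prog
  /-- register `x` := the constant `c` -/
  | const (x c : ℕ) : Prog
  /-- register `x` := register `y` ∘ register `z` -/
  | arith (o : ArithOp) (x y z : ℕ) : Prog
  /-- register `x` := the memory cell whose address is in register `y` -/
  | load (x y : ℕ) : Prog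
  /-- the memory cell whose address is in register `x` := register `y` -/
  | store (x y : ℕ) : Prog
  /-- first `p`, then `q` -/
  | seq (p q : Prog) : Prog
  /-- if register `x` is not `0` then `p` else `q` -/
  | ite (x : ℕ) (p q : Prog) : Prog
  /-- while register `x` is not `0` do `p` -/
  | loop (x : ℕ) (p : Prog) : Prog

/-- The contents of the registers and of the memory cells. -/
structure State : Type where
  reg : ℕ → ℕ
  mem : ℕ → ℕ

/-- `s` with register `x` set to `a`. -/
def State.setReg (s : State) (x a : ℕ) : State := ⟨Function.update s.reg x a, s.mem⟩

/-- `s` with memory cell `x` set to `a`. -/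
def State.setMem (s : State) (x a : ℕ) : State := ⟨s.reg, Function.update s.mem x a⟩

/-- `Exec W p s s' t`: on a machine whose words hold the numbers from `0` to `W`, the program `p`
started in the state `s` halts in the state `s'` after exactly `t` steps. Each instruction and each
test of a branch or of a loop is one step. There is no run in which a number greater than `W` would
have to be put into a register or be used as an address (the word length is respected,
nothing is cut off). -/
inductive Exec (W : ℕ) : Prog → State → State → ℕ → Prop
  | skip (s : State) : Exec W .skip s s 1
  | const (x c : ℕ) (s : State) (h : c ≤ W) : Exec W (.const x c) s (s.setReg x c) 1
  | arith (o : ArithOp) (x y z : ℕ) (s : State) (h : o.eval (s.reg y) (s.reg z) ≤ W) :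
      Exec W (.arith o x y z) s (s.setReg x (o.eval (s.reg y) (s.reg z))) 1
  | load (x y : ℕ) (s : State) (hadr : s.reg y ≤ W) (hval : s.mem (s.reg y) ≤ W) :
      Exec W (.load x y) s (s.setReg x (s.mem (s.reg y))) 1
  | store (x y : ℕ) (s : State) (hadr : s.reg x ≤ W) (hval : s.reg y ≤ W) :
      Exec W (.store x y) s (s.setMem (s.reg x) (s.reg y)) 1
  | seq {p q : Prog} {s s' s'' : State} {t t' : ℕ} (hp : Exec W p s s' t)
      (hq : Exec W q s' s'' t') : Exec W (.seq p q) s s'' (t + t')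
  | ite_true {x : ℕ} {p q : Prog} {s s' : State} {t : ℕ} (hx : s.reg x ≠ 0)
      (hp : Exec W p s s' t) : Exec W (.ite x p q) s s' (t + 1)
  | ite_false {x : ℕ} {p q : Prog} {s s' : State} {t : ℕ} (hx : s.reg x = 0)
      (hq : Exec W q s s' t) : Exec W (.ite x p q) s s' (t + 1)
  | loop_done {x : ℕ} {p : Prog} {s : State} (hx : s.reg x = 0) : Exec W (.loop x p) s s 1
  | loop_step {x : ℕ} {p : Prog} {s s' s'' : State} {t t' : ℕ} (hx : s.reg x ≠ 0)
      (hp : Exec W p s s' t) (hl : Exec W (.loop x p) s' s'' t') :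
      Exec W (.loop x p) s s'' (t + t' + 1)

/-- The state in which all registers are `0` and the memory holds the word `w` in its first cells
and `0` elsewhere. -/
def initial (w : List ℕ) : State := ⟨fun _ => 0, fun i => w.getD i 0⟩

/-- With words for the numbers from `0` to `W`, the program `p` on input `w` halts after at most `T`
steps and answers whether `Q` holds, by `1` (yes) or `0` (no) in register `0`. -/
def Answers (W : ℕ) (p : Prog) (w : List ℕ) (T : ℕ) (Q : Prop) : Prop :=
  ∃ (s : State) (t : ℕ), Exec W p (initial w) s t ∧ t ≤ T ∧
    (Q → s.reg 0 = 1) ∧ (¬ Q → s.reg 0 = 0)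

end WordRAM

/-- The input for the Oriented Chromatic Number problem on a digraph that is given by a directed
clique-width `k`-expression: the numbers `r`, `k`, the number of operations, and the expression. -/
def ocnInput {k : ℕ} (r : ℕ) (X : CWExpr k) : List ℕ :=
  r :: k :: X.size :: X.code

/-! An oriented `r`-coloring amounts to a homomorphism into some tournament on the `r` colors: a
pair of colors is oriented as the arcs between them dictate, and arbitrarily if there are none
(`hasOrientedColoring_iff`). Fix a tournament and sets S_0, …, S_{k-1} of colors, and record whether
some homomorphism sends every vertex with label a into S_a. These bits form a table with 2^(rk +
r(r-1)/2) entries (`IsTable`). The sets only bound the colors from above and need not be attained,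
which makes all operations simple. Disjoint union is the pointwise product (`IsTable.union`).
Changing label a into b reads the entry in which S_a is replaced by S_b (`IsTable.moveSlot`). Arcs
from a to b are inserted by treating, one after the other, the pairs (i, j) of colors without an arc
from i to j in the tournament: either i is deleted from S_a or j is deleted from S_b
(`IsTableAvoiding.forbid`). An insertion makes O(r^2) passes over the table, and this factor
disappears in 2^(r(r+k)) because r(r-1)/2 stays well below r^2 (`timeUnit_le`).

The time bound allows only constant time per operation, plus O(k^2) insertions for each vertex, so
most operations must not touch the table. Labels therefore point to slots, and the current table is
indexed by slots. Changing a label into one without a slot only moves a pointer; an insertion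
between slots marked as completely joined is skipped. An insertion that is carried out marks a new
pair of slots. Merging two slots takes one label out of use and erases at most 2(k+1) marks. Hence
the `potential`, the number of unmarked pairs plus 3(k+1) for each label with a slot, pays for all
changes of the table (`arcsProg_spec`, `relabelProg_spec`). It is at most 4(k+1)^2 and is renewed
only at the 2n-1 vertex creations and disjoint unions, where the topmost table is translated from
slots back to labels and slots and marks are reset.

The postfix word is evaluated with a stack of tables; the correctness and the running time of this
follow by induction on the expression (`iter_stepProg`). The machine itself is hidden behind a
translation of expressions (`Expr.exec`) and triples that record the number of steps (`Tri`,
`Tri.for`, `Iter`). -/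

/-! ### A small imperative layer over the machine -/

namespace WordRAM

/-- Expressions over variables, arrays and the input. -/
inductive Expr : Type
  | lit (c : ℕ) : Expr
  | var (x : ℕ) : Expr
  | bin (o : ArithOp) (a b : Expr) : Expr
  /-- the entry with index `e` of array `ρ` -/
  | rd (ρ : ℕ) (e : Expr) : Expr
  /-- the input word at position `e` -/
  | inp (e : Expr) : Expr

/-- The fixed data of a run: the word bound, the length of the input, and the input. -/
structure Env : Type where
  W : ℕ
  L : ℕ
  inp : ℕ → ℕ
  five_le : 5 ≤ W

/-- The values of the variables and of the arrays. -/
@[ext] structure Store : Type where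
  var : ℕ → ℕ
  arr : ℕ → ℕ → ℕ

/-- `h` with variable `x` set to `a`. -/
def Store.set (h : Store) (x a : ℕ) : Store := ⟨Function.update h.var x a, h.arr⟩

/-- `h` with entry `i` of array `ρ` set to `a`. -/
def Store.put (h : Store) (ρ i a : ℕ) : Store :=
  ⟨h.var, Function.update h.arr ρ (Function.update (h.arr ρ) i a)⟩

@[simp] theorem Store.set_arr (h : Store) (x a : ℕ) : (h.set x a).arr = h.arr := rfl

@[simp] theorem Store.put_var (h : Store) (ρ i a : ℕ) : (h.put ρ i a).var = h.var := rfl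

@[simp] theorem Store.set_var (h : Store) (x a y : ℕ) :
    (h.set x a).var y = if y = x then a else h.var y := by
  simp [Store.set, Function.update_apply]

theorem Store.put_arr (h : Store) (ρ i a σ : ℕ) :
    (h.put ρ i a).arr σ = if σ = ρ then Function.update (h.arr ρ) i a else h.arr σ := by
  simp [Store.put, Function.update_apply]

@[simp] theorem Store.put_arr_apply (h : Store) (ρ i a σ j : ℕ) :
    (h.put ρ i a).arr σ j = if σ = ρ ∧ j = i then a else h.arr σ j := by
  rw [Store.put_arr]
  by_cases hσ : σ = ρ
  · subst hσ; simp [Function.update_apply]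
  · simp [hσ]

/-! ### Expressions: values, word bounds, costs and machine code -/

namespace Expr

instance : Add Expr := ⟨bin .add⟩
instance : Sub Expr := ⟨bin .sub⟩
instance : Mul Expr := ⟨bin .mul⟩
instance : Div Expr := ⟨bin .div⟩
instance : Mod Expr := ⟨bin .mod⟩

/-- The value of an expression. -/
def val (E : Env) (h : Store) : Expr → ℕ
  | lit c => c
  | var x => h.var x
  | bin o a b => o.eval (a.val E h) (b.val E h)
  | rd ρ e => h.arr ρ (e.val E h)
  | inp e => E.inp (e.val E h)

/-- The evaluation of an expression respects the word length. -/
def Ok (E : Env) (h : Store) : Expr → Prop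
  | lit c => c ≤ E.W
  | var x => x < 50
  | bin .add a b => a.Ok E h ∧ b.Ok E h ∧ a.val E h + b.val E h ≤ E.W
  | bin .mul a b => a.Ok E h ∧ b.Ok E h ∧ a.val E h * b.val E h ≤ E.W
  | bin _ a b => a.Ok E h ∧ b.Ok E h
  | rd ρ e => ρ < 5 ∧ e.Ok E h ∧ E.L + 5 * e.val E h + 5 ≤ E.W
  | inp e => e.Ok E h ∧ e.val E h < E.L

/-- The number of steps of the evaluation of an expression. -/
def cost : Expr → ℕ
  | lit _ => 1
  | var _ => 2
  | bin _ a b => a.cost + b.cost + 1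
  | rd _ e => e.cost + 6
  | inp e => e.cost + 1

/-- The program that evaluates an expression into register `51 + d`, using only the registers from
`51 + d` on. -/
def code : Expr → ℕ → Prog
  | lit c, d => .const (51 + d) c
  | var x, d => .seq (.const (51 + d) 0) (.arith .add (51 + d) x (51 + d))
  | bin o a b, d => .seq (a.code d) (.seq (b.code (d + 1)) (.arith o (51 + d) (51 + d) (52 + d)))
  | rd ρ e, d => .seq (e.code d) (.seq (.const (52 + d) 5) (.seq
      (.arith .mul (51 + d) (51 + d) (52 + d)) (.seq (.arith .add (51 + d) 50 (51 + d)) (.seq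
      (.const (52 + d) ρ) (.seq (.arith .add (51 + d) (51 + d) (52 + d))
      (.load (51 + d) (51 + d)))))))
  | inp e, d => .seq (e.code d) (.load (51 + d) (51 + d))

section simps
variable (E : Env) (h : Store) (a b : Expr)

@[simp] theorem val_lit (c : ℕ) : (lit c).val E h = c := rfl
@[simp] theorem val_var (x : ℕ) : (var x).val E h = h.var x := rfl
@[simp] theorem val_rd (ρ : ℕ) : (rd ρ a).val E h = h.arr ρ (a.val E h) := rfl
@[simp] theorem val_inp : (inp a).val E h = E.inp (a.val E h) := rfl
@[simp] theorem val_add : (a + b).val E h = a.val E h + b.val E h := rfl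
@[simp] theorem val_sub : (a - b).val E h = a.val E h - b.val E h := rfl
@[simp] theorem val_mul : (a * b).val E h = a.val E h * b.val E h := rfl
@[simp] theorem val_div : (a / b).val E h = a.val E h / b.val E h := rfl
@[simp] theorem val_mod : (a % b).val E h = a.val E h % b.val E h := rfl
@[simp] theorem val_lt : (bin .lt a b).val E h = if a.val E h < b.val E h then 1 else 0 := rfl
@[simp] theorem val_eq : (bin .eq a b).val E h = if a.val E h = b.val E h then 1 else 0 := rfl

@[simp] theorem ok_lit (c : ℕ) : (lit c).Ok E h ↔ c ≤ E.W := Iff.rfl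
@[simp] theorem ok_var (x : ℕ) : (var x).Ok E h ↔ x < 50 := Iff.rfl
@[simp] theorem ok_rd (ρ : ℕ) :
    (rd ρ a).Ok E h ↔ ρ < 5 ∧ a.Ok E h ∧ E.L + 5 * a.val E h + 5 ≤ E.W := Iff.rfl
@[simp] theorem ok_inp : (inp a).Ok E h ↔ a.Ok E h ∧ a.val E h < E.L := Iff.rfl
@[simp] theorem ok_add :
    (a + b).Ok E h ↔ a.Ok E h ∧ b.Ok E h ∧ a.val E h + b.val E h ≤ E.W := Iff.rfl
@[simp] theorem ok_mul :
    (a * b).Ok E h ↔ a.Ok E h ∧ b.Ok E h ∧ a.val E h * b.val E h ≤ E.W := Iff.rfl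
@[simp] theorem ok_sub : (a - b).Ok E h ↔ a.Ok E h ∧ b.Ok E h := Iff.rfl
@[simp] theorem ok_div : (a / b).Ok E h ↔ a.Ok E h ∧ b.Ok E h := Iff.rfl
@[simp] theorem ok_mod : (a % b).Ok E h ↔ a.Ok E h ∧ b.Ok E h := Iff.rfl
@[simp] theorem ok_lt : (bin .lt a b).Ok E h ↔ a.Ok E h ∧ b.Ok E h := Iff.rfl
@[simp] theorem ok_eq : (bin .eq a b).Ok E h ↔ a.Ok E h ∧ b.Ok E h := Iff.rfl

@[simp] theorem cost_lit (c : ℕ) : (lit c).cost = 1 := rfl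
@[simp] theorem cost_var (x : ℕ) : (var x).cost = 2 := rfl
@[simp] theorem cost_rd (ρ : ℕ) : (rd ρ a).cost = a.cost + 6 := rfl
@[simp] theorem cost_inp : (inp a).cost = a.cost + 1 := rfl
@[simp] theorem cost_add : (a + b).cost = a.cost + b.cost + 1 := rfl
@[simp] theorem cost_sub : (a - b).cost = a.cost + b.cost + 1 := rfl
@[simp] theorem cost_mul : (a * b).cost = a.cost + b.cost + 1 := rfl
@[simp] theorem cost_div : (a / b).cost = a.cost + b.cost + 1 := rfl
@[simp] theorem cost_mod : (a % b).cost = a.cost + b.cost + 1 := rfl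
@[simp] theorem cost_bin (o : ArithOp) : (bin o a b).cost = a.cost + b.cost + 1 := rfl

end simps

end Expr

/-! ### Correctness of the translation of expressions -/

/-- The machine state `s` represents the store `h`: variable `x` is register `x`, array `ρ` consists
of the cells `L + 5 * i + ρ`, the input lies below `L`, and register `50` holds `L`. -/
structure Rep (E : Env) (s : State) (h : Store) : Prop where
  var : ∀ x < 50, s.reg x = h.var x
  base : s.reg 50 = E.L
  reg_le : ∀ x, s.reg x ≤ E.W
  arr : ∀ ρ < 5, ∀ i, s.mem (E.L + 5 * i + ρ) = h.arr ρ i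
  inp : ∀ i < E.L, s.mem i = E.inp i
  mem_le : ∀ i, s.mem i ≤ E.W

variable {E : Env} {s : State} {h : Store}

@[simp] theorem State.setReg_reg (s : State) (x a y : ℕ) :
    (s.setReg x a).reg y = if y = x then a else s.reg y := by
  simp [State.setReg, Function.update_apply]

@[simp] theorem State.setReg_mem (s : State) (x a : ℕ) : (s.setReg x a).mem = s.mem := rfl

theorem Rep.setTemp (hs : Rep E s h) {x a : ℕ} (hx : 50 < x) (ha : a ≤ E.W) :
    Rep E (s.setReg x a) h where
  var y hy := by rw [State.setReg_reg, if_neg (by omega)]; exact hs.var y hy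
  base := by rw [State.setReg_reg, if_neg (by omega)]; exact hs.base
  reg_le y := by
    rw [State.setReg_reg]; split_ifs
    · exact ha
    · exact hs.reg_le y
  arr := hs.arr
  inp := hs.inp
  mem_le := hs.mem_le

theorem Rep.setVar (hs : Rep E s h) {x a : ℕ} (hx : x < 50) (ha : a ≤ E.W) :
    Rep E (s.setReg x a) (h.set x a) where
  var y hy := by
    rw [State.setReg_reg, Store.set_var]; split_ifs
    · rfl
    · exact hs.var y hy
  base := by rw [State.setReg_reg, if_neg (by omega)]; exact hs.base
  reg_le y := by
    rw [State.setReg_reg]; split_ifs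
    · exact ha
    · exact hs.reg_le y
  arr := hs.arr
  inp := hs.inp
  mem_le := hs.mem_le

/-- The arrays are interleaved with period 5, so that the address determines both the array and the
index, and all addresses lie beyond the input. -/
theorem Rep.setArr (hs : Rep E s h) {ρ i a : ℕ} (hρ : ρ < 5) (ha : a ≤ E.W) :
    Rep E (s.setMem (E.L + 5 * i + ρ) a) (h.put ρ i a) where
  var := hs.var
  base := hs.base
  reg_le := hs.reg_le
  arr σ hσ j := by
    rw [Store.put_arr_apply, ← hs.arr σ hσ j]
    simp only [State.setMem, Function.update_apply]
    congr 1
    exact propext ⟨fun _ => by omega, fun _ => by omega⟩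
  inp j hj := by
    rw [← hs.inp j hj]
    simp only [State.setMem, Function.update_apply]
    rw [if_neg (by omega)]
  mem_le j := by
    simp only [State.setMem, Function.update_apply]
    split_ifs
    · exact ha
    · exact hs.mem_le j

/-- Only sums and products can exceed the word bound; the other results are bounded by the left
argument or by 1. -/
theorem ArithOp.eval_le {o : ArithOp} {a b W : ℕ} (ha : a ≤ W) (h1 : 1 ≤ W)
    (h : (o = .add ∨ o = .mul) → o.eval a b ≤ W) : o.eval a b ≤ W := by
  cases o with
  | add => exact h (Or.inl rfl)
  | mul => exact h (Or.inr rfl)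
  | sub => exact (Nat.sub_le _ _).trans ha
  | div => exact (Nat.div_le_self _ _).trans ha
  | mod => exact (Nat.mod_le _ _).trans ha
  | lt => simp only [ArithOp.eval]; split_ifs <;> omega
  | eq => simp only [ArithOp.eval]; split_ifs <;> omega

theorem Exec.arith_eq {W x y z v : ℕ} {o : ArithOp} (hv : o.eval (s.reg y) (s.reg z) = v)
    (hW : v ≤ W) : Exec W (.arith o x y z) s (s.setReg x v) 1 := by
  subst hv; exact .arith o x y z s hW

theorem Exec.load_eq {W x y a v : ℕ} (ha : s.reg y = a) (hv : s.mem a = v) (haW : a ≤ W)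
    (hW : v ≤ W) : Exec W (.load x y) s (s.setReg x v) 1 := by
  subst hv; subst ha; exact .load x y s haW hW

theorem Exec.store_eq {W x y a v : ℕ} (ha : s.reg x = a) (hv : s.reg y = v) (haW : a ≤ W)
    (hW : v ≤ W) : Exec W (.store x y) s (s.setMem a v) 1 := by
  subst hv; subst ha; exact .store x y s haW hW

/-- The temporary registers act as a stack of height `d`. That everything below `51 + d` is left
alone keeps the left operand alive while the right one is evaluated. -/
theorem Expr.exec (e : Expr) : ∀ (d : ℕ) (s : State), Rep E s h → e.Ok E h →
    ∃ s', Exec E.W (e.code d) s s' e.cost ∧ Rep E s' h ∧ s'.reg (51 + d) = e.val E h ∧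
      ∀ x < 51 + d, s'.reg x = s.reg x := by
  have h5 := E.five_le
  induction e with
  | lit c =>
    intro d s hs hok
    exact ⟨_, .const _ _ _ hok, hs.setTemp (by omega) hok, by simp, fun x hx => by simp; omega⟩
  | var x =>
    intro d s hs hok
    have hx : x < 50 := hok
    refine ⟨_, .seq (.const _ _ _ (Nat.zero_le _)) (.arith _ _ _ _ _ ?_),
      (hs.setTemp (by omega) (Nat.zero_le _)).setTemp (by omega) ?_, ?_, ?_⟩
    · have := hs.reg_le x
      simp [ArithOp.eval, show x ≠ 51 + d by omega, this]
    · have := hs.reg_le x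
      simp [ArithOp.eval, show x ≠ 51 + d by omega, this]
    · simp [ArithOp.eval, show x ≠ 51 + d by omega, hs.var x hx]
    · intro y hy; simp [show y ≠ 51 + d by omega]
  | bin o a b iha ihb =>
    intro d s hs hok
    have hab : a.Ok E h ∧ b.Ok E h := by
      cases o <;> first | exact ⟨hok.1, hok.2.1⟩ | exact ⟨hok.1, hok.2⟩
    obtain ⟨s1, e1, r1, v1, f1⟩ := iha d s hs hab.1
    obtain ⟨s2, e2, r2, v2, f2⟩ := ihb (d + 1) s1 r1 hab.2
    have v1' : s2.reg (51 + d) = a.val E h := by rw [f2 _ (by omega), v1]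
    have v2' : s2.reg (52 + d) = b.val E h := by rw [← v2]; congr 1; omega
    have hle : o.eval (s2.reg (51 + d)) (s2.reg (52 + d)) ≤ E.W := by
      refine ArithOp.eval_le (r2.reg_le _) (by omega) ?_
      rw [v1', v2']
      rintro (rfl | rfl)
      · exact hok.2.2
      · exact hok.2.2
    have hex := Exec.seq e1 (.seq e2 (.arith o (51 + d) (51 + d) (52 + d) s2 hle))
    rw [← Nat.add_assoc] at hex
    refine ⟨_, hex,
      r2.setTemp (x := 51 + d) (by omega) hle, ?_, ?_⟩
    · simp [v1', v2', Expr.val]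
    · intro x hx
      simp only [State.setReg_reg, if_neg (show x ≠ 51 + d by omega)]
      rw [f2 x (by omega), f1 x hx]
  | rd ρ e ih =>
    intro d s hs hok
    obtain ⟨hρ, he, hadr⟩ := hok
    obtain ⟨s1, e1, r1, v1, f1⟩ := ih d s hs he
    have r2 := r1.setTemp (x := 52 + d) (a := 5) (by omega) (by omega)
    have r3 := r2.setTemp (x := 51 + d) (a := 5 * e.val E h) (by omega) (by omega)
    have r4 := r3.setTemp (x := 51 + d) (a := E.L + 5 * e.val E h) (by omega) (by omega)
    have r5 := r4.setTemp (x := 52 + d) (a := ρ) (by omega) (by omega)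
    have r6 := r5.setTemp (x := 51 + d) (a := E.L + 5 * e.val E h + ρ) (by omega) (by omega)
    have r7 := r6.setTemp (x := 51 + d) (a := h.arr ρ (e.val E h)) (by omega)
      (by rw [← r1.arr ρ hρ]; exact r1.mem_le _)
    have hv : h.arr ρ (e.val E h) ≤ E.W := by rw [← r1.arr ρ hρ]; exact r1.mem_le _
    refine ⟨_, .seq e1 (.seq (.const (52 + d) 5 s1 (by omega)) (.seq
      (.arith_eq (v := 5 * e.val E h) ?_ (by omega)) (.seq
      (.arith_eq (v := E.L + 5 * e.val E h) ?_ (by omega)) (.seq (.const (52 + d) ρ _ (by omega))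
      (.seq (.arith_eq (v := E.L + 5 * e.val E h + ρ) ?_ (by omega))
      (.load_eq (a := E.L + 5 * e.val E h + ρ) ?_ ?_ (by omega) hv)))))), r7, ?_, ?_⟩
    · simp [ArithOp.eval, v1, mul_comm]
    · simp [ArithOp.eval, r1.base, show 50 ≠ 51 + d by omega, show 50 ≠ 52 + d by omega]
    · simp [ArithOp.eval]
    · simp
    · simp [r1.arr ρ hρ]
    · simp [Expr.val]
    · intro x hx
      simp only [State.setReg_reg, if_neg (show x ≠ 51 + d by omega),
        if_neg (show x ≠ 52 + d by omega)]
      exact f1 x hx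
  | inp e ih =>
    intro d s hs hok
    obtain ⟨s1, e1, r1, v1, f1⟩ := ih d s hs hok.1
    refine ⟨_, .seq e1 (.load _ _ _ (r1.reg_le _) (r1.mem_le _)),
      r1.setTemp (by omega) (r1.mem_le _), ?_, ?_⟩
    · simp [Expr.val, v1, r1.inp _ hok.2]
    · intro x hx
      simp only [State.setReg_reg, if_neg (show x ≠ 51 + d by omega)]
      exact f1 x hx

/-! ### Triples with running time -/

/-- Started in a state that represents `h`, the program `p` halts after some number `t` of steps in
a state that represents a store `h'`, where `Q h' t`. -/
def Tri (E : Env) (p : Prog) (h : Store) (Q : Store → ℕ → Prop) : Prop :=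
  ∀ s, Rep E s h → ∃ s' h' t, Exec E.W p s s' t ∧ Rep E s' h' ∧ Q h' t

/-- Variable `x` := the value of `e`. -/
def assign (x : ℕ) (e : Expr) : Prog :=
  .seq (e.code 0) (.seq (.const 52 0) (.arith .add x 51 52))

/-- Entry `e₁` of array `ρ` := the value of `e₂`. -/
def write (ρ : ℕ) (e₁ e₂ : Expr) : Prog :=
  .seq (e₁.code 0) (.seq (.const 52 5) (.seq (.arith .mul 51 51 52) (.seq (.arith .add 51 50 51)
    (.seq (.const 52 ρ) (.seq (.arith .add 51 51 52) (.seq (e₂.code 1) (.store 51 52)))))))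

/-- If the value of `e` is not `0` then `p` else `q`. -/
def cond (e : Expr) (p q : Prog) : Prog := .seq (e.code 0) (.ite 51 p q)

/-- For `x` from `0` while `x` is less than variable `y`, do `p`. -/
def forLoop (x y : ℕ) (p : Prog) : Prog :=
  .seq (assign x (.lit 0)) (.seq ((Expr.bin .lt (.var x) (.var y)).code 0)
    (.loop 51 (.seq p (.seq (assign x (.var x + .lit 1))
      ((Expr.bin .lt (.var x) (.var y)).code 0)))))

variable {p q : Prog} {Q Q' : Store → ℕ → Prop}

theorem Tri.mono (hp : Tri E p h Q) (hQ : ∀ h' t, Q h' t → Q' h' t) : Tri E p h Q' := by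
  intro s hs
  obtain ⟨s', h', t, e, r, q⟩ := hp s hs
  exact ⟨s', h', t, e, r, hQ _ _ q⟩

/-- The postcondition of `p` is itself a triple for `q`, so that proofs execute the program
symbolically from front to back while the steps add up. -/
theorem Tri.seq (hp : Tri E p h fun h₁ t₁ => Tri E q h₁ fun h₂ t₂ => Q h₂ (t₁ + t₂)) :
    Tri E (.seq p q) h Q := by
  intro s hs
  obtain ⟨s1, h1, t1, e1, r1, q1⟩ := hp s hs
  obtain ⟨s2, h2, t2, e2, r2, q2⟩ := q1 s1 r1
  exact ⟨s2, h2, _, .seq e1 e2, r2, q2⟩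

theorem Tri.skip (hQ : Q h 1) : Tri E .skip h Q :=
  fun s hs => ⟨s, h, 1, .skip s, hs, hQ⟩

theorem Tri.assign {x : ℕ} {e : Expr} (hx : x < 50) (he : e.Ok E h)
    (hQ : Q (h.set x (e.val E h)) (e.cost + 2)) : Tri E (assign x e) h Q := by
  intro s hs
  obtain ⟨s1, e1, r1, v1, -⟩ := e.exec 0 s hs he
  have hle : e.val E h ≤ E.W := v1 ▸ r1.reg_le _
  have r2 := r1.setTemp (x := 52) (a := 0) (by omega) (by omega)
  refine ⟨_, _, _, .seq e1 (.seq (.const _ _ _ (Nat.zero_le _)) (t' := 1) ?_),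
    r2.setVar hx hle, hQ⟩
  convert Exec.arith (W := E.W) .add x 51 52 _ ?_ using 2
  · simpa [ArithOp.eval] using v1.symm
  · simpa [ArithOp.eval] using r1.reg_le 51

theorem Tri.write {ρ : ℕ} {e₁ e₂ : Expr} (hρ : ρ < 5) (h₁ : e₁.Ok E h) (h₂ : e₂.Ok E h)
    (hadr : E.L + 5 * e₁.val E h + 5 ≤ E.W)
    (hQ : Q (h.put ρ (e₁.val E h) (e₂.val E h)) (e₁.cost + e₂.cost + 6)) :
    Tri E (write ρ e₁ e₂) h Q := by
  intro s hs
  have h5 := E.five_le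
  obtain ⟨s1, e1, r1, v1, -⟩ := e₁.exec 0 s hs h₁
  have r2 := r1.setTemp (x := 52) (a := 5) (by omega) (by omega)
  have r3 := r2.setTemp (x := 51) (a := 5 * e₁.val E h) (by omega) (by omega)
  have r4 := r3.setTemp (x := 51) (a := E.L + 5 * e₁.val E h) (by omega) (by omega)
  have r5 := r4.setTemp (x := 52) (a := ρ) (by omega) (by omega)
  have r6 := r5.setTemp (x := 51) (a := E.L + 5 * e₁.val E h + ρ) (by omega) (by omega)
  obtain ⟨s7, e7, r7, v7, f7⟩ := e₂.exec 1 _ r6 h₂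
  have hle : e₂.val E h ≤ E.W := v7 ▸ r7.reg_le _
  have h51 : s7.reg 51 = E.L + 5 * e₁.val E h + ρ := by rw [f7 51 (by omega)]; simp
  refine ⟨_, _, _, .seq e1 (.seq (.const 52 5 s1 (by omega)) (.seq
    (.arith_eq (v := 5 * e₁.val E h) ?_ (by omega)) (.seq
    (.arith_eq (v := E.L + 5 * e₁.val E h) ?_ (by omega)) (.seq (.const 52 ρ _ (by omega))
    (.seq (.arith_eq (v := E.L + 5 * e₁.val E h + ρ) ?_ (by omega)) (.seq e7
    (.store_eq h51 v7 (by omega) hle))))))), r7.setArr hρ hle, ?_⟩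
  · simp only [add_zero] at v1
    simp [ArithOp.eval, v1, mul_comm]
  · simp [ArithOp.eval, r1.base]
  · simp [ArithOp.eval]
  · convert hQ using 1; ring

theorem Tri.cond {e : Expr} (he : e.Ok E h)
    (hp : e.val E h ≠ 0 → Tri E p h fun h' t => Q h' (e.cost + (t + 1)))
    (hq : e.val E h = 0 → Tri E q h fun h' t => Q h' (e.cost + (t + 1))) :
    Tri E (cond e p q) h Q := by
  intro s hs
  obtain ⟨s1, e1, r1, v1, -⟩ := e.exec 0 s hs he
  simp only [add_zero] at v1
  by_cases hv : e.val E h = 0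
  · obtain ⟨s2, h2, t, e2, r2, q2⟩ := hq hv s1 r1
    exact ⟨s2, h2, _, .seq e1 (.ite_false (v1.trans hv) e2), r2, q2⟩
  · obtain ⟨s2, h2, t, e2, r2, q2⟩ := hp hv s1 r1
    exact ⟨s2, h2, _, .seq e1 (.ite_true (v1 ▸ hv) e2), r2, q2⟩

/-! ### Loops -/

/-- `n` iterations of a loop with body `p`, counter `x` and bound `y`; each of them takes `12` steps
besides those of `p`. -/
def Iter (E : Env) (p : Prog) (x y : ℕ) : ℕ → Store → (Store → ℕ → Prop) → Prop
  | 0, h, Q => Q h 0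
  | n + 1, h, Q => Tri E p h fun h₁ t₁ => h₁.var x = h.var x ∧ h₁.var y = h.var y ∧
      Iter E p x y n (h₁.set x (h.var x + 1)) fun h₂ t₂ => Q h₂ (t₁ + t₂ + 12)

theorem Iter.mono {x y n : ℕ} : ∀ {h : Store} {Q Q' : Store → ℕ → Prop}, Iter E p x y n h Q →
    (∀ h' t, Q h' t → Q' h' t) → Iter E p x y n h Q' := by
  induction n with
  | zero => intro h Q Q' hi hQ; exact hQ _ _ hi
  | succ n ih =>
    intro h Q Q' hi hQ
    exact Tri.mono hi fun h' t ⟨hx, hy, hr⟩ => ⟨hx, hy, ih hr fun h'' t' hq => hQ _ _ hq⟩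

/-- This splits a run of the main loop into the stretches that belong to the subexpressions, where
no invariant uniform in the counter is at hand. -/
theorem Iter.add {x y n m : ℕ} : ∀ {h : Store} {Q : Store → ℕ → Prop},
    Iter E p x y n h (fun h₁ t₁ => Iter E p x y m h₁ fun h₂ t₂ => Q h₂ (t₁ + t₂)) →
    Iter E p x y (n + m) h Q := by
  induction n with
  | zero => intro h Q hi; simpa [Iter] using hi
  | succ n ih =>
    intro h Q hi
    rw [Nat.succ_add_eq_add_succ]
    change Iter E p x y ((n + m) + 1) h Q
    refine Tri.mono hi fun h' t ⟨hx, hy, hr⟩ => ⟨hx, hy, ih (Iter.mono hr fun h₁ t₁ hq =>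
      Iter.mono hq fun h₂ t₂ hq' => ?_)⟩
    convert hq' using 1; ring

/-- Register `51` carries the outcome of the test. One round costs 6 steps for the increment, 5 for
the new test and 1 for the loop instruction, besides the body. -/
theorem Iter.loop {x y n N : ℕ} (hx : x < 50) (hy : y < 50) (hxy : x ≠ y) (hN : N ≤ E.W) :
    ∀ {h : Store} {Q : Store → ℕ → Prop} {s : State}, Iter E p x y n h Q → h.var y = N →
      h.var x + n = N → Rep E s h → s.reg 51 = (if h.var x < h.var y then 1 else 0) →
      ∃ s' h' t, Exec E.W (.loop 51 (.seq p (.seq (WordRAM.assign x (.var x + .lit 1))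
        ((Expr.bin .lt (.var x) (.var y)).code 0)))) s s' (t + 1) ∧ Rep E s' h' ∧ Q h' t := by
  have h5 := E.five_le
  induction n with
  | zero =>
    intro h Q s hi hyN hxn hs h51
    refine ⟨s, h, 0, .loop_done ?_, hs, hi⟩
    rw [h51, if_neg (by omega)]
  | succ n ih =>
    intro h Q s hi hyN hxn hs h51
    obtain ⟨s1, h1, t1, e1, r1, hx1, hy1, q1⟩ := hi s hs
    obtain ⟨s2, h2, t2, e2, r2, q2⟩ := Tri.assign (E := E) (h := h1) (x := x)
      (e := .var x + .lit 1) (Q := fun h' t => h' = h1.set x (h.var x + 1) ∧ t = 6) hx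
      (by simp [hx1]; omega) (by simp [hx1]) s1 r1
    obtain ⟨rfl, rfl⟩ := q2
    obtain ⟨s3, e3, r3, v3, -⟩ := (Expr.bin .lt (.var x) (.var y)).exec 0 s2 r2 (by simp; omega)
    obtain ⟨s4, h4, t4, e4, r4, q4⟩ := ih q1 (by simp [hxy.symm, hy1, hyN]) (by simp; omega) r3
      (by simpa using v3)
    have h51' : s.reg 51 ≠ 0 := by rw [h51, if_pos (by omega)]; simp
    refine ⟨s4, h4, t1 + t4 + 12, ?_, r4, q4⟩
    convert Exec.loop_step h51' (.seq e1 (.seq e2 e3)) e4 using 1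
    simp; ring

/-- The 9 steps are 3 for clearing the counter, 5 for the first test and 1 for leaving the loop. -/
theorem Tri.iter {x y : ℕ} (hx : x < 50) (hy : y < 50) (hxy : x ≠ y)
    (hi : Iter E p x y (h.var y) (h.set x 0) fun h' t => Q h' (t + 9)) :
    Tri E (forLoop x y p) h Q := by
  intro s hs
  obtain ⟨s2, h2, t2, e2, r2, q2⟩ := Tri.assign (E := E) (h := h) (x := x)
      (e := .lit 0) (Q := fun h' t => h' = h.set x 0 ∧ t = 3) hx
      (by simp) (by simp) s hs
  obtain ⟨rfl, rfl⟩ := q2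
  obtain ⟨s3, e3, r3, v3, -⟩ := (Expr.bin .lt (.var x) (.var y)).exec 0 s2 r2 (by simp; omega)
  obtain ⟨s4, h4, t4, e4, r4, q4⟩ := Iter.loop hx hy hxy (N := h.var y)
    (by rw [← hs.var y hy]; exact hs.reg_le y) hi (by simp [hxy.symm]) (by simp) r3
    (by simpa using v3)
  refine ⟨s4, h4, _, .seq e2 (.seq e3 e4), r4, ?_⟩
  convert q4 using 1; simp; ring

/-- The rule for loops with an invariant. -/
theorem Tri.for {x y : ℕ} (I : ℕ → Store → Prop) (T n : ℕ) (hn : h.var y = n)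
    (hx : x < 50) (hy : y < 50) (hxy : x ≠ y) (h0 : I 0 (h.set x 0))
    (hI : ∀ i < n, ∀ h, I i h → h.var x = i → h.var y = n → Tri E p h fun h' t =>
      t ≤ T ∧ h'.var x = i ∧ h'.var y = n ∧ I (i + 1) (h'.set x (i + 1)))
    (hQ : ∀ h' t, I n h' → h'.var x = n → h'.var y = n → t ≤ n * (T + 12) + 9 → Q h' t) :
    Tri E (forLoop x y p) h Q := by
  refine Tri.iter hx hy hxy ?_
  rw [hn]
  have key : ∀ m i h, I i h → h.var x = i → h.var y = n → i + m = n →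
      Iter E p x y m h fun h' t => I n h' ∧ h'.var x = n ∧ h'.var y = n ∧ t ≤ m * (T + 12) := by
    intro m
    induction m with
    | zero =>
      intro i h hi hxi hyn him
      obtain rfl : i = n := by omega
      exact ⟨hi, hxi, hyn, by simp⟩
    | succ m ih =>
      intro i h hi hxi hyn him
      refine Tri.mono (hI i (by omega) h hi hxi hyn) fun h' t ⟨ht, hx', hy', hi'⟩ => ?_
      refine ⟨hx'.trans hxi.symm, hy'.trans hyn.symm, ?_⟩
      rw [hxi]
      refine Iter.mono (ih (i + 1) _ hi' (by simp) (by simpa [hxy.symm] using hy') (by omega))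
        fun h'' t' ⟨a, b, c, d⟩ => ⟨a, b, c, ?_⟩
      calc t + t' + 12 ≤ T + m * (T + 12) + 12 := by omega
        _ = (m + 1) * (T + 12) := by ring
  refine Iter.mono (key n 0 _ h0 (by simp) (by simpa [hxy.symm] using hn) (by simp))
    fun h' t ⟨a, b, c, d⟩ => hQ _ _ a b c (by omega)

end WordRAM

/-! ### Tables of partial colorings -/

namespace OrientedColoring

open Finset

/-! ### Bits and blocks of bits -/

/-- The number of pairs `i < j` with `j < n`. -/
def tri : ℕ → ℕ
  | 0 => 0
  | n + 1 => tri n + n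

theorem tri_mono {m n : ℕ} (h : m ≤ n) : tri m ≤ tri n := by
  induction h with
  | refl => exact le_rfl
  | step _ ih => exact ih.trans (Nat.le_add_right _ _)

theorem tri_add_lt {i j n : ℕ} (hij : i < j) (hj : j < n) : tri j + i < tri n :=
  lt_of_lt_of_le (show tri j + i < tri (j + 1) by simp only [tri]; omega) (tri_mono hj)

theorem tri_add_inj {i j i' j' : ℕ} (h : i < j) (h' : i' < j') (e : tri j + i = tri j' + i') :
    i = i' ∧ j = j' := by
  rcases lt_trichotomy j j' with hj | rfl | hj
  · have := tri_add_lt h hj; omega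
  · omega
  · have := tri_add_lt h' hj; omega

theorem block_inj {r s t i j : ℕ} (hi : i < r) (hj : j < r) (h : r * s + i = r * t + j) :
    s = t ∧ i = j := by
  have hr : 0 < r := by omega
  have h1 : (r * s + i) / r = s := by rw [Nat.mul_add_div hr, Nat.div_eq_of_lt hi]; simp
  have h2 : (r * t + j) / r = t := by rw [Nat.mul_add_div hr, Nat.div_eq_of_lt hj]; simp
  have : s = t := by rw [← h1, h, h2]
  subst this; exact ⟨rfl, by omega⟩

theorem block_lt {r s k i : ℕ} (hi : i < r) (hs : s < k) : r * s + i < r * k := by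
  calc r * s + i < r * (s + 1) := by rw [Nat.mul_succ]; omega
    _ ≤ r * k := Nat.mul_le_mul_left _ hs

theorem testBit_digit (x t r i : ℕ) :
    (x / 2 ^ t % 2 ^ r).testBit i = (decide (i < r) && x.testBit (t + i)) := by
  rw [Nat.testBit_mod_two_pow, Nat.testBit_div_two_pow, Nat.add_comm]

theorem div_mod_two_eq_one {x n : ℕ} : x / 2 ^ n % 2 = 1 ↔ x.testBit n = true := by
  rw [Nat.testBit_eq_decide_div_mod_eq, decide_eq_true_eq]

/-- `x` with the `r` bits from position `t` on replaced by those of `D`. -/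
def setDigit (r t D x : ℕ) : ℕ := x - x / 2 ^ t % 2 ^ r * 2 ^ t + D * 2 ^ t

/-- Splitting `x` into the bits below, inside and above the block shows that the subtraction clears
the block without a borrow and the addition fills it without a carry. -/
theorem testBit_setDigit {r t D x : ℕ} (hD : D < 2 ^ r) (n : ℕ) :
    (setDigit r t D x).testBit n = if t ≤ n ∧ n < t + r then D.testBit (n - t) else x.testBit n := by
  set lo := x % 2 ^ t with hlo
  set y := x / 2 ^ t with hy
  set hi := y / 2 ^ r with hhi
  set mid := y % 2 ^ r with hmid
  have hlot : lo < 2 ^ t := Nat.mod_lt _ (by positivity)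
  have hmidr : mid < 2 ^ r := Nat.mod_lt _ (by positivity)
  have hx : x = 2 ^ t * (2 ^ r * hi + mid) + lo := by
    rw [hhi, hmid, Nat.div_add_mod, hy, hlo, Nat.div_add_mod]
  have h1 : setDigit r t D x = 2 ^ t * (2 ^ r * hi + D) + lo := by
    have : x - mid * 2 ^ t = 2 ^ t * (2 ^ r * hi) + lo := by
      conv_lhs => rw [hx]
      rw [Nat.mul_add, Nat.mul_comm mid]; omega
    unfold setDigit
    rw [this]; ring
  rw [h1, Nat.testBit_two_pow_mul_add _ hlot, Nat.testBit_two_pow_mul_add _ hD]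
  conv_rhs => rw [hx, Nat.testBit_two_pow_mul_add _ hlot, Nat.testBit_two_pow_mul_add _ hmidr]
  by_cases h : n < t
  · simp [h, show ¬ t ≤ n by omega]
  · by_cases h' : n < t + r
    · simp [h, show t ≤ n by omega, h', show n - t < r by omega]
    · simp [h, h', show ¬ n - t < r by omega]

theorem lt_two_pow_of_bits {x n : ℕ} (h : ∀ m, n ≤ m → x.testBit m = false) : x < 2 ^ n :=
  Nat.lt_pow_two_of_testBit x h

theorem testBit_eq_false_of_lt {x n m : ℕ} (h : x < 2 ^ n) (hm : n ≤ m) : x.testBit m = false :=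
  Nat.testBit_lt_two_pow (h.trans_le (Nat.pow_le_pow_right (by norm_num) hm))

theorem sub_two_pow_eq {x n : ℕ} (h : x.testBit n = true) : x - 2 ^ n = setDigit 1 n 0 x := by
  simp [setDigit, div_mod_two_eq_one.2 h]

theorem testBit_sub_two_pow {x n : ℕ} (h : x.testBit n = true) (m : ℕ) :
    (x - 2 ^ n).testBit m = (decide (m ≠ n) && x.testBit m) := by
  rw [sub_two_pow_eq h, testBit_setDigit (by norm_num)]
  by_cases hm : m = n
  · simp [hm]
  · rw [if_neg (by omega)]; simp [hm]

/-! ### Tables indexed by tournaments and sets of colors -/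

/-- The number of entries of a table. -/
def tsize (r k : ℕ) : ℕ := 2 ^ (r * k + tri r)

/-- The tournament on the colors that is given by the bits of `x` from position `r * k` on. -/
def Dominates (r k x i j : ℕ) : Prop :=
  i < j ∧ x.testBit (r * k + (tri j + i)) = true ∨ j < i ∧ x.testBit (r * k + (tri i + j)) = false

theorem dominates_congr {r k x y : ℕ} (h : ∀ m, r * k ≤ m → x.testBit m = y.testBit m) (i j : ℕ) :
    Dominates r k x i j ↔ Dominates r k y i j := by
  unfold Dominates
  rw [h _ (Nat.le_add_right _ _), h _ (Nat.le_add_right _ _)]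

/-- `c` is a homomorphism into the tournament given by `x`, and the vertices `v` with `σ v = s`
have colors in the `s`-th of the sets of colors given by the bits of `x`. -/
structure Colors (r k x : ℕ) {V : Type} (Arc : V → V → Prop) (σ c : V → ℕ) : Prop where
  lt : ∀ v, c v < r
  mem : ∀ v, x.testBit (r * σ v + c v) = true
  hom : ∀ u v, Arc u v → Dominates r k x (c u) (c v)

open Classical in
/-- The truth value of a proposition. -/
noncomputable def ind (p : Prop) : ℕ := if p then 1 else 0

theorem ind_of {p : Prop} (h : p) : ind p = 1 := by simp [ind, h]

theorem ind_of_not {p : Prop} (h : ¬ p) : ind p = 0 := by simp [ind, h]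

theorem ind_le (p : Prop) : ind p ≤ 1 := by unfold ind; split_ifs <;> simp

theorem ind_mul (p q : Prop) : ind p * ind q = ind (p ∧ q) := by
  by_cases hp : p <;> by_cases hq : q <;> simp [ind, hp, hq]

theorem ind_or (p q : Prop) : (if 0 < ind p + ind q then 1 else 0) = ind (p ∨ q) := by
  by_cases hp : p <;> by_cases hq : q <;> simp [ind, hp, hq]

theorem ind_congr {p q : Prop} (h : p ↔ q) : ind p = ind q := by rw [propext h]

/-- `T` says for which tournaments and sets of colors there is a coloring such that in addition no
two vertices `u`, `v` with `σ u = s` and `σ v = t` have forbidden colors. -/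
def IsTableAvoiding (r k : ℕ) (T : ℕ → ℕ) {V : Type} (Arc : V → V → Prop) (σ : V → ℕ) (s t : ℕ)
    (K : ℕ → ℕ → ℕ → Prop) : Prop :=
  ∀ x < tsize r k, T x = ind (∃ c, Colors r k x Arc σ c ∧
    ∀ u v, σ u = s → σ v = t → ¬ K x (c u) (c v))

/-- `T` says for which tournaments and sets of colors there is a coloring. -/
def IsTable (r k : ℕ) (T : ℕ → ℕ) {V : Type} (Arc : V → V → Prop) (σ : V → ℕ) : Prop :=
  ∀ x < tsize r k, T x = ind (∃ c, Colors r k x Arc σ c)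

section
variable {r k : ℕ} {T T' : ℕ → ℕ} {V V' : Type} {Arc : V → V → Prop} {Arc' : V' → V' → Prop}
  {σ : V → ℕ} {σ' : V' → ℕ}

theorem IsTable.le_one (h : IsTable r k T Arc σ) {x : ℕ} (hx : x < tsize r k) : T x ≤ 1 := by
  rw [h x hx]; exact ind_le _

theorem isTable_vertex (r k a : ℕ) :
    IsTable r k (fun x => if 0 < x / 2 ^ (r * a) % 2 ^ r then 1 else 0)
      (fun _ _ : Unit => False) (fun _ => a) := by
  intro x _
  have key : (0 < x / 2 ^ (r * a) % 2 ^ r) ↔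
      ∃ c, Colors r k x (fun _ _ : Unit => False) (fun _ => a) c := by
    constructor
    · intro h
      obtain ⟨i, hi⟩ := Nat.exists_testBit_of_ne_zero h.ne'
      rw [testBit_digit] at hi
      simp only [Bool.and_eq_true, decide_eq_true_eq] at hi
      exact ⟨fun _ => i, fun _ => hi.1, fun _ => hi.2, fun _ _ h => h.elim⟩
    · rintro ⟨c, hc⟩
      refine Nat.pos_of_ne_zero fun h => ?_
      have := testBit_digit x (r * a) r (c ())
      rw [h] at this
      simp [hc.lt (), hc.mem ()] at this
  by_cases h : 0 < x / 2 ^ (r * a) % 2 ^ r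
  · simp only [if_pos h, ind_of (key.1 h)]
  · simp only [if_neg h, ind_of_not (fun h' => h (key.2 h'))]

/-- The arcs of a disjoint union. -/
def sumArc (Arc : V → V → Prop) (Arc' : V' → V' → Prop) : V ⊕ V' → V ⊕ V' → Prop
  | Sum.inl u, Sum.inl v => Arc u v
  | Sum.inr u, Sum.inr v => Arc' u v
  | _, _ => False

/-- No arc joins the two parts and the sets of colors are only upper bounds, so colorings of the
parts for the same entry combine freely. -/
theorem IsTable.union (h : IsTable r k T Arc σ) (h' : IsTable r k T' Arc' σ') :
    IsTable r k (fun x => T x * T' x) (sumArc Arc Arc') (Sum.elim σ σ') := by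
  intro x hx
  simp only [h x hx, h' x hx, ind_mul]
  refine ind_congr ⟨?_, ?_⟩
  · rintro ⟨⟨c, hc⟩, c', hc'⟩
    refine ⟨Sum.elim c c', ?_, ?_, ?_⟩
    · rintro (v | v)
      exacts [hc.lt v, hc'.lt v]
    · rintro (v | v)
      exacts [hc.mem v, hc'.mem v]
    · rintro (u | u) (v | v) huv
      exacts [hc.hom u v huv, huv.elim, huv.elim, hc'.hom u v huv]
  · rintro ⟨c, hc⟩
    exact ⟨⟨c ∘ Sum.inl, fun v => hc.lt (.inl v), fun v => hc.mem (.inl v),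
      fun u v huv => hc.hom (.inl u) (.inl v) huv⟩, c ∘ Sum.inr, fun v => hc.lt (.inr v),
      fun v => hc.mem (.inr v), fun u v huv => hc.hom (.inr u) (.inr v) huv⟩

/-! ### Translation between slots and labels -/

/-- The entry of the table whose sets of colors are those of `x` at the position of `s` for all
slots `s`, if `slot` tells the slots of the labels. The sum is restricted to the labels below
`n`. -/
def permute (r k : ℕ) (slot : ℕ → ℕ) (x n : ℕ) : ℕ :=
  x / 2 ^ (r * k) * 2 ^ (r * k) +
    ∑ a ∈ range n, x / 2 ^ (r * a) % 2 ^ r * if slot a < k then 2 ^ (r * slot a) else 0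

/-- The map from labels to slots is injective on the labels in use. -/
def SlotInj (k : ℕ) (slot : ℕ → ℕ) : Prop :=
  ∀ a < k, ∀ b < k, slot a < k → slot a = slot b → a = b

theorem testBit_permute {slot : ℕ → ℕ} (hinj : SlotInj k slot) (x n : ℕ) (hn : n ≤ k) (m : ℕ) :
    (permute r k slot x n).testBit m = true ↔ (r * k ≤ m ∧ x.testBit m = true) ∨
      ∃ a < n, slot a < k ∧ ∃ i < r, m = r * slot a + i ∧ x.testBit (r * a + i) = true := by
  induction n generalizing m with
  | zero =>
    have := Nat.testBit_two_pow_mul_add (x / 2 ^ (r * k)) (b := 0) (i := r * k) (by positivity) m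
    simp only [permute, range_zero, sum_empty, Nat.mul_comm (x / _)]
    rw [this]
    by_cases h : m < r * k
    · simp [h]
    · rw [if_neg h, Nat.testBit_div_two_pow, Nat.sub_add_cancel (by omega)]
      simp [show r * k ≤ m by omega]
  | succ n ih =>
    have ih := fun m => ih (by omega) m
    by_cases hs : slot n < k
    · have hz : permute r k slot x n / 2 ^ (r * slot n) % 2 ^ r = 0 := by
        refine Nat.eq_of_testBit_eq fun i => ?_
        rw [testBit_digit, Nat.zero_testBit, Bool.and_eq_false_iff, decide_eq_false_iff_not]
        by_contra! hcon
        obtain ⟨hir, hb⟩ := hcon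
        rw [ne_eq, Bool.not_eq_false, ih] at hb
        rcases hb with ⟨hm, -⟩ | ⟨a, ha, hak, j, hj, he, -⟩
        · have := block_lt hir hs; omega
        · have := hinj a (by omega) n (by omega) hak (block_inj hir hj he).1.symm
          omega
      have he : permute r k slot x (n + 1) =
          setDigit r (r * slot n) (x / 2 ^ (r * n) % 2 ^ r) (permute r k slot x n) := by
        simp only [permute] at hz ⊢
        rw [setDigit, hz, sum_range_succ, if_pos hs]; simp [Nat.add_assoc]
      rw [he, testBit_setDigit (Nat.mod_lt _ (by positivity))]
      split_ifs with hm
      · rw [testBit_digit]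
        simp only [Bool.and_eq_true, decide_eq_true_eq]
        constructor
        · rintro ⟨h1, h2⟩
          exact Or.inr ⟨n, by omega, hs, m - r * slot n, h1, by omega, h2⟩
        · rintro (⟨h1, -⟩ | ⟨a, ha, hak, i, hi, h1, h2⟩)
          · have := block_lt (i := m - r * slot n) (r := r) (by omega) hs
            omega
          · have := block_inj hi (show m - r * slot n < r by omega)
              (show r * slot a + i = r * slot n + (m - r * slot n) by omega)
            obtain rfl := hinj a (by omega) n (by omega) hak this.1
            rw [← this.2]; exact ⟨hi, h2⟩
      · rw [ih]
        refine or_congr_right ⟨fun ⟨a, ha, h⟩ => ⟨a, by omega, h⟩, ?_⟩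
        rintro ⟨a, ha, h, i, hi, h1, h2⟩
        refine ⟨a, ?_, h, i, hi, h1, h2⟩
        rcases Nat.lt_succ_iff_lt_or_eq.1 ha with h' | rfl
        · exact h'
        · omega
    · have he : permute r k slot x (n + 1) = permute r k slot x n := by
        simp [permute, sum_range_succ, hs]
      rw [he, ih]
      refine or_congr_right ⟨fun ⟨a, ha, h⟩ => ⟨a, by omega, h⟩, ?_⟩
      rintro ⟨a, ha, h, h1⟩
      refine ⟨a, ?_, h, h1⟩
      rcases Nat.lt_succ_iff_lt_or_eq.1 ha with h' | rfl
      · exact h'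
      · exact absurd h hs

theorem permute_lt {slot : ℕ → ℕ} (hinj : SlotInj k slot) {x n : ℕ} (hn : n ≤ k)
    (hx : x < tsize r k) : permute r k slot x n < tsize r k := by
  refine lt_two_pow_of_bits fun m hm => ?_
  rw [← Bool.not_eq_true, testBit_permute hinj x n hn]
  rintro (⟨-, h⟩ | ⟨a, ha, hak, i, hi, rfl, -⟩)
  · rw [testBit_eq_false_of_lt hx hm] at h; simp at h
  · have := block_lt hi hak; omega

/-- A coloring looks only at the tournament and at the sets of slots that carry vertices, and
`permute` preserves both. Labels without a slot carry no vertices, so their sets may be dropped. -/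
theorem IsTable.permute {slot : ℕ → ℕ} {l : V → ℕ} (hinj : SlotInj k slot)
    (hl : ∀ v, l v < k ∧ slot (l v) < k) (h : IsTable r k T Arc (fun v => slot (l v))) :
    IsTable r k (fun x => T (permute r k slot x k)) Arc l := by
  intro x hx
  have hb := fun m => testBit_permute (r := r) hinj x k le_rfl m
  simp only [h _ (permute_lt hinj le_rfl hx)]
  have hhigh : ∀ m, r * k ≤ m →
      (OrientedColoring.permute r k slot x k).testBit m = x.testBit m := by
    intro m hm
    rw [Bool.eq_iff_iff, hb]
    constructor
    · rintro (⟨-, h⟩ | ⟨a, ha, hak, i, hi, rfl, -⟩)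
      · exact h
      · have := block_lt hi hak; omega
    · exact fun h => Or.inl ⟨hm, h⟩
  have hlow : ∀ v, ∀ i < r, (OrientedColoring.permute r k slot x k).testBit (r * slot (l v) + i) =
      x.testBit (r * l v + i) := by
    intro v i hi
    rw [Bool.eq_iff_iff, hb]
    constructor
    · rintro (⟨h, -⟩ | ⟨a, ha, hak, j, hj, he, h⟩)
      · have := block_lt hi (hl v).2; omega
      · obtain ⟨h1, rfl⟩ := block_inj hi hj he
        rwa [hinj _ (hl v).1 a ha (hl v).2 h1]
    · exact fun h => Or.inr ⟨l v, (hl v).1, (hl v).2, i, hi, rfl, h⟩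
  refine ind_congr (exists_congr fun c => ⟨fun hc => ⟨hc.lt, fun v => ?_, fun u v huv => ?_⟩,
    fun hc => ⟨hc.lt, fun v => ?_, fun u v huv => ?_⟩⟩)
  · rw [← hlow v _ (hc.lt v)]; exact hc.mem v
  · exact (dominates_congr hhigh _ _).1 (hc.hom u v huv)
  · rw [hlow v _ (hc.lt v)]; exact hc.mem v
  · exact (dominates_congr hhigh _ _).2 (hc.hom u v huv)

/-! ### Merging of slots -/

/-- `x` with the set of colors of slot `s` replaced by that of slot `t`. -/
def moveSlot (r s t x : ℕ) : ℕ := setDigit r (r * s) (x / 2 ^ (r * t) % 2 ^ r) x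

theorem testBit_moveSlot (r s t x n : ℕ) : (moveSlot r s t x).testBit n =
    if r * s ≤ n ∧ n < r * s + r then x.testBit (r * t + (n - r * s)) else x.testBit n := by
  rw [moveSlot, testBit_setDigit (Nat.mod_lt _ (by positivity)), testBit_digit]
  split_ifs with h
  · simp [show n - r * s < r by omega]
  · rfl

/-- Idempotence is what allows the table to be updated in place: every entry that is read is a fixed
point and keeps its value. -/
theorem moveSlot_moveSlot (r s t x : ℕ) :
    moveSlot r s t (moveSlot r s t x) = moveSlot r s t x := by
  refine Nat.eq_of_testBit_eq fun n => ?_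
  simp only [testBit_moveSlot]
  by_cases h : r * s ≤ n ∧ n < r * s + r
  · simp only [if_pos h]
    -- The bit that is read lies in block `s` again only if `s = t`, and then nothing moves.
    by_cases h' : r * s ≤ r * t + (n - r * s) ∧ r * t + (n - r * s) < r * s + r
    · rw [if_pos h']
      have := block_inj (show n - r * s < r by omega)
        (show r * t + (n - r * s) - r * s < r by omega)
        (show r * t + (n - r * s) = r * s + (r * t + (n - r * s) - r * s) by omega)
      congr 1; omega
    · rw [if_neg h']
  · simp only [if_neg h]

theorem moveSlot_lt {s t x : ℕ} (hs : s < k) (hx : x < tsize r k) :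
    moveSlot r s t x < tsize r k := by
  refine lt_two_pow_of_bits fun m hm => ?_
  rw [testBit_moveSlot]
  have := Nat.mul_le_mul_left r (Nat.succ_le_of_lt hs)
  rw [if_neg (by rw [Nat.mul_succ] at this; omega)]
  exact testBit_eq_false_of_lt hx hm

/-- After the merge the vertices of slot `s` are bound by the set of slot `t`, which is what the old
table expresses once that set is copied into slot `s`. -/
theorem IsTable.moveSlot {s : ℕ} (t : ℕ) (hs : s < k) (h : IsTable r k T Arc σ) :
    IsTable r k (fun x => T (moveSlot r s t x)) Arc (fun v => if σ v = s then t else σ v) := by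
  intro x hx
  simp only [h _ (moveSlot_lt hs hx)]
  have hhigh : ∀ m, r * k ≤ m →
      (OrientedColoring.moveSlot r s t x).testBit m = x.testBit m := by
    intro m hm
    have := Nat.mul_le_mul_left r (Nat.succ_le_of_lt hs)
    rw [testBit_moveSlot, if_neg (by rw [Nat.mul_succ] at this; omega)]
  have hlow : ∀ v, ∀ i < r, (OrientedColoring.moveSlot r s t x).testBit (r * σ v + i) =
      x.testBit (r * (if σ v = s then t else σ v) + i) := by
    intro v i hi
    rw [testBit_moveSlot]
    by_cases hv : σ v = s
    · rw [if_pos hv, hv, if_pos (by omega)]; congr 1; omega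
    · rw [if_neg hv, if_neg]
      rintro ⟨h1, h2⟩
      exact hv (block_inj hi (show r * σ v + i - r * s < r by omega) (by omega)).1
  refine ind_congr (exists_congr fun c => ⟨fun hc => ⟨hc.lt, fun v => ?_, fun u v huv => ?_⟩,
    fun hc => ⟨hc.lt, fun v => ?_, fun u v huv => ?_⟩⟩)
  · rw [← hlow v _ (hc.lt v)]; exact hc.mem v
  · exact (dominates_congr hhigh _ _).1 (hc.hom u v huv)
  · rw [hlow v _ (hc.lt v)]; exact hc.mem v
  · exact (dominates_congr hhigh _ _).2 (hc.hom u v huv)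

/-! ### Insertion of arcs, one forbidden pair of colors at a time -/

/-- The weight of the lowest color of slot `s`, and `0` if there is no slot `s`. -/
def weight (r k s : ℕ) : ℕ := if s < k then 2 ^ (r * s) else 0

/-- One step of the computation of a table for an insertion of arcs: at the entries that allow two
forbidden colors, one of them is dropped. -/
def forbid (p q w z : ℕ) (T : ℕ → ℕ) (x : ℕ) : ℕ :=
  if x / p % 2 = 1 ∧ x / q % 2 = 1 ∧ x / w % 2 = z then
    if 0 < T (x - p) + T (x - q) then 1 else 0
  else T x

theorem IsTableAvoiding.congr {s t : ℕ} {K K' : ℕ → ℕ → ℕ → Prop}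
    (h : IsTableAvoiding r k T Arc σ s t K)
    (hK : ∀ x < tsize r k, ∀ i < r, ∀ j < r, K x i j ↔ K' x i j) :
    IsTableAvoiding r k T Arc σ s t K' := by
  intro x hx
  rw [h x hx]
  refine ind_congr (exists_congr fun c => and_congr_right fun hc => ?_)
  refine forall₂_congr fun u v => ?_
  rw [hK x hx _ (hc.lt u) _ (hc.lt v)]

/-- Subtracting the power of two clears one bit below the tournament, hence deletes one color from
one set. -/
theorem Colors.sub_iff {x s i : ℕ} {c : V → ℕ} (hs : s < k) (hi : i < r)
    (hb : x.testBit (r * s + i) = true) :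
    Colors r k (x - 2 ^ (r * s + i)) Arc σ c ↔
      Colors r k x Arc σ c ∧ ∀ v, σ v = s → c v ≠ i := by
  have hbits := testBit_sub_two_pow hb
  have hhigh : ∀ m, r * k ≤ m → (x - 2 ^ (r * s + i)).testBit m = x.testBit m := by
    intro m hm
    have := block_lt hi hs
    rw [hbits, decide_eq_true (by omega), Bool.true_and]
  constructor
  · refine fun hc => ⟨⟨hc.lt, fun v => ?_, fun u v huv => ?_⟩, fun v hv hvi => ?_⟩
    · have := hc.mem v
      rw [hbits, Bool.and_eq_true] at this
      exact this.2
    · exact (dominates_congr hhigh _ _).1 (hc.hom u v huv)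
    · have := hc.mem v
      rw [hbits, hv, hvi] at this
      simp at this
  · refine fun ⟨hc, h⟩ => ⟨hc.lt, fun v => ?_, fun u v huv => ?_⟩
    · rw [hbits, hc.mem v, Bool.and_true, decide_eq_true_eq]
      intro he
      obtain ⟨h1, h2⟩ := block_inj (hc.lt v) hi he
      exact h v h1 h2
    · exact (dominates_congr hhigh _ _).2 (hc.hom u v huv)

/-- A coloring avoids the pair `(i, j)` exactly if color `i` is absent from slot `s` or color `j` is
absent from slot `t`; each alternative is an entry with one color deleted. The earlier restrictions
`K` survive the deletion because they depend on the tournament only. -/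
theorem IsTableAvoiding.forbid {s t i j n z : ℕ} {K : ℕ → ℕ → ℕ → Prop} (hi : i < r) (hj : j < r) (hσ : ∀ v, σ v < k)
    (hK : ∀ x y, (∀ m, r * k ≤ m → x.testBit m = y.testBit m) → ∀ a b, K x a b ↔ K y a b)
    (h : IsTableAvoiding r k T Arc σ s t K) :
    IsTableAvoiding r k (forbid (weight r k s * 2 ^ i) (weight r k t * 2 ^ j) (2 ^ n) z T) Arc σ s t
      (fun x a b => K x a b ∨ (a = i ∧ b = j ∧ x / 2 ^ n % 2 = z)) := by
  intro x hx
  unfold OrientedColoring.forbid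
  by_cases hst : s < k ∧ t < k
  swap
  -- A number that is not a slot has weight 0. Division by 0 gives 0, so the test fails at every
  -- entry; and as no vertex has this slot, the new restriction is void.
  · rw [if_neg, h x hx]
    · refine ind_congr (exists_congr fun c => and_congr_right fun hc => ?_)
      refine forall₂_congr fun u v => ?_
      have hu := hσ u
      have hv := hσ v
      exact ⟨fun _ h1 h2 => absurd ⟨h1 ▸ hu, h2 ▸ hv⟩ hst,
        fun _ h1 h2 => absurd ⟨h1 ▸ hu, h2 ▸ hv⟩ hst⟩
    · rw [not_and_or] at hst
      rcases hst with hs | ht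
      · simp [weight, hs]
      · simp [weight, ht]
  obtain ⟨hs, ht⟩ := hst
  simp only [weight, if_pos hs, if_pos ht, ← pow_add]
  -- The colors in use belong to the sets of the entry, so where the test fails the new pair cannot
  -- occur and the entry may stay.
  have hnoop : (¬ (x / 2 ^ (r * s + i) % 2 = 1 ∧ x / 2 ^ (r * t + j) % 2 = 1 ∧
      x / 2 ^ n % 2 = z)) → ∀ c, Colors r k x Arc σ c →
      ∀ u v, σ u = s → σ v = t → ¬ (c u = i ∧ c v = j ∧ x / 2 ^ n % 2 = z) := by
    rintro hcond c hc u v hu hv ⟨h1, h2, h3⟩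
    refine hcond ⟨?_, ?_, h3⟩
    · rw [div_mod_two_eq_one, ← hu, ← h1]; exact hc.mem u
    · rw [div_mod_two_eq_one, ← hv, ← h2]; exact hc.mem v
  split_ifs with hcond hor
  all_goals try
    obtain ⟨hp, hq, hw⟩ := hcond
    rw [div_mod_two_eq_one] at hp hq
    have hTp := h _ ((Nat.sub_le x (2 ^ (r * s + i))).trans_lt hx)
    have hTq := h _ ((Nat.sub_le x (2 ^ (r * t + j))).trans_lt hx)
    simp only [Colors.sub_iff hs hi hp] at hTp
    simp only [Colors.sub_iff ht hj hq] at hTq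
    have hKp := hK (x - 2 ^ (r * s + i)) x (fun m hm => by
      have := block_lt hi hs
      rw [testBit_sub_two_pow hp, decide_eq_true (by omega), Bool.true_and])
    have hKq := hK (x - 2 ^ (r * t + j)) x (fun m hm => by
      have := block_lt hj ht
      rw [testBit_sub_two_pow hq, decide_eq_true (by omega), Bool.true_and])
    simp only [hKp] at hTp
    simp only [hKq] at hTq
    have key : (if 0 < T (x - 2 ^ (r * s + i)) + T (x - 2 ^ (r * t + j)) then 1 else 0) =
        ind (∃ c, Colors r k x Arc σ c ∧ ∀ u v, σ u = s → σ v = t →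
          ¬ (K x (c u) (c v) ∨ (c u = i ∧ c v = j ∧ x / 2 ^ n % 2 = z))) := by
      rw [hTp, hTq, ind_or]
      refine ind_congr ⟨?_, ?_⟩
      · rintro (⟨c, ⟨hc, h1⟩, h2⟩ | ⟨c, ⟨hc, h1⟩, h2⟩)
        · refine ⟨c, hc, fun u v hu hv => ?_⟩
          rintro (h3 | ⟨h3, -, -⟩)
          exacts [h2 u v hu hv h3, h1 u hu h3]
        · refine ⟨c, hc, fun u v hu hv => ?_⟩
          rintro (h3 | ⟨-, h3, -⟩)
          exacts [h2 u v hu hv h3, h1 v hv h3]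
      · rintro ⟨c, hc, h1⟩
        by_cases hex : ∃ u, σ u = s ∧ c u = i
        · obtain ⟨u, hu, hui⟩ := hex
          exact Or.inr ⟨c, ⟨hc, fun v hv hvj => h1 u v hu hv (Or.inr ⟨hui, hvj, hw⟩)⟩,
            fun u v hu hv h3 => h1 u v hu hv (Or.inl h3)⟩
        · exact Or.inl ⟨c, ⟨hc, fun u hu hui => hex ⟨u, hu, hui⟩⟩,
            fun u v hu hv h3 => h1 u v hu hv (Or.inl h3)⟩
  · rw [← key, if_pos hor]
  · rw [← key, if_neg hor]
  · rw [h x hx]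
    refine ind_congr (exists_congr fun c => and_congr_right fun hc => ?_)
    refine ⟨fun h1 u v hu hv => ?_, fun h1 u v hu hv h2 => h1 u v hu hv (Or.inl h2)⟩
    rintro (h2 | h2)
    exacts [h1 u v hu hv h2, hnoop hcond c hc u v hu hv h2]

/-- The pairs of colors that have been forbidden when the loops over the pairs of colors have
reached `j` and `i`. -/
def Forbidden (r k j i x a b : ℕ) : Prop :=
  ¬ Dominates r k x a b ∧ (a < j ∧ b < j ∨ a < i ∧ b = j ∨ a = j ∧ b < i)

theorem forbidden_congr {j i : ℕ} (x y : ℕ) (h : ∀ m, r * k ≤ m → x.testBit m = y.testBit m)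
    (a b : ℕ) : Forbidden r k j i x a b ↔ Forbidden r k j i y a b := by
  unfold Forbidden; rw [dominates_congr h]

theorem not_dominates_self (r k x i : ℕ) : ¬ Dominates r k x i i := by
  rintro (⟨h, -⟩ | ⟨h, -⟩) <;> exact lt_irrefl _ h

theorem not_dominates_lt {x i j : ℕ} (h : i < j) :
    ¬ Dominates r k x i j ↔ x / 2 ^ (r * k + (tri j + i)) % 2 = 0 := by
  have := @div_mod_two_eq_one x (r * k + (tri j + i))
  have h2 := Nat.mod_lt (x / 2 ^ (r * k + (tri j + i))) (show 2 > 0 by norm_num)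
  have h3 : Dominates r k x i j ↔ x.testBit (r * k + (tri j + i)) = true := by
    unfold Dominates; simp [h, not_lt_of_gt h]
  rw [h3, ← this]; omega

theorem not_dominates_gt {x i j : ℕ} (h : i < j) :
    ¬ Dominates r k x j i ↔ x / 2 ^ (r * k + (tri j + i)) % 2 = 1 := by
  have := @div_mod_two_eq_one x (r * k + (tri j + i))
  have h3 : Dominates r k x j i ↔ x.testBit (r * k + (tri j + i)) = false := by
    unfold Dominates; simp [h, not_lt_of_gt h]
  rw [h3, this, Bool.not_eq_false]

/-- Exactly one of `(i, j)` and `(j, i)` is forbidden for `i ≠ j`, and the bit of the pair tells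
which. The two passes treat the entries with bit 0 and with bit 1. -/
theorem IsTableAvoiding.step {s t i j : ℕ} (hij : i < j) (hj : j < r) (hσ : ∀ v, σ v < k)
    (h : IsTableAvoiding r k T Arc σ s t (Forbidden r k j i)) :
    IsTableAvoiding r k
      (OrientedColoring.forbid (weight r k s * 2 ^ j) (weight r k t * 2 ^ i)
        (2 ^ (r * k + (tri j + i))) 1
        (OrientedColoring.forbid (weight r k s * 2 ^ i) (weight r k t * 2 ^ j)
          (2 ^ (r * k + (tri j + i))) 0 T)) Arc σ s t (Forbidden r k j (i + 1)) := by
  have h1 := h.forbid (i := i) (j := j) (n := r * k + (tri j + i)) (z := 0) (hij.trans hj) hj hσ forbidden_congr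
  have h2 := h1.forbid (i := j) (j := i) (n := r * k + (tri j + i)) (z := 1) hj (hij.trans hj) hσ (by
    intro x y hxy a b
    have : x / 2 ^ (r * k + (tri j + i)) % 2 = 0 ↔ y / 2 ^ (r * k + (tri j + i)) % 2 = 0 := by
      rw [← not_dominates_lt hij, ← not_dominates_lt hij, dominates_congr hxy]
    rw [forbidden_congr x y hxy, this])
  refine h2.congr fun x _ a ha b hb => ?_
  rw [← not_dominates_lt hij, ← not_dominates_gt hij]
  unfold Forbidden
  constructor
  · rintro ((⟨h1, h2⟩ | ⟨rfl, rfl, h⟩) | ⟨rfl, rfl, h⟩)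
    · exact ⟨h1, by omega⟩
    · exact ⟨h, by omega⟩
    · exact ⟨h, by omega⟩
  · rintro ⟨hd, hlt⟩
    by_cases ha : a = i ∧ b = j
    · obtain ⟨rfl, rfl⟩ := ha
      exact Or.inl (Or.inr ⟨rfl, rfl, hd⟩)
    by_cases hb : a = j ∧ b = i
    · obtain ⟨rfl, rfl⟩ := hb
      exact Or.inr ⟨rfl, rfl, hd⟩
    exact Or.inl (Or.inl ⟨hd, by omega⟩)

/-- A tournament has no loops, so `(j, j)` is forbidden at every entry. The bit of weight `tsize r
k` lies above all entries, so testing it for 0 always succeeds and the same routine can be used. -/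
theorem IsTableAvoiding.diag {s t j : ℕ} (hj : j < r) (hσ : ∀ v, σ v < k)
    (h : IsTableAvoiding r k T Arc σ s t (Forbidden r k j j)) :
    IsTableAvoiding r k
      (OrientedColoring.forbid (weight r k s * 2 ^ j) (weight r k t * 2 ^ j) (tsize r k) 0 T)
      Arc σ s t (Forbidden r k (j + 1) 0) := by
  have h1 := h.forbid (i := j) (j := j) (z := 0) (n := r * k + tri r) hj hj hσ forbidden_congr
  refine h1.congr fun x hx a ha b hb => ?_
  have : x / 2 ^ (r * k + tri r) % 2 = 0 := by
    rw [Nat.div_eq_of_lt (show x < 2 ^ (r * k + tri r) from hx)]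
  simp only [this, and_true]
  unfold Forbidden
  constructor
  · rintro (⟨h1, h2⟩ | ⟨rfl, rfl⟩)
    · exact ⟨h1, by omega⟩
    · exact ⟨not_dominates_self _ _ _ _, by omega⟩
  · rintro ⟨h1, h2⟩
    by_cases ha : a = j ∧ b = j
    · exact Or.inr ha
    · exact Or.inl ⟨h1, by omega⟩

theorem IsTable.avoiding (h : IsTable r k T Arc σ) (s t : ℕ) :
    IsTableAvoiding r k T Arc σ s t (Forbidden r k 0 0) := by
  intro x hx
  rw [h x hx]
  refine ind_congr (exists_congr fun c => ?_)
  simp [Forbidden]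

/-- Once all pairs of colors have been treated, avoiding the forbidden ones says that the tournament
has an arc for every inserted arc. -/
theorem IsTableAvoiding.isTable {s t : ℕ}
    (h : IsTableAvoiding r k T Arc σ s t (Forbidden r k r 0)) :
    IsTable r k T (fun u v => Arc u v ∨ (σ u = s ∧ σ v = t)) σ := by
  intro x hx
  rw [h x hx]
  refine ind_congr (exists_congr fun c => ⟨fun ⟨hc, h⟩ => ⟨hc.lt, hc.mem, ?_⟩,
    fun hc => ⟨⟨hc.lt, hc.mem, fun u v huv => hc.hom u v (Or.inl huv)⟩, fun u v hu hv hf =>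
      hf.1 (hc.hom u v (Or.inr ⟨hu, hv⟩))⟩⟩)
  rintro u v (huv | ⟨hu, hv⟩)
  · exact hc.hom u v huv
  · by_contra hd
    exact h u v hu hv ⟨hd, Or.inl ⟨hc.lt u, hc.lt v⟩⟩

/-! ### The answer in terms of the table -/

/-- The entry of a table for the tournament `t` and all colors allowed. -/
def fullEntry (r k t : ℕ) : ℕ := 2 ^ (r * k) * t + (2 ^ (r * k) - 1)

theorem testBit_fullEntry (r k t m : ℕ) : (fullEntry r k t).testBit m =
    if m < r * k then true else t.testBit (m - r * k) := by
  rw [fullEntry, Nat.testBit_two_pow_mul_add _ (by have := Nat.two_pow_pos (r * k); omega)]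
  split_ifs with h
  · rw [Nat.testBit_two_pow_sub_one, decide_eq_true h]
  · rfl

theorem fullEntry_lt {t : ℕ} (ht : t < 2 ^ tri r) : fullEntry r k t < tsize r k := by
  have h1 := Nat.two_pow_pos (r * k)
  have h2 := Nat.mul_le_mul_left (2 ^ (r * k)) (Nat.succ_le_of_lt ht)
  rw [tsize, pow_add, fullEntry]
  rw [Nat.mul_succ] at h2
  omega

theorem exists_bits (f : ℕ → Prop) (n : ℕ) : ∃ h < 2 ^ n, ∀ m < n, h.testBit m = true ↔ f m := by
  classical
  refine ⟨Nat.ofBits (n := n) fun i => decide (f i), Nat.ofBits_lt_two_pow _, fun m hm => ?_⟩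
  rw [Nat.testBit_ofBits_lt _ _ hm]; simp

/-- The second condition on an oriented coloring says that all arcs between two color classes point
the same way, so the classes define part of a tournament. Conversely, a tournament has neither loops
nor opposite arcs. -/
theorem hasOrientedColoring_iff (G : Digraph V) (hσ : ∀ v, σ v < k)
    (h : IsTable r k T G.Adj σ) :
    HasOrientedColoring G r ↔ ∃ t < 2 ^ tri r, T (fullEntry r k t) = 1 := by
  constructor
  · rintro ⟨c, hc1, hc2⟩
    -- A pair of colors gets bit 1 if an arc leads from the smaller to the larger color; pairs
    -- without arcs thereby get the other orientation, an arbitrary choice.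
    obtain ⟨t, ht, hb⟩ := exists_bits (fun m => ∃ i j, i < j ∧ m = tri j + i ∧
      ∃ u v, G.Adj u v ∧ (c u : ℕ) = i ∧ (c v : ℕ) = j) (tri r)
    refine ⟨t, ht, ?_⟩
    rw [h _ (fullEntry_lt ht)]
    refine ind_of ⟨fun v => c v, fun v => (c v).2, fun v => ?_, fun u v huv => ?_⟩
    · rw [testBit_fullEntry, if_pos (block_lt (c v).2 (hσ v))]
    · have hbit : ∀ i j, i < j → j < r → ((fullEntry r k t).testBit (r * k + (tri j + i)) = true ↔
          ∃ u v, G.Adj u v ∧ (c u : ℕ) = i ∧ (c v : ℕ) = j) := by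
        intro i j hij hj
        rw [testBit_fullEntry, if_neg (by omega), Nat.add_sub_cancel_left,
          hb _ (tri_add_lt hij hj)]
        constructor
        · rintro ⟨i', j', h1, h2, h3⟩
          obtain ⟨rfl, rfl⟩ := tri_add_inj hij h1 h2
          exact h3
        · exact fun h => ⟨i, j, hij, rfl, h⟩
      have hne : (c u : ℕ) ≠ c v := fun he => hc1 u v huv (Fin.ext he)
      rcases lt_or_gt_of_ne hne with hlt | hlt
      · exact Or.inl ⟨hlt, (hbit _ _ hlt (c v).2).2 ⟨u, v, huv, rfl, rfl⟩⟩
      · refine Or.inr ⟨hlt, ?_⟩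
        rw [← Bool.not_eq_true, hbit _ _ hlt (c u).2]
        rintro ⟨x, y, hxy, hx, hy⟩
        exact hc2 u v x y huv hxy (Fin.ext hx.symm) (Fin.ext hy.symm)
  · rintro ⟨t, ht, hT⟩
    rw [h _ (fullEntry_lt ht)] at hT
    have hex : ∃ c, Colors r k (fullEntry r k t) G.Adj σ c := by
      by_contra hn
      rw [ind_of_not hn] at hT
      simp at hT
    obtain ⟨c, hc⟩ := hex
    refine ⟨fun v => ⟨c v, hc.lt v⟩, fun u v huv he => ?_, fun u v x y huv hxy hvx huy => ?_⟩
    · have := hc.hom u v huv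
      rw [Fin.mk.injEq] at he
      rw [he] at this
      exact not_dominates_self _ _ _ _ this
    · rw [Fin.mk.injEq] at hvx huy
      have h1 := hc.hom u v huv
      have h2 := hc.hom x y hxy
      rw [← hvx, ← huy] at h2
      rcases h1 with ⟨h1, h1'⟩ | ⟨h1, h1'⟩ <;> rcases h2 with ⟨h2, h2'⟩ | ⟨h2, h2'⟩
      · omega
      · rw [h1'] at h2'; simp at h2'
      · rw [h1'] at h2'; simp at h2'
      · omega

end

end OrientedColoring

/-! ### The routines of the program

The variables `2`, `3`, `4` hold `r`, `k` and the number of operations, `5` the size of a table, `6`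
and `7` the numbers `2 ^ (r * k)` and `2 ^ r`, `8` the level of the topmost table, `9` and `10` the
numbers `k + 1` and `(k + 1) ^ 2`, `11` the number of operations done, and `12`, `13`, `14` the
current operation. The other variables are local to the routines. Array `0` holds the weights of the
slots, `1` the slots of the labels, `2` the pairs of slots between which all arcs are present,
`3` the tables in terms of slots, and `4` the tables in terms of labels. -/

namespace OrientedColoring

open WordRAM Finset

/-! ### Frames, word length and constant data -/

/-- `h'` agrees with `h` on the variables below `n`, on the arrays other than `ρ`, and on the
entries below `b` of array `ρ`. -/
structure Frame (n ρ b : ℕ) (h h' : Store) : Prop where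
  var : ∀ x < n, h'.var x = h.var x
  arr : ∀ σ, σ ≠ ρ → h'.arr σ = h.arr σ
  low : ∀ i < b, h'.arr ρ i = h.arr ρ i

section Frame
variable {n m ρ b b' x a i : ℕ} {h h' h'' : Store}

theorem Frame.refl (n ρ b : ℕ) (h : Store) : Frame n ρ b h h :=
  ⟨fun _ _ => rfl, fun _ _ => rfl, fun _ _ => rfl⟩

theorem Frame.trans (h₁ : Frame n ρ b h h') (h₂ : Frame n ρ b h' h'') : Frame n ρ b h h'' :=
  ⟨fun x hx => (h₂.var x hx).trans (h₁.var x hx), fun σ hσ => (h₂.arr σ hσ).trans (h₁.arr σ hσ),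
    fun i hi => (h₂.low i hi).trans (h₁.low i hi)⟩

theorem Frame.mono (h₁ : Frame m ρ b' h h') (hn : n ≤ m) (hb : b ≤ b') : Frame n ρ b h h' :=
  ⟨fun x hx => h₁.var x (by omega), h₁.arr, fun i hi => h₁.low i (by omega)⟩

theorem Frame.set (h₁ : Frame n ρ b h h') (hx : n ≤ x) : Frame n ρ b h (h'.set x a) :=
  ⟨fun y hy => by rw [Store.set_var, if_neg (by omega)]; exact h₁.var y hy, h₁.arr, h₁.low⟩

theorem Frame.put (h₁ : Frame n ρ b h h') (hi : b ≤ i) : Frame n ρ b h (h'.put ρ i a) :=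
  ⟨h₁.var, fun σ hσ => by rw [Store.put_arr, if_neg hσ]; exact h₁.arr σ hσ, fun j hj => by
    rw [Store.put_arr_apply, if_neg (by omega)]; exact h₁.low j hj⟩

end Frame

/-- The words are long enough for `D` levels of tables. -/
structure Room (E : Env) (r k D : ℕ) : Prop where
  one_le : 1 ≤ k
  room : E.L + 10 * (D * tsize r k + (k + 1) * (k + 1) + 1) ≤ E.W

/-- The variables that do not change after the initialization. -/
structure Glob (r k : ℕ) (h : Store) : Prop where
  colors : h.var 2 = r
  labels : h.var 3 = k
  size : h.var 5 = tsize r k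
  sets : h.var 6 = 2 ^ (r * k)
  base : h.var 7 = 2 ^ r
  succ : h.var 9 = k + 1
  sq : h.var 10 = (k + 1) * (k + 1)
  weight : ∀ a ≤ k, h.arr 0 a = weight r k a

theorem Glob.frame {r k n ρ b : ℕ} {h h' : Store} (g : Glob r k h) (f : Frame n ρ b h h')
    (hn : 11 ≤ n) (hρ : ρ ≠ 0) : Glob r k h' := by
  refine ⟨?_, ?_, ?_, ?_, ?_, ?_, ?_, fun a ha => ?_⟩
  · rw [f.var _ (by omega), g.colors]
  · rw [f.var _ (by omega), g.labels]
  · rw [f.var _ (by omega), g.size]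
  · rw [f.var _ (by omega), g.sets]
  · rw [f.var _ (by omega), g.base]
  · rw [f.var _ (by omega), g.succ]
  · rw [f.var _ (by omega), g.sq]
  · rw [f.arr 0 hρ.symm, g.weight a ha]

variable {E : Env} {r k D d : ℕ} {h : Store}

theorem level_le (hd : d < D) : d * tsize r k + tsize r k ≤ D * tsize r k := by
  rw [← Nat.succ_mul]; exact Nat.mul_le_mul_right _ hd

theorem tsize_pos (r k : ℕ) : 0 < tsize r k := Nat.two_pow_pos _

/-! ### The routine for the insertion of arcs -/

/-- The entry with index `e` of the table at level `l` in array `ρ`. -/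
def entry (l e : Expr) : Expr := l * .var 5 + e

/-- One step of the insertion of arcs, for the bits whose weights are in the variables `40`, `41`
and `42`. -/
def forbidProg (z : ℕ) : Prog :=
  forLoop 43 5 (cond (.bin .eq (.var 43 / .var 40 % .lit 2 + .var 43 / .var 41 % .lit 2 +
      .bin .eq (.var 43 / .var 42 % .lit 2) (.lit z)) (.lit 3))
    (write 3 (entry (.var 8) (.var 43)) (.bin .lt (.lit 0)
      (.rd 3 (entry (.var 8) (.var 43 - .var 40)) + .rd 3 (entry (.var 8) (.var 43 - .var 41)))))
    .skip)

/-- An entry with a deleted color fails the test of `forbid`, so a pass over the table does not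
change the entries that it reads. -/
theorem sub_div_mod_two {x p : ℕ} (h : x / p % 2 = 1) : (x - p) / p % 2 = 0 ∧ x - p < x := by
  rcases Nat.eq_zero_or_pos p with rfl | hp
  · simp at h
  have hle : p ≤ x := by
    by_contra hlt
    rw [Nat.div_eq_of_lt (by omega)] at h; simp at h
  have : x / p = (x - p) / p + 1 := by
    conv_lhs => rw [← Nat.sub_add_cancel hle]
    rw [Nat.add_div_right _ hp]
  omega

theorem forbid_of_mod_eq_zero {p q w z x : ℕ} {T : ℕ → ℕ} (h : x / p % 2 = 0 ∨ x / q % 2 = 0) :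
    forbid p q w z T x = T x := by
  rw [forbid, if_neg (by omega)]

theorem forbidProg_spec (hR : Room E r k D) (g : Glob r k h) (hd : h.var 8 = d) (hdD : d < D)
    {z : ℕ} (hz : z ≤ 1) (T : ℕ → ℕ) (hT : ∀ x < tsize r k, h.arr 3 (d * tsize r k + x) = T x)
    (hT1 : ∀ x < tsize r k, T x ≤ 1) :
    Tri E (forbidProg z) h fun h' t => t ≤ 100 * tsize r k + 9 ∧
      Frame 43 3 (d * tsize r k) h h' ∧ ∀ x < tsize r k, h'.arr 3 (d * tsize r k + x) =
        forbid (h.var 40) (h.var 41) (h.var 42) z T x := by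
  have hlev := level_le (r := r) (k := k) hdD
  have hroom := hR.room
  set S := tsize r k with hS
  set p := h.var 40 with hp
  set q := h.var 41 with hq
  set w := h.var 42 with hw
  set B := d * S with hB
  refine Tri.for (fun i h' => Frame 43 3 B h h' ∧ ∀ x < S, h'.arr 3 (B + x) =
    if x < i then forbid p q w z T x else T x) 88 S g.size (by omega) (by omega) (by omega) ?_ ?_ ?_
  · exact ⟨(Frame.refl _ _ _ _).set le_rfl, fun x hx => by simp [hT x hx]⟩
  · rintro i hi h' ⟨f, hf⟩ h43 h5
    have h8 : h'.var 8 = d := by rw [f.var _ (by omega), hd]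
    have h40 : h'.var 40 = p := f.var _ (by omega)
    have h41 : h'.var 41 = q := f.var _ (by omega)
    have h42 : h'.var 42 = w := f.var _ (by omega)
    have m1 := Nat.mod_lt (i / p) (show 2 > 0 by norm_num)
    have m2 := Nat.mod_lt (i / q) (show 2 > 0 by norm_num)
    refine Tri.cond ?_ (fun hc => ?_) (fun hc => ?_)
    · simp only [Expr.ok_eq, Expr.ok_add, Expr.ok_mod, Expr.ok_div, Expr.ok_var, Expr.ok_lit,
        Expr.val_add, Expr.val_mod, Expr.val_div, Expr.val_var, Expr.val_lit, Expr.val_eq, h40, h41,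
        h42, h43]
      split_ifs <;> omega
    -- Three summands, each at most 1, add up to 3 only if all three tests succeed.
    · have hc' : i / p % 2 = 1 ∧ i / q % 2 = 1 ∧ i / w % 2 = z := by
        simp only [Expr.val_add, Expr.val_mod, Expr.val_div, Expr.val_var, Expr.val_lit,
          Expr.val_eq, h40, h41, h42, h43] at hc
        split_ifs at hc <;> omega
      obtain ⟨p0, plt⟩ := sub_div_mod_two hc'.1
      obtain ⟨q0, qlt⟩ := sub_div_mod_two hc'.2.1
      -- This entry has already been visited, but it lacks the tested bit and so still holds its old
      -- value.
      have hep : h'.arr 3 (B + (i - p)) = T (i - p) := by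
        rw [hf _ (by omega), forbid_of_mod_eq_zero (Or.inl p0), ite_self]
      have heq : h'.arr 3 (B + (i - q)) = T (i - q) := by
        rw [hf _ (by omega), forbid_of_mod_eq_zero (Or.inr q0), ite_self]
      have := hT1 (i - p) (by omega)
      have := hT1 (i - q) (by omega)
      refine Tri.write (by omega) ?_ ?_ ?_ ?_
      · simp [entry, h8, h5, h43, ← hB]; omega
      · simp [entry, h8, h5, h40, h41, h43, ← hB, hep, heq]; omega
      · simp [entry, h8, h5, h43, ← hB]; omega
      · refine ⟨by simp [entry], by simp [h43], by simp [h5],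
          (f.put (by simp [entry, h8, h5, h43, ← hB])).set le_rfl, fun x hx => ?_⟩
        simp only [entry, Store.set_arr, Store.put_arr_apply, Expr.val_add, Expr.val_mul,
          Expr.val_var, h8, h5, ← hB, h43, Expr.val_lt, Expr.val_lit, Expr.val_rd, Expr.val_sub,
          h40, h41, hep, heq, true_and, Nat.add_left_cancel_iff]
        rcases lt_trichotomy x i with hx' | rfl | hx'
        · rw [if_neg (by omega), hf x hx, if_pos hx', if_pos (by omega)]
        · rw [if_pos rfl, if_pos (Nat.lt_succ_self _), forbid, if_pos hc']
        · rw [if_neg (by omega), hf x hx, if_neg (by omega), if_neg (by omega)]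
    · refine Tri.skip ⟨by simp, h43, h5, f.set le_rfl, fun x hx => ?_⟩
      have hc' : ¬ (i / p % 2 = 1 ∧ i / q % 2 = 1 ∧ i / w % 2 = z) := by
        rintro ⟨c1, c2, c3⟩
        simp [h40, h41, h42, h43, c1, c2, c3] at hc
      rw [Store.set_arr, hf x hx]
      rcases lt_trichotomy x i with hx' | rfl | hx'
      · rw [if_pos hx', if_pos (by omega)]
      · rw [if_neg (by omega), if_pos (by omega), forbid, if_neg hc']
      · rw [if_neg (by omega), if_neg (by omega)]
  · rintro h' t ⟨f, hf⟩ - - ht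
    refine ⟨by omega, f, fun x hx => by rw [hf x hx, if_pos hx]⟩

theorem forbid_congr {p q w z x : ℕ} {T T' : ℕ → ℕ} (h : ∀ y < tsize r k, T y = T' y)
    (hx : x < tsize r k) : forbid p q w z T x = forbid p q w z T' x := by
  unfold forbid
  rw [h x hx, h (x - p) ((Nat.sub_le _ _).trans_lt hx), h (x - q) ((Nat.sub_le _ _).trans_lt hx)]

theorem IsTableAvoiding.congr_table {T T' : ℕ → ℕ} {V : Type} {Arc : V → V → Prop} {σ : V → ℕ}
    {s t : ℕ} {K : ℕ → ℕ → ℕ → Prop} (h : IsTableAvoiding r k T Arc σ s t K)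
    (hT : ∀ x < tsize r k, T' x = T x) : IsTableAvoiding r k T' Arc σ s t K :=
  fun x hx => (hT x hx).trans (h x hx)

theorem IsTableAvoiding.le_one {T : ℕ → ℕ} {V : Type} {Arc : V → V → Prop} {σ : V → ℕ}
    {s t : ℕ} {K : ℕ → ℕ → ℕ → Prop} (h : IsTableAvoiding r k T Arc σ s t K) (x : ℕ)
    (hx : x < tsize r k) : T x ≤ 1 := by
  rw [h x hx]; exact ind_le _

theorem IsTable.congr_table {T T' : ℕ → ℕ} {V : Type} {Arc : V → V → Prop} {σ : V → ℕ}
    (h : IsTable r k T Arc σ) (hT : ∀ x < tsize r k, T' x = T x) : IsTable r k T' Arc σ :=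
  fun x hx => (hT x hx).trans (h x hx)

/-- The step of the insertion of arcs for the colors whose weights are in the variables `a` and `b`
and the bit whose weight is in variable `w`. -/
def forbidPair (a b w z : ℕ) : Prog :=
  .seq (assign 40 (.var 30 * .var a)) (.seq (assign 41 (.var 31 * .var b))
    (.seq (assign 42 (.var w)) (forbidProg z)))

theorem weight_mul_lt {s i : ℕ} (hi : i < r) : weight r k s * 2 ^ i < 2 ^ (r * k) := by
  unfold weight
  split_ifs with hs
  · rw [← pow_add]
    exact Nat.pow_lt_pow_right (by norm_num) (block_lt hi hs)
  · simp

theorem sets_le (r k : ℕ) : 2 ^ (r * k) ≤ tsize r k :=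
  Nat.pow_le_pow_right (by norm_num) (Nat.le_add_right _ _)

theorem Room.tsize_le (hR : Room E r k D) (hd : d < D) : tsize r k ≤ E.W := by
  have := hR.room
  have := level_le (r := r) (k := k) hd
  omega

theorem forbidPair_spec (hR : Room E r k D) (g : Glob r k h) (hd : h.var 8 = d) (hdD : d < D)
    {a b w z s t i j : ℕ} (hz : z ≤ 1) (ha : a < 40) (hb : b < 40) (hw : w < 40)
    (h30 : h.var 30 = weight r k s) (h31 : h.var 31 = weight r k t) (hi : i < r) (hj : j < r)
    (hai : h.var a = 2 ^ i) (hbj : h.var b = 2 ^ j)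
    (hT1 : ∀ x < tsize r k, h.arr 3 (d * tsize r k + x) ≤ 1) :
    Tri E (forbidPair a b w z) h fun h' t' => t' ≤ 130 * tsize r k ∧
      Frame 40 3 (d * tsize r k) h h' ∧ ∀ x < tsize r k, h'.arr 3 (d * tsize r k + x) =
        forbid (weight r k s * 2 ^ i) (weight r k t * 2 ^ j) (h.var w) z
          (fun x => h.arr 3 (d * tsize r k + x)) x := by
  have hS := hR.tsize_le hdD
  have h1 := weight_mul_lt (k := k) (s := s) hi
  have h2 := weight_mul_lt (k := k) (s := t) hj
  have h3 := sets_le r k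
  have hpos := tsize_pos r k
  refine .seq (.assign (by omega) ?_ (.seq (.assign (by omega) ?_ (.seq (.assign (by omega) ?_
    ?_)))))
  · simp [h30, hai]; omega
  · simp [show b ≠ 40 by omega, h31, hbj]; omega
  · simp; omega
  set h' := ((h.set 40 (Expr.val E h (.var 30 * .var a))).set 41 _).set 42 _ with hh'
  have f : Frame 40 3 (d * tsize r k) h h' :=
    (((Frame.refl _ _ _ _).set (by omega)).set (by omega)).set (by omega)
  refine (forbidProg_spec hR (g.frame f (by omega) (by omega)) ((f.var 8 (by omega)).trans hd) hdD
    hz (fun x => h.arr 3 (d * tsize r k + x)) (fun x _ => rfl) hT1).mono ?_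
  rintro h'' t' ⟨ht', f', hx⟩
  refine ⟨?_, f.trans (f'.mono (by omega) le_rfl), fun x hxS => ?_⟩
  · simp; omega
  · rw [hx x hxS]
    simp [hh', show b ≠ 40 by omega, show w ≠ 40 by omega, show w ≠ 41 by omega, h30, h31, hai, hbj]

/-- Insertion of the arcs from slot `s` to slot `t`, whose weights are in the variables `30` and
`31`. -/
def insertProg : Prog :=
  .seq (assign 36 (.var 6)) (.seq (assign 34 (.lit 1)) (forLoop 32 2
    (.seq (assign 35 (.lit 1)) (.seq
      (forLoop 33 32 (.seq (forbidPair 35 34 36 0) (.seq (forbidPair 34 35 36 1)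
        (.seq (assign 35 (.var 35 + .var 35)) (assign 36 (.var 36 + .var 36))))))
      (.seq (forbidPair 34 34 5 0) (assign 34 (.var 34 + .var 34)))))))

theorem two_pow_colors_le (hk : 1 ≤ k) : 2 ^ r ≤ 2 ^ (r * k) :=
  Nat.pow_le_pow_right (by norm_num) (Nat.le_mul_of_pos_right _ hk)

section
variable {V : Type} {Arc : V → V → Prop} {σ : V → ℕ} {s t : ℕ}

/-- The invariant of the loops of `insertProg`. -/
structure InsertInv (r k d : ℕ) (Arc : V → V → Prop) (σ : V → ℕ) (s t : ℕ) (h : Store) (j i : ℕ)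
    (h' : Store) : Prop where
  frame : Frame 30 3 (d * tsize r k) h h'
  fst : h'.var 30 = weight r k s
  snd : h'.var 31 = weight r k t
  high : h'.var 34 = 2 ^ j
  low : h'.var 35 = 2 ^ i
  bit : h'.var 36 = 2 ^ (r * k + (tri j + i))
  table : IsTableAvoiding r k (fun x => h'.arr 3 (d * tsize r k + x)) Arc σ s t (Forbidden r k j i)

theorem insertProg_inner (hR : Room E r k D) (g : Glob r k h) (hd : h.var 8 = d) (hdD : d < D)
    (hσ : ∀ v, σ v < k) {j : ℕ} (hj : j < r) {h' : Store} (hj' : h'.var 32 = j)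
    (hI : InsertInv r k d Arc σ s t h j 0 h') :
    Tri E (forLoop 33 32 (.seq (forbidPair 35 34 36 0) (.seq (forbidPair 34 35 36 1)
        (.seq (assign 35 (.var 35 + .var 35)) (assign 36 (.var 36 + .var 36)))))) h' fun h'' t' =>
      t' ≤ j * (292 * tsize r k) + 9 ∧ InsertInv r k d Arc σ s t h j j h'' ∧ h''.var 32 = j := by
  have hS := hR.tsize_le hdD
  have hpos := tsize_pos r k
  have hRM := (two_pow_colors_le (r := r) hR.one_le).trans (sets_le r k)
  -- Each round consists of two passes of at most `130 * tsize r k` steps and of two assignments.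
  refine Tri.for (fun i h'' => InsertInv r k d Arc σ s t h j i h'')
    (280 * tsize r k) j hj' (by omega) (by omega) (by omega) ?_ ?_ ?_
  · exact ⟨hI.frame.set (by omega), by simp [hI.fst], by simp [hI.snd], by simp [hI.high],
      by simp [hI.low], by simp [hI.bit], hI.table⟩
  · rintro i hi h₁ hI₁ h33 h32
    have g₁ := g.frame hI₁.frame (by omega) (by omega)
    have hd₁ : h₁.var 8 = d := (hI₁.frame.var 8 (by omega)).trans hd
    refine .seq ((forbidPair_spec hR g₁ hd₁ hdD (by omega) (by omega) (by omega) (by omega)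
      hI₁.fst hI₁.snd (hi.trans hj) hj hI₁.low hI₁.high hI₁.table.le_one).mono ?_)
    rintro h₂ t₂ ⟨ht₂, f₂, hx₂⟩
    have e₂ := fun x hx => f₂.var x hx
    have g₂ := g₁.frame f₂ (by omega) (by omega)
    have T₂ := hI₁.table.forbid (i := i) (j := j) (n := r * k + (tri j + i)) (z := 0) (hi.trans hj)
      hj hσ forbidden_congr
    rw [hI₁.bit] at hx₂
    refine .seq ((forbidPair_spec hR g₂ ((e₂ 8 (by omega)).trans hd₁) hdD (by omega) (by omega)
      (by omega) (by omega) ((e₂ 30 (by omega)).trans hI₁.fst) ((e₂ 31 (by omega)).trans hI₁.snd)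
      hj (hi.trans hj) ((e₂ 34 (by omega)).trans hI₁.high) ((e₂ 35 (by omega)).trans hI₁.low)
      (T₂.congr_table hx₂).le_one).mono ?_)
    rintro h₃ t₃ ⟨ht₃, f₃, hx₃⟩
    have e₃ := fun x hx => (f₃.var x hx).trans (e₂ x hx)
    have b₁ : 2 ^ i + 2 ^ i ≤ 2 ^ r := by
      rw [← Nat.two_mul, ← pow_succ']; exact Nat.pow_le_pow_right (by norm_num) (by omega)
    have b₂ : 2 ^ (r * k + (tri j + i)) + 2 ^ (r * k + (tri j + i)) ≤ tsize r k := by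
      rw [← Nat.two_mul, ← pow_succ']
      have := tri_add_lt hi hj
      exact Nat.pow_le_pow_right (by norm_num) (by omega)
    refine .seq (.assign (by omega) ?_ (.assign (by omega) ?_ ?_))
    · simp [e₃, hI₁.low]; omega
    · simp [e₃, hI₁.bit]; omega
    refine ⟨by simp; omega, by simp [e₃, h33], by simp [e₃, h32], ⟨?_, ?_, ?_, ?_, ?_, ?_, ?_⟩⟩
    · exact (((hI₁.frame.trans (f₂.mono (by omega) le_rfl)).trans
        (f₃.mono (by omega) le_rfl)).set (by omega)).set (by omega) |>.set (by omega)
    · simp [e₃, hI₁.fst]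
    · simp [e₃, hI₁.snd]
    · simp [e₃, hI₁.high]
    · simp [e₃, hI₁.low]; ring
    · simp [e₃, hI₁.bit]; ring
    · refine (hI₁.table.step hi hj hσ).congr_table fun x hx => ?_
      simp only [Store.set_arr]
      rw [hx₃ x hx, e₂ 36 (by omega), hI₁.bit]
      exact forbid_congr (fun y hy => hx₂ y hy) hx
  · rintro h'' t' hI' - h32 ht
    refine ⟨ht.trans ?_, hI', h32⟩
    gcongr; omega

theorem insertProg_spec (hR : Room E r k D) (g : Glob r k h) (hd : h.var 8 = d) (hdD : d < D)
    (hσ : ∀ v, σ v < k) (h30 : h.var 30 = weight r k s) (h31 : h.var 31 = weight r k t)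
    (hT : IsTable r k (fun x => h.arr 3 (d * tsize r k + x)) Arc σ) :
    Tri E insertProg h fun h' t' => t' ≤ 500 * ((r + 1) * (r + 1) * tsize r k) ∧
      Frame 30 3 (d * tsize r k) h h' ∧ IsTable r k (fun x => h'.arr 3 (d * tsize r k + x))
        (fun u v => Arc u v ∨ (σ u = s ∧ σ v = t)) σ := by
  have hS := hR.tsize_le hdD
  have hpos := tsize_pos r k
  have hRM := (two_pow_colors_le (r := r) hR.one_le).trans (sets_le r k)
  refine .seq (.assign (by omega) (by simp) (.seq (.assign (by omega) (by simp; omega) ?_)))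
  -- Each round starts by setting variable `35` to 1, so its value between rounds is irrelevant. The
  -- invariant speaks of the store after this variable has been overwritten.
  refine Tri.for (fun j h' => ∃ b, InsertInv r k d Arc σ s t h j 0 (h'.set 35 b))
    (r * (292 * tsize r k) + 200 * tsize r k) r (by simp [g.colors]) (by omega) (by omega)
    (by omega) ?_ ?_ ?_
  · refine ⟨1, ?_, by simp [h30], by simp [h31], by simp, by simp, by simp [g.sets, tri],
      hT.avoiding s t⟩
    exact ((((Frame.refl _ _ _ _).set (by omega)).set (by omega)).set (by omega)).set (by omega)
  · rintro j hj h₁ ⟨b, hI₁⟩ h32 h2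
    have hI₁' : InsertInv r k d Arc σ s t h j 0 (h₁.set 35 1) := by
      have e : (h₁.set 35 b).set 35 1 = h₁.set 35 1 := by
        ext x
        · simp only [Store.set_var]; split_ifs <;> rfl
        · rfl
      rw [← e]
      have hv : ∀ x, x ≠ 35 → ((h₁.set 35 b).set 35 1).var x = (h₁.set 35 b).var x := by
        intro x hx; simp [hx]
      exact ⟨hI₁.frame.set (by omega), (hv _ (by omega)).trans hI₁.fst,
        (hv _ (by omega)).trans hI₁.snd, (hv _ (by omega)).trans hI₁.high, by simp,
        (hv _ (by omega)).trans hI₁.bit, hI₁.table⟩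
    refine .seq (.assign (by omega) (by simp; omega) ?_)
    refine .seq ((insertProg_inner hR g hd hdD hσ hj (by simpa using h32) hI₁').mono ?_)
    rintro h₂ t₂ ⟨ht₂, hI₂, h32'⟩
    have g₂ := g.frame hI₂.frame (by omega) (by omega)
    refine .seq ((forbidPair_spec hR g₂ ((hI₂.frame.var 8 (by omega)).trans hd) hdD (by omega)
      (by omega) (by omega) (by omega) hI₂.fst hI₂.snd hj hj hI₂.high hI₂.high
      hI₂.table.le_one).mono ?_)
    rintro h₃ t₃ ⟨ht₃, f₃, hx₃⟩
    rw [g₂.size] at hx₃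
    have e₃ := fun x hx => f₃.var x hx
    have b₁ : 2 ^ j + 2 ^ j ≤ 2 ^ r := by
      rw [← Nat.two_mul, ← pow_succ']; exact Nat.pow_le_pow_right (by norm_num) (by omega)
    refine .assign (by omega) ?_ ?_
    · simp [e₃, hI₂.high]; omega
    have hjr : j * (292 * tsize r k) ≤ r * (292 * tsize r k) := by gcongr
    refine ⟨by simp; omega, by simp [e₃, h32'], ?_, 1, ?_, ?_, ?_, ?_, ?_, ?_, ?_⟩
    · simp [e₃, g₂.colors]
    · exact (((hI₂.frame.trans (f₃.mono (by omega) le_rfl)).set (by omega)).set (by omega)).set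
        (by omega)
    · simp [e₃, hI₂.fst]
    · simp [e₃, hI₂.snd]
    · simp [e₃, hI₂.high]; ring
    · simp
    · simp [e₃, hI₂.bit, tri]
    · exact (hI₂.table.diag hj hσ).congr_table fun x hx => hx₃ x hx
  · rintro h' t' ⟨b, hI'⟩ - - ht
    have hf := hI'.frame
    refine ⟨?_, ⟨fun x hx => ?_, hf.arr, hf.low⟩, hI'.table.isTable⟩
    · simp
      nlinarith [Nat.zero_le r, Nat.zero_le (r * tsize r k), Nat.zero_le (r * r * tsize r k),
        Nat.mul_le_mul_left r hpos]
    · have := hf.var x hx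
      rwa [Store.set_var, if_neg (by omega)] at this

end

/-! ### The routines for merging, translating, creating and joining tables -/

/-- Change of slot `s` into slot `t`, whose weights are in the variables `30` and `31`. -/
def moveProg : Prog :=
  forLoop 32 5 (write 3 (entry (.var 8) (.var 32)) (.rd 3 (entry (.var 8)
    (.var 32 - .var 32 / .var 30 % .var 7 * .var 30 + .var 32 / .var 31 % .var 7 * .var 30))))

theorem digit_mul_lt {s : ℕ} (hs : s < k) (x : ℕ) :
    x % 2 ^ r * 2 ^ (r * s) < 2 ^ (r * k) := by
  have h1 : x % 2 ^ r < 2 ^ r := Nat.mod_lt _ (by positivity)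
  calc x % 2 ^ r * 2 ^ (r * s) < 2 ^ r * 2 ^ (r * s) := by gcongr
    _ = 2 ^ (r * (s + 1)) := by rw [← pow_add]; congr 1; ring
    _ ≤ 2 ^ (r * k) := Nat.pow_le_pow_right (by norm_num) (Nat.mul_le_mul_left _ hs)

theorem moveProg_spec (hR : Room E r k D) (g : Glob r k h) (hd : h.var 8 = d) (hdD : d < D)
    {s t : ℕ} (hs : s < k) (h30 : h.var 30 = 2 ^ (r * s)) (h31 : h.var 31 = 2 ^ (r * t)) :
    Tri E moveProg h fun h' t' => t' ≤ 100 * tsize r k + 9 ∧ Frame 30 3 (d * tsize r k) h h' ∧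
      ∀ x < tsize r k, h'.arr 3 (d * tsize r k + x) =
        h.arr 3 (d * tsize r k + moveSlot r s t x) := by
  have hlev := level_le (r := r) (k := k) hdD
  have hroom := hR.room
  have hM := sets_le r k
  set S := tsize r k with hS
  set B := d * S with hB
  refine Tri.for (fun i h' => Frame 32 3 B h h' ∧ ∀ x < S, h'.arr 3 (B + x) =
    if x < i then h.arr 3 (B + moveSlot r s t x) else h.arr 3 (B + x)) 88 S g.size (by omega)
    (by omega) (by omega) ?_ ?_ ?_
  · exact ⟨(Frame.refl _ _ _ _).set le_rfl, fun x hx => by simp⟩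
  · rintro i hi h' ⟨f, hf⟩ h32 h5
    have g' := g.frame f (by omega) (by omega)
    have h8 : h'.var 8 = d := by rw [f.var _ (by omega), hd]
    have h30' : h'.var 30 = 2 ^ (r * s) := by rw [f.var _ (by omega), h30]
    have h31' : h'.var 31 = 2 ^ (r * t) := by rw [f.var _ (by omega), h31]
    have hlt := moveSlot_lt (r := r) (t := t) hs hi
    have hle := digit_mul_lt (r := r) hs (i / 2 ^ (r * t))
    have hle' := digit_mul_lt (r := r) hs (i / 2 ^ (r * s))
    have hval : i - i / 2 ^ (r * s) % 2 ^ r * 2 ^ (r * s) +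
        i / 2 ^ (r * t) % 2 ^ r * 2 ^ (r * s) = moveSlot r s t i := rfl
    -- Whether or not the entry has been visited, its value is the old one, by idempotence.
    have hrd : h'.arr 3 (B + moveSlot r s t i) = h.arr 3 (B + moveSlot r s t i) := by
      rw [hf _ hlt, moveSlot_moveSlot, ite_self]
    refine Tri.write (by omega) ?_ ?_ ?_ ?_
    · simp [entry, h8, h5, h32, ← hB]; omega
    · simp [entry, h8, h5, h32, h30', h31', g'.base, ← hB, hval]; omega
    · simp [entry, h8, h5, h32, ← hB]; omega
    · refine ⟨by simp [entry], by simp [h32], by simp [h5],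
          (f.put (by simp [entry, h8, h5, h32, ← hB])).set le_rfl, fun x hx => ?_⟩
      simp only [entry, Store.set_arr, Store.put_arr_apply, Expr.val_add, Expr.val_mul,
        Expr.val_var, h8, h5, ← hB, h32, Expr.val_rd, Expr.val_sub, Expr.val_mod, Expr.val_div,
        h30', h31', g'.base, hval, hrd, true_and, Nat.add_left_cancel_iff]
      rcases lt_trichotomy x i with hx' | rfl | hx'
      · rw [if_neg (by omega), hf x hx, if_pos hx', if_pos (by omega)]
      · rw [if_pos rfl, if_pos (Nat.lt_succ_self _)]
      · rw [if_neg (by omega), hf x hx, if_neg (by omega), if_neg (by omega)]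
  · rintro h' t ⟨f, hf⟩ - - ht
    refine ⟨by omega, f.mono (by omega) le_rfl, fun x hx => by rw [hf x hx, if_pos hx]⟩

theorem Room.sq_le (hR : Room E r k D) : E.L + 10 * ((k + 1) * (k + 1) + 1) ≤ E.W := by
  have := hR.room
  omega

theorem pair_lt {k a b : ℕ} (ha : a ≤ k) (hb : b ≤ k) :
    a * (k + 1) + b < (k + 1) * (k + 1) := by
  calc a * (k + 1) + b < (a + 1) * (k + 1) := by rw [Nat.succ_mul]; omega
    _ ≤ (k + 1) * (k + 1) := Nat.mul_le_mul_right _ (by omega)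

/-- Forget which arcs are present at the slot in variable `21`. -/
def clearProg : Prog :=
  forLoop 32 9 (.seq (write 2 (.var 21 * .var 9 + .var 32) (.lit 0))
    (write 2 (.var 32 * .var 9 + .var 21) (.lit 0)))

theorem clearProg_spec (hR : Room E r k D) (g : Glob r k h) {t : ℕ} (ht : t ≤ k)
    (h21 : h.var 21 = t) :
    Tri E clearProg h fun h' t' => t' ≤ (k + 1) * 72 + 9 ∧ Frame 30 2 0 h h' ∧
      ∀ i, ((∃ z ≤ k, i = t * (k + 1) + z ∨ i = z * (k + 1) + t) → h'.arr 2 i = 0) ∧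
        ((¬ ∃ z ≤ k, i = t * (k + 1) + z ∨ i = z * (k + 1) + t) → h'.arr 2 i = h.arr 2 i) := by
  have hroom := hR.sq_le
  refine Tri.for (fun n h' => Frame 32 2 0 h h' ∧ ∀ i,
    ((∃ z < n, i = t * (k + 1) + z ∨ i = z * (k + 1) + t) → h'.arr 2 i = 0) ∧
    ((¬ ∃ z < n, i = t * (k + 1) + z ∨ i = z * (k + 1) + t) → h'.arr 2 i = h.arr 2 i)) 60 (k + 1)
    g.succ (by omega) (by omega) (by omega) ?_ ?_ ?_
  · exact ⟨(Frame.refl _ _ _ _).set le_rfl, fun i => by simp⟩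
  · rintro n hn h' ⟨f, hf⟩ h32 h9
    have h21' : h'.var 21 = t := by rw [f.var _ (by omega), h21]
    have p1 := pair_lt (k := k) ht (show n ≤ k by omega)
    have p2 := pair_lt (k := k) (show n ≤ k by omega) ht
    refine .seq (.write (by omega) ?_ (by simp) ?_ (.write (by omega) ?_ (by simp) ?_ ?_))
    · simp [h21', h9, h32]; omega
    · simp [h21', h9, h32]; omega
    · simp [h21', h9, h32]; omega
    · simp [h21', h9, h32]; omega
    · refine ⟨by simp, by simp [h32], by simp [h9],
        ((f.put (Nat.zero_le _)).put (Nat.zero_le _)).set le_rfl, fun i => ?_⟩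
      simp only [Store.set_arr, Store.put_arr_apply, Store.put_var, Expr.val_add, Expr.val_mul,
        Expr.val_var, h21', h9, h32, Expr.val_lit, true_and]
      constructor
      · rintro ⟨z, hz, hi⟩
        split_ifs with c1 c2
        · rfl
        · rfl
        · refine (hf i).1 ⟨z, ?_, hi⟩
          rcases Nat.lt_succ_iff_lt_or_eq.1 hz with hz | rfl
          · exact hz
          · omega
      · intro hi
        rw [if_neg, if_neg, (hf i).2]
        · rintro ⟨z, hz, hi'⟩
          exact hi ⟨z, by omega, hi'⟩
        · exact fun hi' => hi ⟨n, by omega, Or.inl hi'⟩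
        · exact fun hi' => hi ⟨n, by omega, Or.inr hi'⟩
  · rintro h' t' ⟨f, hf⟩ - - ht'
    refine ⟨by omega, f.mono (by omega) le_rfl, fun i => ?_⟩
    simpa [Nat.lt_succ_iff] using hf i

/-- Translation of the topmost table from slots to labels. -/
def flushProg : Prog :=
  forLoop 30 5 (.seq (assign 31 (.var 30 / .var 6 * .var 6)) (.seq
    (forLoop 32 3 (assign 31 (.var 31 + .var 30 / .rd 0 (.var 32) % .var 7 *
      .rd 0 (.rd 1 (.var 32)))))
    (write 4 (entry (.var 8) (.var 30)) (.rd 3 (entry (.var 8) (.var 31))))))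

/-- The values of the map from labels to slots. -/
structure SlotOk (k : ℕ) (h : Store) : Prop where
  le : ∀ a < k, h.arr 1 a ≤ k
  inj : SlotInj k (h.arr 1)

theorem flushProg_spec (hR : Room E r k D) (g : Glob r k h) (hs : SlotOk k h) (hd : h.var 8 = d)
    (hdD : d < D) :
    Tri E flushProg h fun h' t' => t' ≤ tsize r k * (k * 50 + 100) + 9 ∧
      Frame 30 4 (d * tsize r k) h h' ∧ ∀ x < tsize r k, h'.arr 4 (d * tsize r k + x) =
        h.arr 3 (d * tsize r k + permute r k (h.arr 1) x k) := by
  have hlev := level_le (r := r) (k := k) hdD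
  have hroom := hR.room
  have hk := hR.one_le
  have hkk : k + 1 ≤ (k + 1) * (k + 1) := Nat.le_mul_of_pos_right _ (by omega)
  set S := tsize r k with hS
  set B := d * S with hB
  set δ := permute r k (h.arr 1) with hδ
  refine Tri.for (fun i h' => Frame 30 4 B h h' ∧ ∀ x < i, h'.arr 4 (B + x) = h.arr 3 (B + δ x k))
    (k * 50 + 88) S g.size (by omega) (by omega) (by omega) ?_ ?_ ?_
  · exact ⟨(Frame.refl _ _ _ _).set le_rfl, fun x hx => by omega⟩
  · rintro i hi h₁ ⟨f₁, hf₁⟩ h30 h5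
    have g₁ := g.frame f₁ (by omega) (by omega)
    have hlt : ∀ n ≤ k, δ i n < S := fun n hn => permute_lt hs.inj hn hi
    have hdiv : i / 2 ^ (r * k) * 2 ^ (r * k) ≤ i := Nat.div_mul_le_self _ _
    refine .seq (.assign (by omega) ?_ ?_)
    · simp [h30, g₁.sets]; omega
    refine .seq (Tri.for (fun a h' => Frame 31 4 B h₁ h' ∧ h'.arr = h₁.arr ∧ h'.var 31 = δ i a) 38 k
      (by simp [g₁.labels]) (by omega) (by omega) (by omega) ?_ ?_ ?_)
    · refine ⟨((Frame.refl _ _ _ _).set le_rfl).set (by omega), rfl, ?_⟩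
      simp [h30, g₁.sets, hδ, permute]
    · rintro a ha h₂ ⟨f₂, harr, h31⟩ h32 h3
      have h7 : h₂.var 7 = 2 ^ r := by rw [f₂.var _ (by omega), g₁.base]
      have h30₂ : h₂.var 30 = i := by rw [f₂.var _ (by omega), h30]
      have hsl : h₂.arr 1 a = h.arr 1 a := by rw [harr, f₁.arr 1 (by omega)]
      have hw : ∀ b ≤ k, h₂.arr 0 b = weight r k b := fun b hb => by rw [harr, g₁.weight b hb]
      -- A label without a slot points to `k`, whose weight is 0, so its set contributes nothing.
      have hsum : δ i a + i / 2 ^ (r * a) % 2 ^ r * weight r k (h.arr 1 a) = δ i (a + 1) := by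
        rw [hδ]; simp only [permute, sum_range_succ, weight]; ring
      have hval : (Expr.var 31 + Expr.var 30 / Expr.rd 0 (Expr.var 32) % Expr.var 7 *
          Expr.rd 0 (Expr.rd 1 (Expr.var 32))).val E h₂ = δ i (a + 1) := by
        simp [h31, h30₂, h32, h7, hsl, hw a ha.le, hw _ (hs.le a ha), weight, ha] at hsum ⊢
        exact hsum
      have hlt' := hlt (a + 1) ha
      have hsle := hs.le a ha
      refine .assign (by omega) ?_ ⟨by simp, by simp [h32], by simp [h3],
        (f₂.set le_rfl).set (by omega), harr, ?_⟩
      · have h1 : (Expr.var 30 / Expr.rd 0 (Expr.var 32) % Expr.var 7 *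
          Expr.rd 0 (Expr.rd 1 (Expr.var 32))).val E h₂ ≤ δ i (a + 1) := by
          rw [← hval]; exact Nat.le_add_left _ _
        rw [Expr.ok_add, ← Expr.val_add, hval, Expr.ok_mul]
        refine ⟨by simp, ⟨?_, ?_, ?_⟩, by omega⟩
        · simp [h32]; omega
        · simp [h32, hsl]; omega
        · rw [← Expr.val_mul]; omega
      · rw [Store.set_var, if_neg (by omega), Store.set_var, if_pos rfl, hval]
    · rintro h₂ t₂ ⟨f₂, harr, h31⟩ h32 h3 ht₂
      have h8 : h₂.var 8 = d := by rw [f₂.var _ (by omega), f₁.var _ (by omega), hd]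
      have h5₂ : h₂.var 5 = S := by rw [f₂.var _ (by omega), h5]
      have h30₂ : h₂.var 30 = i := by rw [f₂.var _ (by omega), h30]
      have hlt' := hlt k le_rfl
      refine .write (by omega) ?_ ?_ ?_ ?_
      · simp [entry, h8, h5₂, h30₂, ← hB]; omega
      · simp [entry, h8, h5₂, h31, ← hB]; omega
      · simp [entry, h8, h5₂, h30₂, ← hB]; omega
      · refine ⟨by simp [entry]; omega, by simp [h30₂], by simp [h5₂],
          ((f₁.trans (f₂.mono (by omega) le_rfl)).put (by simp [entry, h8, h5₂, h30₂, ← hB])).set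
            le_rfl, fun x hx => ?_⟩
        simp only [entry, Store.set_arr, Store.put_arr_apply, Expr.val_add, Expr.val_mul,
          Expr.val_var, h8, h5₂, ← hB, h30₂, Expr.val_rd, h31, true_and, Nat.add_left_cancel_iff]
        rcases Nat.lt_succ_iff_lt_or_eq.1 hx with hx | rfl
        · rw [if_neg (by omega), harr, hf₁ x hx]
        · rw [if_pos rfl, harr, f₁.arr 3 (by omega)]
  · rintro h' t ⟨f, hf⟩ - - ht
    refine ⟨ht.trans (by gcongr), f, hf⟩

/-- The table of a vertex with the label in variable `13`. -/
def vertexProg : Prog :=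
  forLoop 30 5 (write 3 (entry (.var 8) (.var 30))
    (.bin .lt (.lit 0) (.var 30 / .rd 0 (.var 13) % .var 7)))

theorem vertexProg_spec (hR : Room E r k D) (g : Glob r k h) (hd : h.var 8 = d) (hdD : d < D)
    {a : ℕ} (ha : a < k) (h13 : h.var 13 = a) :
    Tri E vertexProg h fun h' t' => t' ≤ 100 * tsize r k + 9 ∧
      Frame 30 3 (d * tsize r k) h h' ∧ ∀ x < tsize r k, h'.arr 3 (d * tsize r k + x) =
        if 0 < x / 2 ^ (r * a) % 2 ^ r then 1 else 0 := by
  have hlev := level_le (r := r) (k := k) hdD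
  have hroom := hR.room
  have hkk : k + 1 ≤ (k + 1) * (k + 1) := Nat.le_mul_of_pos_right _ (by omega)
  set S := tsize r k with hS
  set B := d * S with hB
  refine Tri.for (fun i h' => Frame 30 3 B h h' ∧ ∀ x < i, h'.arr 3 (B + x) =
    if 0 < x / 2 ^ (r * a) % 2 ^ r then 1 else 0) 88 S g.size (by omega) (by omega) (by omega)
    ?_ ?_ ?_
  · exact ⟨(Frame.refl _ _ _ _).set le_rfl, fun x hx => by omega⟩
  · rintro i hi h' ⟨f, hf⟩ h30 h5
    have g' := g.frame f (by omega) (by omega)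
    have h8 : h'.var 8 = d := by rw [f.var _ (by omega), hd]
    have h13' : h'.var 13 = a := by rw [f.var _ (by omega), h13]
    have hw : h'.arr 0 a = 2 ^ (r * a) := by rw [g'.weight a ha.le, weight, if_pos ha]
    refine .write (by omega) ?_ ?_ ?_ ?_
    · simp [entry, h8, h5, h30, ← hB]; omega
    · simp [h13']; omega
    · simp [entry, h8, h5, h30, ← hB]; omega
    · refine ⟨by simp [entry], by simp [h30], by simp [h5],
        (f.put (by simp [entry, h8, h5, h30, ← hB])).set le_rfl, fun x hx => ?_⟩
      simp only [entry, Store.set_arr, Store.put_arr_apply, Expr.val_add, Expr.val_mul,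
        Expr.val_var, h8, h5, ← hB, h30, Expr.val_rd, Expr.val_lt, Expr.val_lit, Expr.val_mod,
        Expr.val_div, h13', hw, g'.base, true_and, Nat.add_left_cancel_iff]
      rcases Nat.lt_succ_iff_lt_or_eq.1 hx with hx | rfl
      · rw [if_neg (by omega), hf x hx]
      · rw [if_pos rfl]
  · rintro h' t ⟨f, hf⟩ - - ht
    refine ⟨by omega, f, hf⟩

/-- The table of a disjoint union. -/
def unionProg : Prog :=
  forLoop 30 5 (write 3 (entry (.var 8) (.var 30))
    (.rd 4 (entry (.var 8) (.var 30)) * .rd 4 (entry (.var 8 + .lit 1) (.var 30))))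

theorem unionProg_spec (hR : Room E r k D) (g : Glob r k h) (hd : h.var 8 = d) (hdD : d + 1 < D)
    (h1 : ∀ x < tsize r k, h.arr 4 (d * tsize r k + x) ≤ 1)
    (h2 : ∀ x < tsize r k, h.arr 4 ((d + 1) * tsize r k + x) ≤ 1) :
    Tri E unionProg h fun h' t' => t' ≤ 100 * tsize r k + 9 ∧
      Frame 30 3 (d * tsize r k) h h' ∧ ∀ x < tsize r k, h'.arr 3 (d * tsize r k + x) =
        h.arr 4 (d * tsize r k + x) * h.arr 4 ((d + 1) * tsize r k + x) := by
  have hlev := level_le (r := r) (k := k) hdD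
  have hroom := hR.room
  have hpos := tsize_pos r k
  have hdS : d + 1 ≤ (d + 1) * tsize r k := Nat.le_mul_of_pos_right _ hpos
  have hB' : (d + 1) * tsize r k = d * tsize r k + tsize r k := Nat.succ_mul _ _
  set S := tsize r k with hS
  set B := d * S with hB
  refine Tri.for (fun i h' => Frame 30 3 B h h' ∧ ∀ x < i, h'.arr 3 (B + x) =
    h.arr 4 (B + x) * h.arr 4 ((d + 1) * S + x)) 88 S g.size (by omega) (by omega) (by omega)
    ?_ ?_ ?_
  · exact ⟨(Frame.refl _ _ _ _).set le_rfl, fun x hx => by omega⟩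
  · rintro i hi h' ⟨f, hf⟩ h30 h5
    have h8 : h'.var 8 = d := by rw [f.var _ (by omega), hd]
    have h4 : h'.arr 4 = h.arr 4 := f.arr 4 (by omega)
    have := Nat.mul_le_mul (h1 i hi) (h2 i hi)
    refine .write (by omega) ?_ ?_ ?_ ?_
    · simp [entry, h8, h5, h30, ← hB]; omega
    · simp [entry, h8, h5, h30, ← hB, h4]; omega
    · simp [entry, h8, h5, h30, ← hB]; omega
    · refine ⟨by simp [entry], by simp [h30], by simp [h5],
        (f.put (by simp [entry, h8, h5, h30, ← hB])).set le_rfl, fun x hx => ?_⟩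
      simp only [entry, Store.set_arr, Store.put_arr_apply, Expr.val_add, Expr.val_mul,
        Expr.val_var, h8, h5, ← hB, h30, Expr.val_rd, Expr.val_lit, h4, true_and,
        Nat.add_left_cancel_iff]
      rcases Nat.lt_succ_iff_lt_or_eq.1 hx with hx | rfl
      · rw [if_neg (by omega), hf x hx]
      · rw [if_pos rfl]
  · rintro h' t ⟨f, hf⟩ - - ht
    refine ⟨by omega, f, hf⟩

/-- Label `a` gets slot `a`, and no arcs are known to be present. -/
def resetProg : Prog :=
  .seq (forLoop 30 3 (write 1 (.var 30) (.var 30))) (forLoop 30 10 (write 2 (.var 30) (.lit 0)))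

theorem resetProg_spec (hR : Room E r k D) (h3 : h.var 3 = k)
    (h10 : h.var 10 = (k + 1) * (k + 1)) :
    Tri E resetProg h fun h' t' => t' ≤ 50 * ((k + 1) * (k + 1)) + 18 ∧
      (∀ x < 30, h'.var x = h.var x) ∧ (∀ ρ, ρ ≠ 1 → ρ ≠ 2 → h'.arr ρ = h.arr ρ) ∧
      (∀ a < k, h'.arr 1 a = a) ∧ ∀ i < (k + 1) * (k + 1), h'.arr 2 i = 0 := by
  have hroom := hR.sq_le
  have hkk : k + 1 ≤ (k + 1) * (k + 1) := Nat.le_mul_of_pos_right _ (by omega)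
  refine .seq (Tri.for (fun n h' => Frame 30 1 0 h h' ∧ ∀ a < n, h'.arr 1 a = a) 12 k h3
    (by omega) (by omega) (by omega) ⟨(Frame.refl _ _ _ _).set le_rfl, fun a ha => by omega⟩ ?_ ?_)
  · rintro n hn h' ⟨f, hf⟩ h30 h3'
    refine .write (by omega) (by simp) (by simp) (by simp [h30]; omega)
      ⟨by simp, by simp [h30], by simp [h3'], (f.put (Nat.zero_le _)).set le_rfl, fun a ha => ?_⟩
    simp only [Store.set_arr, Store.put_arr_apply, Expr.val_var, h30, true_and]
    split_ifs with hc
    · exact hc.symm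
    · exact hf a (by omega)
  rintro h₁ t₁ ⟨f₁, hf₁⟩ - - ht₁
  refine Tri.for (fun n h' => Frame 30 2 0 h₁ h' ∧ ∀ i < n, h'.arr 2 i = 0) 12 ((k + 1) * (k + 1))
    ((f₁.var 10 (by omega)).trans h10) (by omega) (by omega) (by omega)
    ⟨(Frame.refl _ _ _ _).set le_rfl, fun a ha => by omega⟩ ?_ ?_
  · rintro n hn h' ⟨f, hf⟩ h30 h3'
    refine .write (by omega) (by simp) (by simp) (by simp [h30]; omega)
      ⟨by simp, by simp [h30], by simp [h3'], (f.put (Nat.zero_le _)).set le_rfl, fun a ha => ?_⟩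
    simp only [Store.set_arr, Store.put_arr_apply, Expr.val_var, Expr.val_lit, h30, true_and]
    split_ifs with hc
    · rfl
    · exact hf a (by omega)
  · rintro h₂ t₂ ⟨f₂, hf₂⟩ - - ht₂
    refine ⟨by omega, fun x hx => (f₂.var x hx).trans (f₁.var x hx),
      fun ρ h1 h2 => (f₂.arr ρ h2).trans (f₁.arr ρ h1), fun a ha => ?_, hf₂⟩
    rw [f₂.arr 1 (by omega), hf₁ a ha]

/-! ### Lazy slots, marks and amortized time -/

/-- `h'` agrees with `h` on the variables below `20`, on the weights, on the tables in terms of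
labels, and on the tables below level `d`. -/
structure Kept (r k d : ℕ) (h h' : Store) : Prop where
  var : ∀ x < 20, h'.var x = h.var x
  weight : h'.arr 0 = h.arr 0
  labels : h'.arr 4 = h.arr 4
  low : ∀ i < d * tsize r k, h'.arr 3 i = h.arr 3 i

theorem Glob.congr {h' : Store} (g : Glob r k h) (hv : ∀ x < 11, h'.var x = h.var x)
    (ha : h'.arr 0 = h.arr 0) : Glob r k h' := by
  refine ⟨?_, ?_, ?_, ?_, ?_, ?_, ?_, fun a hak => ?_⟩
  · rw [hv _ (by omega), g.colors]
  · rw [hv _ (by omega), g.labels]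
  · rw [hv _ (by omega), g.size]
  · rw [hv _ (by omega), g.sets]
  · rw [hv _ (by omega), g.base]
  · rw [hv _ (by omega), g.succ]
  · rw [hv _ (by omega), g.sq]
  · rw [ha, g.weight a hak]

/-- The store represents a digraph with labels, by its table at level `d`, the slots of its labels
and the pairs of slots between which all arcs are present. -/
structure Chain (r k d : ℕ) (h : Store) {V : Type} (Arc : V → V → Prop) (lab : V → ℕ) : Prop where
  ok : SlotOk k h
  lab_lt : ∀ v, lab v < k
  alive : ∀ v, h.arr 1 (lab v) < k
  flag : ∀ u v, h.arr 2 (h.arr 1 (lab u) * (k + 1) + h.arr 1 (lab v)) ≠ 0 → Arc u v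
  table : IsTable r k (fun x => h.arr 3 (d * tsize r k + x)) Arc (fun v => h.arr 1 (lab v))

/-- The number of pairs of slots that are not known to have all arcs. -/
def openPairs (k : ℕ) (h : Store) : ℕ := #{i ∈ range ((k + 1) * (k + 1)) | h.arr 2 i = 0}

/-- The number of labels that have a slot. -/
def usedLabels (k : ℕ) (h : Store) : ℕ := #{a ∈ range k | h.arr 1 a < k}

/-- The potential that pays for the operations that change the table. -/
def potential (k : ℕ) (h : Store) : ℕ := openPairs k h + 3 * ((k + 1) * usedLabels k h)

/-- The unit of time for operations that change the table. -/
def timeUnit (r k : ℕ) : ℕ := (r + 1) * (r + 1) * tsize r k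

theorem tsize_le_timeUnit (r k : ℕ) : tsize r k ≤ timeUnit r k :=
  Nat.le_mul_of_pos_left _ (by positivity)

theorem timeUnit_pos (r k : ℕ) : 0 < timeUnit r k :=
  (tsize_pos r k).trans_le (tsize_le_timeUnit r k)

/-- The insertion of arcs from label `13` to label `14`. -/
def arcsProg : Prog :=
  .seq (assign 20 (.rd 1 (.var 13))) (.seq (assign 21 (.rd 1 (.var 14)))
    (.seq (assign 22 (.var 20 * .var 9 + .var 21))
      (cond (.bin .eq (.rd 2 (.var 22)) (.lit 0))
        (.seq (write 2 (.var 22) (.lit 1)) (.seq (assign 30 (.rd 0 (.var 20)))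
          (.seq (assign 31 (.rd 0 (.var 21))) insertProg))) .skip)))

section
variable {V : Type} {Arc : V → V → Prop} {lab : V → ℕ}

/-- Distinct labels may share the value `k`, but the label of a vertex has a proper slot, where the
map is injective. -/
theorem Chain.slot_eq_iff (hc : Chain r k d h Arc lab) {a : ℕ} (ha : a < k) (v : V) :
    h.arr 1 (lab v) = h.arr 1 a ↔ lab v = a :=
  ⟨fun e => hc.ok.inj _ (hc.lab_lt v) _ ha (hc.alive v) e, fun e => by rw [e]⟩

theorem openPairs_put_lt {i a : ℕ} (hi : i < (k + 1) * (k + 1)) (h0 : h.arr 2 i = 0)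
    (ha : a ≠ 0) {h' : Store} (hu : h'.arr 2 = Function.update (h.arr 2) i a) :
    openPairs k h' + 1 ≤ openPairs k h := by
  refine card_lt_card ⟨fun j hj => ?_, fun hsub => ?_⟩
  · rw [mem_filter, hu, Function.update_apply] at hj
    rw [mem_filter]
    refine ⟨hj.1, ?_⟩
    have := hj.2
    split_ifs at this with hji
    · exact absurd this ha
    · exact this
  · have := hsub (mem_filter.2 ⟨mem_range.2 hi, h0⟩)
    rw [mem_filter, hu, Function.update_apply, if_pos rfl] at this
    exact ha this.2

/-- If the pair of slots is marked, the arcs are present and nothing is done. Otherwise the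
insertion marks the pair, and the loss of one unit of potential covers its cost. -/
theorem arcsProg_spec (hR : Room E r k D) (g : Glob r k h) (hd : h.var 8 = d) (hdD : d < D)
    (hc : Chain r k d h Arc lab) {a b : ℕ} (ha : a < k) (hb : b < k) (h13 : h.var 13 = a)
    (h14 : h.var 14 = b) :
    Tri E arcsProg h fun h' t => Kept r k d h h' ∧
      Chain r k d h' (fun u v => Arc u v ∨ (lab u = a ∧ lab v = b)) lab ∧
      t + 500 * timeUnit r k * potential k h' ≤ 500 * timeUnit r k * potential k h + 200 := by
  have hroom := hR.sq_le
  have hkk : k + 1 ≤ (k + 1) * (k + 1) := Nat.le_mul_of_pos_right _ (by omega)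
  have hsa := hc.ok.le a ha
  have hsb := hc.ok.le b hb
  have hp := pair_lt hsa hsb
  set s := h.arr 1 a with hs
  set t := h.arr 1 b with ht
  refine .seq (.assign (by omega) (by simp [h13]; omega) (.seq (.assign (by omega)
    (by simp [h14]; omega) (.seq (.assign (by omega) ?_ ?_)))))
  · simp [h13, h14, g.succ, ← hs, ← ht]; omega
  set h₁ := ((h.set 20 (Expr.val E h (.rd 1 (.var 13)))).set 21 _).set 22 _ with hh₁
  have hv : ∀ x < 20, h₁.var x = h.var x := fun x hx => by
    rw [hh₁, Store.set_var, if_neg (by omega), Store.set_var, if_neg (by omega), Store.set_var,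
      if_neg (by omega)]
  have h20 : h₁.var 20 = s := by simp [hh₁, h13, hs]
  have h21 : h₁.var 21 = t := by simp [hh₁, h14, ht]
  have h22 : h₁.var 22 = s * (k + 1) + t := by simp [hh₁, h13, h14, hs, ht, g.succ]
  have harr : h₁.arr = h.arr := rfl
  clear_value h₁
  have hiff : ∀ u v, (lab u = a ∧ lab v = b) ↔
      (h.arr 1 (lab u) = s ∧ h.arr 1 (lab v) = t) := fun u v => by
    rw [hs, ht, hc.slot_eq_iff ha, hc.slot_eq_iff hb]
  refine .cond ?_ (fun hflag => ?_) (fun hflag => ?_)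
  · simp [h22]; omega
  · have hflag : h.arr 2 (s * (k + 1) + t) = 0 := by
      by_contra hne
      simp [h22, harr, hne] at hflag
    refine .seq (.write (by omega) (by simp) (by simp; omega) (by simp [h22]; omega)
      (.seq (.assign (by omega) ?_ (.seq (.assign (by omega) ?_ ?_)))))
    · simp [h20]; omega
    · simp [h21]; omega
    set h₂ := ((h₁.put 2 (Expr.val E h₁ (.var 22)) _).set 30 _).set 31 _ with hh₂
    have hv₂ : ∀ x < 30, h₂.var x = h₁.var x := fun x hx => by
      rw [hh₂, Store.set_var, if_neg (by omega), Store.set_var, if_neg (by omega)]; rfl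
    have harr₂ : ∀ ρ, ρ ≠ 2 → h₂.arr ρ = h.arr ρ := fun ρ hρ => by
      rw [hh₂, Store.set_arr, Store.set_arr, Store.put_arr, if_neg hρ, harr]
    have hfl₂ : h₂.arr 2 = Function.update (h.arr 2) (s * (k + 1) + t) 1 := by
      rw [hh₂, Store.set_arr, Store.set_arr, Store.put_arr, if_pos rfl, harr]
      simp [h22]
    have g₂ : Glob r k h₂ := g.congr
      (fun x hx => (hv₂ x (by omega)).trans (hv x (by omega))) (harr₂ 0 (by omega))
    have h30 : h₂.var 30 = weight r k s := by
      rw [← g.weight s hsa]; simp [hh₂, h20, harr]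
    have h31 : h₂.var 31 = weight r k t := by
      rw [← g.weight t hsb]; simp [hh₂, h21, harr]
    have hd₂ : h₂.var 8 = d := by rw [hv₂ 8 (by omega), hv 8 (by omega), hd]
    clear_value h₂
    refine (insertProg_spec hR g₂ hd₂ hdD (σ := fun v => h.arr 1 (lab v)) (fun v => hc.alive v) h30
      h31 (by rw [harr₂ 3 (by omega)]; exact hc.table)).mono ?_
    rintro h₃ t₃ ⟨ht₃, f₃, hT₃⟩
    have h1₃ : h₃.arr 1 = h.arr 1 := by rw [f₃.arr 1 (by omega), harr₂ 1 (by omega)]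
    have h2₃ : h₃.arr 2 = Function.update (h.arr 2) (s * (k + 1) + t) 1 := by
      rw [f₃.arr 2 (by omega), hfl₂]
    refine ⟨⟨fun x hx => ?_, ?_, ?_, fun i hi => ?_⟩, ⟨⟨?_, ?_⟩, hc.lab_lt, ?_, ?_, ?_⟩, ?_⟩
    · rw [f₃.var x (by omega), hv₂ x (by omega), hv x hx]
    · rw [f₃.arr 0 (by omega), harr₂ 0 (by omega)]
    · rw [f₃.arr 4 (by omega), harr₂ 4 (by omega)]
    · rw [f₃.low i hi, harr₂ 3 (by omega)]
    · rw [h1₃]; exact hc.ok.le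
    · rw [h1₃]; exact hc.ok.inj
    · rw [h1₃]; exact hc.alive
    · intro u v huv
      rw [h1₃, h2₃, Function.update_apply] at huv
      split_ifs at huv with he
      · right
        rw [hiff]
        have hu := hc.alive u
        have hv := hc.alive v
        have := block_inj (r := k + 1) (i := h.arr 1 (lab v)) (j := t) (s := h.arr 1 (lab u))
          (t := s) (by omega) (by omega) (by rw [Nat.mul_comm, he, Nat.mul_comm])
        exact this
      · exact Or.inl (hc.flag u v huv)
    · simp only [hiff, h1₃]; exact hT₃
    · have h1 := openPairs_put_lt (k := k) hp hflag one_ne_zero h2₃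
      have h2 : usedLabels k h₃ = usedLabels k h := by unfold usedLabels; rw [h1₃]
      -- The slots are unchanged and one more pair is marked; one unit of potential is worth `500 *
      -- timeUnit r k` steps, the bound for `insertProg`.
      have h3 : potential k h₃ + 1 ≤ potential k h := by unfold potential; rw [h2]; omega
      have h4 := Nat.mul_le_mul_left (500 * timeUnit r k) h3
      have ht₃' : t₃ ≤ 500 * timeUnit r k := ht₃
      rw [Nat.mul_add] at h4
      simp
      omega
  · have hflag : h.arr 2 (s * (k + 1) + t) ≠ 0 := by
      intro he
      simp [h22, harr, he] at hflag
    refine .skip ⟨⟨hv, by rw [harr], by rw [harr], fun i _ => by rw [harr]⟩,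
      ⟨⟨?_, ?_⟩, hc.lab_lt, ?_, ?_, ?_⟩, ?_⟩
    · rw [harr]; exact hc.ok.le
    · rw [harr]; exact hc.ok.inj
    · rw [harr]; exact hc.alive
    · rw [harr]; exact fun u v huv => Or.inl (hc.flag u v huv)
    · have : (fun u v => Arc u v ∨ (lab u = a ∧ lab v = b)) = Arc := by
        funext u v
        refine propext ⟨?_, Or.inl⟩
        rintro (huv | huv)
        · exact huv
        · rw [hiff] at huv
          refine hc.flag u v ?_
          rw [huv.1, huv.2]; exact hflag
      rw [this, harr]; exact hc.table
    · have : potential k h₁ = potential k h := by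
        unfold potential openPairs usedLabels; rw [harr]
      rw [this]; simp; omega

/-- The change of label `13` into label `14`. -/
def relabelProg : Prog :=
  .seq (assign 20 (.rd 1 (.var 13))) (.seq (assign 21 (.rd 1 (.var 14)))
    (cond (.bin .eq (.var 13) (.var 14)) .skip (cond (.bin .eq (.var 20) (.var 3)) .skip
      (.seq (write 1 (.var 13) (.var 3)) (cond (.bin .eq (.var 21) (.var 3))
        (write 1 (.var 14) (.var 20))
        (.seq (assign 30 (.rd 0 (.var 20))) (.seq (assign 31 (.rd 0 (.var 21)))
          (.seq moveProg clearProg))))))))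

/-- Label `a` gives its slot away and at most `b` gains one. -/
theorem usedLabels_rename_le {a b : ℕ} (ha : a < k) (hsa : h.arr 1 a < k) {h' : Store}
    (h1 : ∀ c < k, c ≠ b → h'.arr 1 c = if c = a then k else h.arr 1 c) :
    usedLabels k h' ≤ usedLabels k h := by
  have hmem : a ∈ ({c ∈ range k | h.arr 1 c < k} : Finset ℕ) :=
    mem_filter.2 ⟨mem_range.2 ha, hsa⟩
  have hsub : ({c ∈ range k | h'.arr 1 c < k} : Finset ℕ) ⊆
      insert b (({c ∈ range k | h.arr 1 c < k} : Finset ℕ).erase a) := by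
    intro c hc
    rw [mem_filter, mem_range] at hc
    rw [mem_insert, mem_erase, mem_filter, mem_range]
    by_cases hcb : c = b
    · exact Or.inl hcb
    · rw [h1 c hc.1 hcb] at hc
      by_cases hca : c = a
      · rw [if_pos hca] at hc; omega
      · rw [if_neg hca] at hc; exact Or.inr ⟨hca, hc⟩
  have := (card_le_card hsub).trans (card_insert_le _ _)
  rw [card_erase_of_mem hmem] at this
  have hpos := card_pos.2 ⟨a, hmem⟩
  unfold usedLabels
  omega

theorem usedLabels_merge_lt {a : ℕ} (ha : a < k) (hsa : h.arr 1 a < k) {h' : Store}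
    (h1 : h'.arr 1 = Function.update (h.arr 1) a k) : usedLabels k h' + 1 ≤ usedLabels k h := by
  refine card_lt_card ⟨fun c hc => ?_, fun hsub => ?_⟩
  · rw [mem_filter, h1, Function.update_apply] at hc
    rw [mem_filter]
    refine ⟨hc.1, ?_⟩
    have := hc.2
    split_ifs at this with hca
    · omega
    · exact this
  · have := hsub (mem_filter.2 ⟨mem_range.2 ha, hsa⟩)
    rw [mem_filter, h1, Function.update_apply, if_pos rfl] at this
    omega

/-- Only the row and the column of `t` are touched, at most `2 * (k + 1)` positions. -/
theorem openPairs_clear_le {t : ℕ} {h' : Store}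
    (h2 : ∀ i, (¬ ∃ z ≤ k, i = t * (k + 1) + z ∨ i = z * (k + 1) + t) → h'.arr 2 i = h.arr 2 i) :
    openPairs k h' ≤ openPairs k h + 2 * (k + 1) := by
  have hsub : ({i ∈ range ((k + 1) * (k + 1)) | h'.arr 2 i = 0} : Finset ℕ) ⊆
      {i ∈ range ((k + 1) * (k + 1)) | h.arr 2 i = 0} ∪
        ((range (k + 1)).image (fun z => t * (k + 1) + z) ∪
          (range (k + 1)).image (fun z => z * (k + 1) + t)) := by
    intro i hi
    rw [mem_filter] at hi
    simp only [mem_union, mem_filter, mem_image, mem_range]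
    by_cases hex : ∃ z ≤ k, i = t * (k + 1) + z ∨ i = z * (k + 1) + t
    · obtain ⟨z, hz, hz' | hz'⟩ := hex
      · exact Or.inr (Or.inl ⟨z, by omega, hz'.symm⟩)
      · exact Or.inr (Or.inr ⟨z, by omega, hz'.symm⟩)
    · rw [h2 i hex] at hi
      exact Or.inl ⟨mem_range.1 hi.1, hi.2⟩
  have h3 := (card_le_card hsub).trans (card_union_le _ _)
  have h4 := card_union_le ((range (k + 1)).image (fun z => t * (k + 1) + z))
    ((range (k + 1)).image (fun z => z * (k + 1) + t))
  have h5 := card_image_le (s := range (k + 1)) (f := fun z => t * (k + 1) + z)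
  have h6 := card_image_le (s := range (k + 1)) (f := fun z => z * (k + 1) + t)
  rw [card_range] at h5 h6
  unfold openPairs
  omega

/-- Nothing happens if the labels agree or if `a` has no slot. If only `b` has no slot, it takes
over that of `a`. Only when both have slots is the table changed, and then a label goes out of use
for good until the next reset of the slots. -/
theorem relabelProg_spec (hR : Room E r k D) (g : Glob r k h) (hd : h.var 8 = d) (hdD : d < D)
    (hc : Chain r k d h Arc lab) {a b : ℕ} (ha : a < k) (hb : b < k) (h13 : h.var 13 = a)
    (h14 : h.var 14 = b) :
    Tri E relabelProg h fun h' t => Kept r k d h h' ∧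
      Chain r k d h' Arc (fun v => if lab v = a then b else lab v) ∧
      t + 500 * timeUnit r k * potential k h' ≤ 500 * timeUnit r k * potential k h + 200 := by
  have hroom := hR.sq_le
  have hkk : k + 1 ≤ (k + 1) * (k + 1) := Nat.le_mul_of_pos_right _ (by omega)
  have hsa := hc.ok.le a ha
  have hsb := hc.ok.le b hb
  set s := h.arr 1 a with hs
  set t := h.arr 1 b with ht
  refine .seq (.assign (by omega) (by simp [h13]; omega) (.seq (.assign (by omega)
    (by simp [h14]; omega) ?_)))
  set h₁ := (h.set 20 (Expr.val E h (.rd 1 (.var 13)))).set 21 _ with hh₁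
  have hv : ∀ x < 20, h₁.var x = h.var x := fun x hx => by
    rw [hh₁, Store.set_var, if_neg (by omega), Store.set_var, if_neg (by omega)]
  have h20 : h₁.var 20 = s := by simp [hh₁, h13, hs]
  have h21 : h₁.var 21 = t := by simp [hh₁, h14, ht]
  have h3 : h₁.var 3 = k := by rw [hv 3 (by omega), g.labels]
  have h13' : h₁.var 13 = a := by rw [hv 13 (by omega), h13]
  have h14' : h₁.var 14 = b := by rw [hv 14 (by omega), h14]
  have harr : h₁.arr = h.arr := rfl
  clear_value h₁
  have hpot : potential k h₁ = potential k h := by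
    unfold potential openPairs usedLabels; rw [harr]
  have hnoop : (∀ v, (if lab v = a then b else lab v) = lab v) → Kept r k d h h₁ ∧
      Chain r k d h₁ Arc (fun v => if lab v = a then b else lab v) := by
    intro hlab
    refine ⟨⟨hv, by rw [harr], by rw [harr], fun i _ => by rw [harr]⟩, ?_⟩
    simp only [hlab]
    exact ⟨⟨by rw [harr]; exact hc.ok.le, by rw [harr]; exact hc.ok.inj⟩, hc.lab_lt,
      by rw [harr]; exact hc.alive, by rw [harr]; exact hc.flag, by rw [harr]; exact hc.table⟩
  refine .cond (by simp) (fun hab => .skip ?_) (fun hab => ?_)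
  · have hab : a = b := by
      by_contra hne
      simp [h13', h14', hne] at hab
    obtain ⟨h1, h2⟩ := hnoop fun v => by split_ifs with hl <;> omega
    exact ⟨h1, h2, by rw [hpot]; simp; omega⟩
  have hab : a ≠ b := by
    rintro rfl
    simp [h13', h14'] at hab
  refine .cond (by simp) (fun hsk => .skip ?_) (fun hsk => ?_)
  · have hsk : s = k := by
      by_contra hne
      simp [h20, h3, hne] at hsk
    obtain ⟨h1, h2⟩ := hnoop fun v => by
      rw [if_neg]
      rintro rfl
      have := hc.alive v
      omega
    exact ⟨h1, h2, by rw [hpot]; simp; omega⟩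
  have hsk : s < k := by
    refine lt_of_le_of_ne hsa fun hne => ?_
    simp [h20, h3, hne] at hsk
  refine .seq (.write (by omega) (by simp) (by simp) (by simp [h13']; omega) ?_)
  simp only [Expr.val_var, h13', h3]
  set h₂ := h₁.put 1 a k with hh₂
  have hv₂ : ∀ x, h₂.var x = h₁.var x := fun x => rfl
  have harr₂ : ∀ ρ, ρ ≠ 1 → h₂.arr ρ = h.arr ρ := fun ρ hρ => by
    rw [hh₂, Store.put_arr, if_neg hρ, harr]
  have hsl₂ : h₂.arr 1 = Function.update (h.arr 1) a k := by
    rw [hh₂, Store.put_arr, if_pos rfl, harr]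
  clear_value h₂
  refine .cond (by simp) (fun htk => ?_) (fun htk => ?_)
  · have htk : t = k := by
      by_contra hne
      simp [hv₂, h21, h3, hne] at htk
    refine .write (by omega) (by simp) (by simp) (by simp [hv₂, h14']; omega) ?_
    simp only [Expr.val_var, hv₂, h14', h20]
    set h₃ := h₂.put 1 b s with hh₃
    have harr₃ : ∀ ρ, ρ ≠ 1 → h₃.arr ρ = h.arr ρ := fun ρ hρ => by
      rw [hh₃, Store.put_arr, if_neg hρ, harr₂ ρ hρ]
    have hsl₃ : ∀ c, h₃.arr 1 c = if c = b then s else if c = a then k else h.arr 1 c := by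
      intro c
      rw [hh₃, Store.put_arr_apply, hsl₂, Function.update_apply]; simp
    have hv₃ : ∀ x < 20, h₃.var x = h.var x := fun x hx => by
      rw [hh₃, Store.put_var, hv₂, hv x hx]
    clear_value h₃
    -- Every vertex keeps its slot under the renaming, so the table and the marks remain valid
    -- without any change.
    have hslot : ∀ v, h₃.arr 1 (if lab v = a then b else lab v) = h.arr 1 (lab v) := by
      intro v
      by_cases hva : lab v = a
      · rw [if_pos hva, hsl₃, if_pos rfl, hva]
      · have := hc.alive v
        rw [if_neg hva, hsl₃, if_neg, if_neg hva]
        rintro rfl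
        omega
    refine ⟨⟨hv₃, harr₃ 0 (by omega), harr₃ 4 (by omega), fun i _ => by rw [harr₃ 3 (by omega)]⟩,
      ⟨⟨fun c hck => ?_, fun c hck c' hck' hlt he => ?_⟩, fun v => ?_, fun v => ?_, ?_, ?_⟩, ?_⟩
    · rw [hsl₃]
      have := hc.ok.le c hck
      split_ifs <;> omega
    · rw [hsl₃] at hlt
      rw [hsl₃, hsl₃] at he
      have hi := hc.ok.inj c hck c' hck'
      have hi1 := hc.ok.inj a ha c' hck' hsk
      have hi2 := hc.ok.inj a ha c hck hsk
      split_ifs at hlt he <;> omega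
    · have := hc.lab_lt v
      split_ifs <;> omega
    · rw [hslot]; exact hc.alive v
    · intro u v huv
      rw [hslot, hslot, harr₃ 2 (by omega)] at huv
      exact hc.flag u v huv
    · simp only [hslot]
      rw [harr₃ 3 (by omega)]; exact hc.table
    · have h1 : openPairs k h₃ = openPairs k h := by unfold openPairs; rw [harr₃ 2 (by omega)]
      have h2 : usedLabels k h₃ ≤ usedLabels k h :=
        usedLabels_rename_le ha hsk (b := b) fun c _ hcb => by rw [hsl₃, if_neg hcb]
      have h3 : potential k h₃ ≤ potential k h := by
        unfold potential; rw [h1]; gcongr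
      have h4 := Nat.mul_le_mul_left (500 * timeUnit r k) h3
      simp
      omega
  have htk : t < k := by
    refine lt_of_le_of_ne hsb fun hne => ?_
    simp [hv₂, h21, h3, hne] at htk
  have hst : s ≠ t := fun he => hab (hc.ok.inj a ha b hb hsk he)
  refine .seq (.assign (by omega) ?_ (.seq (.assign (by omega) ?_ ?_)))
  · simp [hv₂, h20]; omega
  · simp [hv₂, h21]; omega
  set h₃ := (h₂.set 30 (Expr.val E h₂ (.rd 0 (.var 20)))).set 31 _ with hh₃
  have hv₃ : ∀ x < 30, h₃.var x = h₁.var x := fun x hx => by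
    rw [hh₃, Store.set_var, if_neg (by omega), Store.set_var, if_neg (by omega), hv₂]
  have harr₃ : h₃.arr = h₂.arr := rfl
  have h30 : h₃.var 30 = 2 ^ (r * s) := by
    have := g.weight s hsa
    rw [weight, if_pos hsk] at this
    simp [hh₃, hv₂, h20, harr₂, this]
  have h31 : h₃.var 31 = 2 ^ (r * t) := by
    have := g.weight t hsb
    rw [weight, if_pos htk] at this
    simp [hh₃, hv₂, h21, harr₂, this]
  clear_value h₃
  have g₃ : Glob r k h₃ := g.congr (fun x hx => (hv₃ x (by omega)).trans (hv x (by omega)))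
    (by rw [harr₃, harr₂ 0 (by omega)])
  refine .seq ((moveProg_spec hR g₃ (by rw [hv₃ 8 (by omega), hv 8 (by omega), hd]) hdD hsk h30
    h31).mono ?_)
  rintro h₄ t₄ ⟨ht₄, f₄, hT₄⟩
  have g₄ := g₃.frame f₄ (by omega) (by omega)
  refine (clearProg_spec hR g₄ hsb (by rw [f₄.var 21 (by omega), hv₃ 21 (by omega), h21])).mono ?_
  rintro h₅ t₅ ⟨ht₅, f₅, hF₅⟩
  have hsl₅ : h₅.arr 1 = Function.update (h.arr 1) a k := by
    rw [f₅.arr 1 (by omega), f₄.arr 1 (by omega), harr₃, hsl₂]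
  have hfl₄ : h₄.arr 2 = h.arr 2 := by
    rw [f₄.arr 2 (by omega), harr₃, harr₂ 2 (by omega)]
  -- On vertices the slots change exactly by sending `s` to `t`, as in `IsTable.moveSlot`.
  have hslot : ∀ v, h₅.arr 1 (if lab v = a then b else lab v) =
      if h.arr 1 (lab v) = s then t else h.arr 1 (lab v) := by
    intro v
    rw [hsl₅, Function.update_apply]
    by_cases hva : lab v = a
    · rw [if_pos hva, if_neg (Ne.symm hab), hva, if_pos rfl]
    · rw [if_neg hva, if_neg hva, if_neg]
      exact fun he => hva ((hc.slot_eq_iff ha v).1 he)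
  have hslt : ∀ v, (if h.arr 1 (lab v) = s then t else h.arr 1 (lab v)) < k := by
    intro v
    have := hc.alive v
    split_ifs <;> omega
  refine ⟨⟨fun x hx => ?_, ?_, ?_, fun i hi => ?_⟩, ⟨⟨fun c hck => ?_, fun c hck c' hck' hlt he => ?_⟩,
    fun v => ?_, fun v => ?_, ?_, ?_⟩, ?_⟩
  · rw [f₅.var x (by omega), f₄.var x (by omega), hv₃ x (by omega), hv x hx]
  · rw [f₅.arr 0 (by omega), f₄.arr 0 (by omega), harr₃, harr₂ 0 (by omega)]
  · rw [f₅.arr 4 (by omega), f₄.arr 4 (by omega), harr₃, harr₂ 4 (by omega)]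
  · rw [f₅.arr 3 (by omega), f₄.low i hi, harr₃, harr₂ 3 (by omega)]
  · rw [hsl₅, Function.update_apply]
    have := hc.ok.le c hck
    split_ifs <;> omega
  · rw [hsl₅, Function.update_apply] at hlt
    rw [hsl₅, Function.update_apply, Function.update_apply] at he
    have hi := hc.ok.inj c hck c' hck'
    split_ifs at hlt he <;> omega
  · have := hc.lab_lt v
    split_ifs <;> omega
  · rw [hslot]; exact hslt v
  · intro u v huv
    rw [hslot, hslot] at huv
    have hu := hslt u
    have hvlt := hslt v
    -- Marks at `t` were erased, since they need not hold for the vertices that come from `s`. Old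
    -- marks at `s` may remain, because no vertex has this slot any more.
    by_cases hut : (if h.arr 1 (lab u) = s then t else h.arr 1 (lab u)) = t
    · refine absurd ((hF₅ _).1 ⟨_, hvlt.le, Or.inl ?_⟩) huv
      rw [hut]
    by_cases hvt : (if h.arr 1 (lab v) = s then t else h.arr 1 (lab v)) = t
    · refine absurd ((hF₅ _).1 ⟨_, hu.le, Or.inr ?_⟩) huv
      rw [hvt]
    rw [(hF₅ _).2, hfl₄] at huv
    · have hus : h.arr 1 (lab u) ≠ s := fun he => hut (if_pos he)
      have hvs : h.arr 1 (lab v) ≠ s := fun he => hvt (if_pos he)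
      rw [if_neg hus, if_neg hvs] at huv
      exact hc.flag u v huv
    · rintro ⟨z, hz, he | he⟩
      · rw [Nat.mul_comm, Nat.mul_comm t] at he
        exact hut (block_inj (by omega) (by omega) he).1
      · rw [Nat.mul_comm, Nat.mul_comm z] at he
        exact hvt (block_inj (by omega) (by omega) he).2
  · simp only [hslot]
    refine (hc.table.moveSlot t hsk).congr_table fun x hx => ?_
    rw [f₅.arr 3 (by omega), hT₄ x hx, harr₃, harr₂ 3 (by omega)]
  · have h1 : openPairs k h₅ ≤ openPairs k h + 2 * (k + 1) :=
      openPairs_clear_le fun i hi => by rw [(hF₅ i).2 hi, hfl₄]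
    have h2 := usedLabels_merge_lt ha hsk hsl₅
    have h3 := Nat.mul_le_mul_left (k + 1) h2
    -- The lost label releases `3 * (k + 1)`, the erased marks consume at most `2 * (k + 1)`; the
    -- remaining `k + 1` pay for the move and for the clearing.
    have h4 : potential k h₅ + (k + 1) ≤ potential k h := by
      unfold potential
      rw [Nat.mul_add] at h3
      omega
    have h5 := Nat.mul_le_mul_left (500 * timeUnit r k) h4
    have h6 := tsize_le_timeUnit r k
    have h7 : k + 1 ≤ timeUnit r k * (k + 1) := Nat.le_mul_of_pos_left _ (timeUnit_pos r k)
    have h8 : timeUnit r k ≤ timeUnit r k * (k + 1) := Nat.le_mul_of_pos_right _ (by omega)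
    rw [Nat.mul_add, Nat.mul_assoc 500 _ (k + 1)] at h5
    simp
    omega

end

end OrientedColoring

/-! ### Sizes of expressions -/

namespace CWExpr

/-- The number of leaves of the expression tree. -/
def leaves {k : ℕ} : CWExpr k → ℕ
  | vertex _ => 1
  | union X Y => X.leaves + Y.leaves
  | arcs _ _ _ X => X.leaves
  | relabel _ _ X => X.leaves

theorem leaves_pos {k : ℕ} (X : CWExpr k) : 0 < X.leaves := by
  induction X with
  | vertex a => simp [leaves]
  | union X Y hX hY => simp only [leaves]; omega
  | arcs a b hab X hX => exact hX
  | relabel a b X hX => exact hX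

theorem finite_vertex_and_card {k : ℕ} (X : CWExpr k) :
    Finite X.Vertex ∧ Nat.card X.Vertex = X.leaves := by
  induction X with
  | vertex a => exact ⟨inferInstanceAs (Finite Unit), Nat.card_unique (α := Unit)⟩
  | union X Y hX hY =>
    obtain ⟨fX, cX⟩ := hX
    obtain ⟨fY, cY⟩ := hY
    refine ⟨inferInstanceAs (Finite (X.Vertex ⊕ Y.Vertex)), ?_⟩
    exact (Nat.card_sum (α := X.Vertex) (β := Y.Vertex)).trans (by rw [cX, cY]; rfl)
  | arcs a b hab X hX => exact hX
  | relabel a b X hX => exact hX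

theorem length_code {k : ℕ} (X : CWExpr k) : X.code.length = 3 * X.size := by
  induction X with
  | vertex a => rfl
  | union X Y hX hY =>
    simp only [code, size, List.length_append, hX, hY, List.length_cons, List.length_nil]
    omega
  | arcs a b hab X hX =>
    simp only [code, size, List.length_append, hX, List.length_cons, List.length_nil]
    omega
  | relabel a b X hX =>
    simp only [code, size, List.length_append, hX, List.length_cons, List.length_nil]
    omega

theorem leaves_le_size {k : ℕ} (X : CWExpr k) : X.leaves ≤ X.size := by
  induction X with
  | vertex a => exact le_rfl
  | union X Y hX hY => simp only [leaves, size]; omega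
  | arcs a b hab X hX => simp only [leaves, size]; omega
  | relabel a b X hX => simp only [leaves, size]; omega

end CWExpr

/-! ### Creations, unions and the evaluation of an expression -/

namespace OrientedColoring

open WordRAM Finset

variable {E : Env} {r k D d : ℕ} {h : Store}

theorem Chain.of_arr {V : Type} {Arc : V → V → Prop} {lab : V → ℕ} {h' : Store}
    (hc : Chain r k d h Arc lab) (e : h'.arr = h.arr) : Chain r k d h' Arc lab := by
  obtain ⟨⟨h1, h2⟩, h3, h4, h5, h6⟩ := hc
  exact ⟨⟨by rwa [e], by rwa [e]⟩, h3, by rwa [e], by rwa [e], by rwa [e]⟩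

theorem SlotOk.of_arr {h' : Store} (hs : SlotOk k h) (e : h'.arr = h.arr) : SlotOk k h' :=
  ⟨by rw [e]; exact hs.le, by rw [e]; exact hs.inj⟩

theorem potential_of_arr {h' : Store} (e : h'.arr = h.arr) : potential k h' = potential k h := by
  unfold potential openPairs usedLabels; rw [e]

theorem potential_le (k : ℕ) (h : Store) : potential k h ≤ 4 * ((k + 1) * (k + 1)) := by
  have h1 : openPairs k h ≤ (k + 1) * (k + 1) :=
    (card_filter_le _ _).trans (card_range _).le
  have h2 : usedLabels k h ≤ k + 1 :=
    ((card_filter_le _ _).trans (card_range _).le).trans (Nat.le_succ k)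
  have h3 := Nat.mul_le_mul_left (k + 1) h2
  unfold potential
  omega

theorem slotOk_of_id (h1 : ∀ a < k, h.arr 1 a = a) : SlotOk k h :=
  ⟨fun a ha => by rw [h1 a ha]; exact ha.le, fun a ha b hb _ he => by
    rwa [h1 a ha, h1 b hb] at he⟩

theorem chain_of_id {V : Type} {Arc : V → V → Prop} {lab : V → ℕ} (h1 : ∀ a < k, h.arr 1 a = a)
    (h2 : ∀ i < (k + 1) * (k + 1), h.arr 2 i = 0) (hl : ∀ v, lab v < k)
    (hT : IsTable r k (fun x => h.arr 3 (d * tsize r k + x)) Arc lab) : Chain r k d h Arc lab := by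
  have e : ∀ v, h.arr 1 (lab v) = lab v := fun v => h1 _ (hl v)
  refine ⟨slotOk_of_id h1, hl, fun v => by rw [e]; exact hl v, fun u v huv => ?_, ?_⟩
  · rw [e, e] at huv
    exact absurd (h2 _ (pair_lt (hl u).le (hl v).le)) huv
  · simpa only [e] using hT

/-- The creation of a vertex with label `13`. -/
def vertexOp : Prog :=
  .seq flushProg (.seq (assign 8 (.var 8 + .lit 1)) (.seq vertexProg resetProg))

/-- The disjoint union of the two topmost digraphs. -/
def unionOp : Prog :=
  .seq flushProg (.seq (assign 8 (.var 8 - .lit 1)) (.seq unionProg resetProg))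

/-- The time for a creation of a vertex or a disjoint union. -/
def nodeTime (r k : ℕ) : ℕ := 3000 * (timeUnit r k * ((k + 1) * (k + 1)))

/-- A creation or union also pays for the whole potential that it leaves behind, at most `4 * ((k +
1) * (k + 1))`; this takes 2000 of the constant 3000. The 6 steps are the change of level. -/
theorem nodeTime_ge {t₁ t₂ t₃ : ℕ} (h₁ : t₁ ≤ tsize r k * (k * 50 + 100) + 9)
    (h₂ : t₂ ≤ 100 * tsize r k + 9) (h₃ : t₃ ≤ 50 * ((k + 1) * (k + 1)) + 18) (h' : Store) :
    t₁ + (6 + (t₂ + t₃)) + 500 * timeUnit r k * potential k h' ≤ nodeTime r k := by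
  have a1 := tsize_le_timeUnit r k
  have a2 := timeUnit_pos r k
  have a3 := Nat.mul_le_mul_left (timeUnit r k) (potential_le k h')
  have a4 : k * 50 + 100 ≤ 100 * ((k + 1) * (k + 1)) := by nlinarith
  have a5 := Nat.mul_le_mul a1 a4
  have a6 : timeUnit r k ≤ timeUnit r k * ((k + 1) * (k + 1)) :=
    Nat.le_mul_of_pos_right _ (by positivity)
  have a7 : (k + 1) * (k + 1) ≤ timeUnit r k * ((k + 1) * (k + 1)) :=
    Nat.le_mul_of_pos_left _ a2
  rw [Nat.mul_left_comm (timeUnit r k) 4] at a3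
  rw [Nat.mul_left_comm (timeUnit r k) 100] at a5
  unfold nodeTime
  rw [Nat.mul_assoc 500]
  omega

/-- The store after the evaluation of an expression that started at level `d`: the table of that
level is saved in terms of labels, and the lower levels are unchanged. -/
structure Saved (r k d : ℕ) (h h' : Store) : Prop where
  var : ∀ x < 11, x ≠ 8 → h'.var x = h.var x
  level : h'.var 8 = d + 1
  weight : h'.arr 0 = h.arr 0
  saved : ∀ x < tsize r k, h'.arr 4 (d * tsize r k + x) =
    h.arr 3 (d * tsize r k + permute r k (h.arr 1) x k)
  labels : ∀ i < d * tsize r k, h'.arr 4 i = h.arr 4 i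
  slots : ∀ i < (d + 1) * tsize r k, h'.arr 3 i = h.arr 3 i

theorem Glob.of_level {h' : Store} (g : Glob r k h) (hv : ∀ x < 11, x ≠ 8 → h'.var x = h.var x)
    (ha : h'.arr 0 = h.arr 0) : Glob r k h' := by
  refine ⟨?_, ?_, ?_, ?_, ?_, ?_, ?_, fun a hak => ?_⟩
  · rw [hv _ (by omega) (by omega), g.colors]
  · rw [hv _ (by omega) (by omega), g.labels]
  · rw [hv _ (by omega) (by omega), g.size]
  · rw [hv _ (by omega) (by omega), g.sets]
  · rw [hv _ (by omega) (by omega), g.base]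
  · rw [hv _ (by omega) (by omega), g.succ]
  · rw [hv _ (by omega) (by omega), g.sq]
  · rw [ha, g.weight a hak]

/-- Slots and marks exist for the topmost table only, so the table below is first saved in terms of
labels. Only `SlotOk` is required, since at the bottom there is no digraph to save and the copied
entries are meaningless but harmless. -/
theorem vertexOp_spec (hR : Room E r k D) (g : Glob r k h) (hs : SlotOk k h) (hd : h.var 8 = d)
    (hdD : d + 1 < D) {a : ℕ} (ha : a < k) (h13 : h.var 13 = a) :
    Tri E vertexOp h fun h' t => Saved r k d h h' ∧ (∀ x < 20, x ≠ 8 → h'.var x = h.var x) ∧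
      Chain r k (d + 1) h' (fun _ _ : Unit => False) (fun _ => a) ∧
      t + 500 * timeUnit r k * potential k h' ≤ nodeTime r k := by
  have hroom := hR.room
  have hlev := level_le (r := r) (k := k) hdD
  have hB : (d + 1) * tsize r k = d * tsize r k + tsize r k := Nat.succ_mul _ _
  have hdS : d + 1 ≤ (d + 1) * tsize r k := Nat.le_mul_of_pos_right _ (tsize_pos r k)
  refine .seq ((flushProg_spec hR g hs hd (by omega)).mono ?_)
  rintro h₁ t₁ ⟨ht₁, f₁, hT₁⟩
  have hd₁ : h₁.var 8 = d := by rw [f₁.var 8 (by omega), hd]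
  refine .seq (.assign (by omega) (by simp [hd₁]; omega) ?_)
  set h₂ := h₁.set 8 (Expr.val E h₁ (.var 8 + .lit 1)) with hh₂
  have hv₂ : ∀ x, x ≠ 8 → h₂.var x = h₁.var x := fun x hx => by rw [hh₂, Store.set_var, if_neg hx]
  have hd₂ : h₂.var 8 = d + 1 := by simp [hh₂, hd₁]
  have harr₂ : h₂.arr = h₁.arr := rfl
  clear_value h₂
  have g₂ : Glob r k h₂ := (g.frame f₁ (by omega) (by omega)).of_level
    (fun x _ hx => hv₂ x hx) (by rw [harr₂])
  refine .seq ((vertexProg_spec hR g₂ hd₂ hdD ha (by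
    rw [hv₂ 13 (by omega), f₁.var 13 (by omega), h13])).mono ?_)
  rintro h₃ t₃ ⟨ht₃, f₃, hT₃⟩
  have g₃ := g₂.frame f₃ (by omega) (by omega)
  refine (resetProg_spec hR g₃.labels g₃.sq).mono ?_
  rintro h₄ t₄ ⟨ht₄, hv₄, harr₄, h1, h2⟩
  have hv : ∀ x < 20, x ≠ 8 → h₄.var x = h.var x := fun x hx hx8 => by
    rw [hv₄ x (by omega), f₃.var x (by omega), hv₂ x hx8, f₁.var x (by omega)]
  have h34 : h₄.arr 4 = h₁.arr 4 := by
    rw [harr₄ 4 (by omega) (by omega), f₃.arr 4 (by omega), harr₂]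
  refine ⟨⟨fun x hx hx8 => hv x (by omega) hx8, ?_, ?_, fun x hx => ?_, fun i hi => ?_,
    fun i hi => ?_⟩, hv, ?_, ?_⟩
  · rw [hv₄ 8 (by omega), f₃.var 8 (by omega), hd₂]
  · rw [harr₄ 0 (by omega) (by omega), f₃.arr 0 (by omega), harr₂, f₁.arr 0 (by omega)]
  · rw [h34, hT₁ x hx]
  · rw [h34, f₁.low i hi]
  · rw [harr₄ 3 (by omega) (by omega), f₃.low i hi, harr₂, f₁.arr 3 (by omega)]
  · refine chain_of_id h1 h2 (fun _ => ha) ((isTable_vertex r k a).congr_table fun x hx => ?_)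
    rw [harr₄ 3 (by omega) (by omega), hT₃ x hx]
  · exact nodeTime_ge ht₁ ht₃ ht₄ h₄

/-- The first operand was saved in terms of labels, while the second is still given by slots;
translating the latter makes the entries comparable. -/
theorem unionOp_spec (hR : Room E r k D) (g : Glob r k h) (hd : h.var 8 = d + 1)
    (hdD : d + 1 < D) {V V' : Type} {Arc : V → V → Prop} {Arc' : V' → V' → Prop} {lab : V → ℕ}
    {lab' : V' → ℕ} (hl : ∀ v, lab v < k)
    (hT : IsTable r k (fun x => h.arr 4 (d * tsize r k + x)) Arc lab)
    (hc : Chain r k (d + 1) h Arc' lab') :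
    Tri E unionOp h fun h' t => (∀ x < 20, x ≠ 8 → h'.var x = h.var x) ∧ h'.var 8 = d ∧
      h'.arr 0 = h.arr 0 ∧ (∀ i < (d + 1) * tsize r k, h'.arr 4 i = h.arr 4 i) ∧
      (∀ i < d * tsize r k, h'.arr 3 i = h.arr 3 i) ∧
      Chain r k d h' (sumArc Arc Arc') (Sum.elim lab lab') ∧
      t + 500 * timeUnit r k * potential k h' ≤ nodeTime r k := by
  have hroom := hR.room
  have hlev := level_le (r := r) (k := k) hdD
  have hB : (d + 1) * tsize r k = d * tsize r k + tsize r k := Nat.succ_mul _ _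
  refine .seq ((flushProg_spec hR g hc.ok hd hdD).mono ?_)
  rintro h₁ t₁ ⟨ht₁, f₁, hT₁⟩
  have hd₁ : h₁.var 8 = d + 1 := by rw [f₁.var 8 (by omega), hd]
  refine .seq (.assign (by omega) (by simp; omega) ?_)
  set h₂ := h₁.set 8 (Expr.val E h₁ (.var 8 - .lit 1)) with hh₂
  have hv₂ : ∀ x, x ≠ 8 → h₂.var x = h₁.var x := fun x hx => by rw [hh₂, Store.set_var, if_neg hx]
  have hd₂ : h₂.var 8 = d := by simp [hh₂, hd₁]
  have harr₂ : h₂.arr = h₁.arr := rfl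
  clear_value h₂
  have g₂ : Glob r k h₂ := (g.frame f₁ (by omega) (by omega)).of_level
    (fun x _ hx => hv₂ x hx) (by rw [harr₂])
  have hT₂ : IsTable r k (fun x => h₂.arr 4 (d * tsize r k + x)) Arc lab :=
    hT.congr_table fun x hx => by rw [harr₂, f₁.low _ (by omega)]
  have hT₂' : IsTable r k (fun x => h₂.arr 4 ((d + 1) * tsize r k + x)) Arc' lab' :=
    (hc.table.permute hc.ok.inj fun v => ⟨hc.lab_lt v, hc.alive v⟩).congr_table
      fun x hx => by rw [harr₂, hT₁ x hx]
  refine .seq ((unionProg_spec hR g₂ hd₂ hdD (fun x hx => hT₂.le_one hx)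
    (fun x hx => hT₂'.le_one hx)).mono ?_)
  rintro h₃ t₃ ⟨ht₃, f₃, hT₃⟩
  have g₃ := g₂.frame f₃ (by omega) (by omega)
  refine (resetProg_spec hR g₃.labels g₃.sq).mono ?_
  rintro h₄ t₄ ⟨ht₄, hv₄, harr₄, h1, h2⟩
  have hv : ∀ x < 20, x ≠ 8 → h₄.var x = h.var x := fun x hx hx8 => by
    rw [hv₄ x (by omega), f₃.var x (by omega), hv₂ x hx8, f₁.var x (by omega)]
  refine ⟨hv, ?_, ?_, fun i hi => ?_, fun i hi => ?_, ?_, ?_⟩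
  · rw [hv₄ 8 (by omega), f₃.var 8 (by omega), hd₂]
  · rw [harr₄ 0 (by omega) (by omega), f₃.arr 0 (by omega), harr₂, f₁.arr 0 (by omega)]
  · rw [harr₄ 4 (by omega) (by omega), f₃.arr 4 (by omega), harr₂, f₁.low i hi]
  · rw [harr₄ 3 (by omega) (by omega), f₃.low i hi, harr₂, f₁.arr 3 (by omega)]
  · refine chain_of_id h1 h2 ?_ ((hT₂.union hT₂').congr_table fun x hx => ?_)
    · rintro (v | v)
      exacts [hl v, hc.lab_lt v]
    · rw [harr₄ 3 (by omega) (by omega), hT₃ x hx]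
  · exact nodeTime_ge ht₁ ht₃ ht₄ h₄

/-- One operation of the expression. -/
def stepProg : Prog :=
  .seq (assign 12 (.inp (.lit 3 * .var 11 + .lit 3))) (.seq
    (assign 13 (.inp (.lit 3 * .var 11 + .lit 4))) (.seq
    (assign 14 (.inp (.lit 3 * .var 11 + .lit 5)))
    (cond (.var 12) (cond (.bin .lt (.lit 1) (.var 12)) (cond (.bin .lt (.lit 2) (.var 12))
      relabelProg arcsProg) unionOp) vertexOp)))

/-- Operation `p` occupies three words after the three words of the header. Decoding it costs at
most 100 steps. -/
theorem stepProg_spec {p o a b : ℕ} (hp : h.var 11 = p) (hL : 3 * p + 5 < E.L) (hW : E.L ≤ E.W)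
    (ho : E.inp (3 * p + 3) = o) (ha : E.inp (3 * p + 4) = a) (hb : E.inp (3 * p + 5) = b)
    {q : Prog} (hq : o = 0 ∧ q = vertexOp ∨ o = 1 ∧ q = unionOp ∨ o = 2 ∧ q = arcsProg ∨
      o = 3 ∧ q = relabelProg) {P : Store → ℕ → Prop}
    (ht : Tri E q (((h.set 12 o).set 13 a).set 14 b) P) :
    Tri E stepProg h fun h' t => ∃ t', P h' t' ∧ t ≤ t' + 100 := by
  refine .seq (.assign (by omega) (by simp [hp]; omega) (.seq (.assign (by omega)
    (by simp [hp]; omega) (.seq (.assign (by omega) (by simp [hp]; omega) ?_)))))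
  have e : ((h.set 12 (Expr.val E h (.inp (.lit 3 * .var 11 + .lit 3)))).set 13 (Expr.val E
      (h.set 12 (Expr.val E h (.inp (.lit 3 * .var 11 + .lit 3))))
      (.inp (.lit 3 * .var 11 + .lit 4)))).set 14 (Expr.val E
      ((h.set 12 (Expr.val E h (.inp (.lit 3 * .var 11 + .lit 3)))).set 13 (Expr.val E
      (h.set 12 (Expr.val E h (.inp (.lit 3 * .var 11 + .lit 3))))
      (.inp (.lit 3 * .var 11 + .lit 4)))) (.inp (.lit 3 * .var 11 + .lit 5))) =
      ((h.set 12 o).set 13 a).set 14 b := by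
    simp [hp, ho, ha, hb]
  rw [e]
  refine .cond (by simp) (fun h0 => .cond (by simp; omega) (fun h1 => .cond (by simp; omega)
    (fun h2 => ?_) (fun h2 => ?_)) (fun h1 => ?_)) (fun h0 => ?_)
  all_goals simp at h0
  all_goals try simp at h1
  all_goals try simp at h2
  all_goals
    rcases hq with ⟨rfl, rfl⟩ | ⟨rfl, rfl⟩ | ⟨rfl, rfl⟩ | ⟨rfl, rfl⟩ <;>
    first
      | omega
      | exact ht.mono fun h' t hP => ⟨t, hP, by simp; omega⟩

/-- The evaluation of an expression. -/
theorem iter_stepProg (hR : Room E r k D) (X : CWExpr k) : ∀ (d p : ℕ) (h : Store),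
    Glob r k h → SlotOk k h → h.var 8 = d → d + X.leaves < D → h.var 11 = p →
    3 * (p + X.size) + 3 ≤ E.L →
    (∀ i < 3 * X.size, E.inp (3 * p + 3 + i) = X.code.getD i 0) →
    Iter E stepProg 11 4 X.size h fun h' t => Saved r k d h h' ∧ h'.var 11 = p + X.size ∧
      Chain r k (d + 1) h' X.Arc (fun v => (X.label v : ℕ)) ∧
      t + 500 * timeUnit r k * potential k h' ≤
        500 * X.size + (2 * X.leaves - 1) * nodeTime r k := by
  have hroom := hR.room
  induction X with
  | vertex a =>
    intro d p h g hs hd hdD hp hL hin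
    simp only [CWExpr.size, CWExpr.leaves] at hdD hL hin ⊢
    have i0 := hin 0 (by omega)
    have i1 := hin 1 (by omega)
    have i2 := hin 2 (by omega)
    simp only [CWExpr.code, List.getD_cons_zero, List.getD_cons_succ] at i0 i1 i2
    refine (stepProg_spec hp (by omega) (by omega) i0 i1 i2 (Or.inl ⟨rfl, rfl⟩)
      (vertexOp_spec (h := ((h.set 12 0).set 13 a).set 14 0) hR (g.congr (fun x hx => ?_) rfl) (hs.of_arr rfl) (by simpa using hd) hdD a.2
        (by simp))).mono ?_
    · simp [show x ≠ 12 by omega, show x ≠ 13 by omega, show x ≠ 14 by omega]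
    rintro h' t ⟨t', ⟨hS, hv, hc, ht'⟩, ht⟩
    refine ⟨?_, ?_, ⟨fun x hx hx8 => ?_, ?_, hS.weight, hS.saved, hS.labels, hS.slots⟩, by simp [hp],
      Chain.of_arr hc rfl, ?_⟩
    · rw [hv 11 (by omega) (by omega)]; simp
    · rw [hv 4 (by omega) (by omega)]; simp
    · rw [Store.set_var, if_neg (by omega), hv x (by omega) hx8]
      simp [show x ≠ 12 by omega, show x ≠ 13 by omega, show x ≠ 14 by omega]
    · rw [Store.set_var, if_neg (by omega), hS.level]
    · rw [potential_of_arr (Store.set_arr _ _ _)]; omega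
  | union X Y ihX ihY =>
    intro d p h g hs hd hdD hp hL hin
    simp only [CWExpr.size, CWExpr.leaves] at hdD hL hin ⊢
    have lX := X.length_code
    have lY := Y.length_code
    have hYpos := Y.leaves_pos
    have hXpos := X.leaves_pos
    rw [Nat.add_assoc]
    refine Iter.add ((ihX d p h g hs hd (by omega) hp (by omega) fun i hi => ?_).mono ?_)
    · rw [hin i (by omega), CWExpr.code, List.append_assoc, List.getD_append _ _ _ _ (by omega)]
    rintro h₁ t₁ ⟨hS₁, hp₁, hc₁, ht₁⟩
    have g₁ := g.of_level hS₁.var hS₁.weight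
    refine Iter.add ((ihY (d + 1) (p + X.size) h₁ g₁ hc₁.ok hS₁.level (by omega) hp₁ (by omega)
      fun i hi => ?_).mono ?_)
    · have := hin (3 * X.size + i) (by omega)
      rw [CWExpr.code, List.append_assoc, List.getD_append_right _ _ _ _ (by omega),
        List.getD_append _ _ _ _ (by omega), lX, Nat.add_sub_cancel_left] at this
      rw [← this]; congr 1; omega
    rintro h₂ t₂ ⟨hS₂, hp₂, hc₂, ht₂⟩
    have g₂ := g₁.of_level hS₂.var hS₂.weight
    have hop : ∀ i < 3, E.inp (3 * (p + X.size + Y.size) + 3 + i) = [1, 0, 0].getD i 0 := by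
      intro i hi
      have := hin (3 * X.size + 3 * Y.size + i) (by omega)
      rw [CWExpr.code, List.getD_append_right _ _ _ _ (by simp [lX, lY]),
        List.length_append, lX, lY, Nat.add_sub_cancel_left] at this
      rw [← this]; congr 1; omega
    have i0 := hop 0 (by omega)
    have i1 := hop 1 (by omega)
    have i2 := hop 2 (by omega)
    simp only [List.getD_cons_zero, List.getD_cons_succ] at i0 i1 i2
    -- The code of `Y` starts with the creation of a vertex, which saves the table of `X` in terms
    -- of labels; the rest of `Y` works on higher levels and leaves it alone.
    have hTX : IsTable r k (fun x => h₂.arr 4 ((d + 1) * tsize r k + x)) X.Arc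
        (fun v => (X.label v : ℕ)) :=
      (hc₁.table.permute hc₁.ok.inj fun v => ⟨hc₁.lab_lt v, hc₁.alive v⟩).congr_table
        fun x hx => hS₂.saved x hx
    refine (stepProg_spec hp₂ (by omega) (by omega) i0 i1 i2 (Or.inr (Or.inl ⟨rfl, rfl⟩))
      (unionOp_spec (d := d + 1) (h := ((h₂.set 12 1).set 13 0).set 14 0) hR
        (g₂.congr (fun x hx => ?_) rfl) (by simpa using hS₂.level)
        (by omega) (fun v => hc₁.lab_lt v) hTX (hc₂.of_arr rfl))).mono ?_
    · simp [show x ≠ 12 by omega, show x ≠ 13 by omega, show x ≠ 14 by omega]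
    rintro h₃ t₃ ⟨t₃', ⟨hv, h8, h0, h4, h3, hc, ht'⟩, ht⟩
    have hB : (d + 1) * tsize r k = d * tsize r k + tsize r k := Nat.succ_mul _ _
    have hv' : ∀ x < 12, x ≠ 8 → h₃.var x = h₂.var x := fun x hx hx8 => by
      rw [hv x (by omega) hx8]
      simp [show x ≠ 12 by omega, show x ≠ 13 by omega, show x ≠ 14 by omega]
    have hB' : (d + 1 + 1) * tsize r k = (d + 1) * tsize r k + tsize r k := Nat.succ_mul _ _
    have h4' : ∀ i < (d + 1) * tsize r k, h₃.arr 4 i = h₁.arr 4 i := fun i hi => by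
      rw [h4 i (by omega), ← hS₂.labels i hi]; rfl
    refine ⟨hv' 11 (by omega) (by omega), hv' 4 (by omega) (by omega),
      ⟨fun x hx hx8 => ?_, ?_, ?_, fun x hx => ?_, fun i hi => ?_, fun i hi => ?_⟩, ?_, ?_, ?_⟩
    · rw [Store.set_var, if_neg (by omega), hv' x (by omega) hx8, hS₂.var x hx hx8,
        hS₁.var x hx hx8]
    · rw [Store.set_var, if_neg (by omega), h8]
    · rw [Store.set_arr, h0, ← hS₁.weight, ← hS₂.weight]; rfl
    · rw [Store.set_arr, h4' _ (by omega), hS₁.saved x hx]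
    · rw [Store.set_arr, h4' _ (by omega), hS₁.labels i hi]
    · rw [Store.set_arr, h3 i hi, ← hS₁.slots i hi, ← hS₂.slots i (by omega)]; rfl
    · simp [hp₂]; omega
    · have e1 : (CWExpr.union X Y).Arc = sumArc X.Arc Y.Arc := by
        funext u v
        rcases u with u | u <;> rcases v with v | v <;> rfl
      have e2 : (fun v => (((CWExpr.union X Y).label v : Fin k) : ℕ)) =
          Sum.elim (fun v => (X.label v : ℕ)) (fun v => (Y.label v : ℕ)) := by
        funext v
        rcases v with v | v <;> rfl
      rw [e1, e2]
      exact hc.of_arr rfl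
    · rw [potential_of_arr (Store.set_arr _ _ _)]
      -- `2 * leaves - 1` counts the leaves and the unions; this union accounts for the last unit.
      have e3 : 2 * (X.leaves + Y.leaves) - 1 = (2 * X.leaves - 1) + (2 * Y.leaves - 1) + 1 := by
        omega
      rw [e3, Nat.add_mul, Nat.add_mul]
      omega
  | arcs a b hab X ih =>
    intro d p h g hs hd hdD hp hL hin
    simp only [CWExpr.size, CWExpr.leaves] at hdD hL hin ⊢
    have lX := X.length_code
    refine Iter.add ((ih d p h g hs hd hdD hp (by omega) fun i hi => ?_).mono ?_)
    · rw [hin i (by omega), CWExpr.code, List.getD_append _ _ _ _ (by omega)]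
    rintro h₁ t₁ ⟨hS₁, hp₁, hc₁, ht₁⟩
    have hpos := X.leaves_pos
    have g₁ := g.of_level hS₁.var hS₁.weight
    have hop : ∀ i < 3, E.inp (3 * (p + X.size) + 3 + i) = [2, (a : ℕ), (b : ℕ)].getD i 0 := by
      intro i hi
      have := hin (3 * X.size + i) (by omega)
      rw [CWExpr.code, List.getD_append_right _ _ _ _ (by omega), lX,
        Nat.add_sub_cancel_left] at this
      rw [← this]; congr 1; omega
    have i0 := hop 0 (by omega)
    have i1 := hop 1 (by omega)
    have i2 := hop 2 (by omega)
    simp only [List.getD_cons_zero, List.getD_cons_succ] at i0 i1 i2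
    refine (stepProg_spec hp₁ (by omega) (by omega) i0 i1 i2 (Or.inr (Or.inr (Or.inl ⟨rfl, rfl⟩)))
      (arcsProg_spec (d := d + 1) (h := ((h₁.set 12 2).set 13 a).set 14 b) hR
        (g₁.congr (fun x hx => ?_) rfl) (by simpa using hS₁.level)
        (by omega) (hc₁.of_arr rfl) a.2 b.2 (by simp) (by simp))).mono ?_
    · simp [show x ≠ 12 by omega, show x ≠ 13 by omega, show x ≠ 14 by omega]
    rintro h₂ t₂ ⟨t₂', ⟨hK, hc, ht'⟩, ht⟩
    have hv' : ∀ x < 12, h₂.var x = h₁.var x := fun x hx => by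
      rw [hK.var x (by omega)]
      simp [show x ≠ 12 by omega, show x ≠ 13 by omega, show x ≠ 14 by omega]
    refine ⟨hv' 11 (by omega), hv' 4 (by omega), ⟨fun x hx hx8 => ?_, ?_, ?_, fun x hx => ?_,
      fun i hi => ?_, fun i hi => ?_⟩, ?_, ?_, ?_⟩
    · rw [Store.set_var, if_neg (by omega), hv' x (by omega), hS₁.var x hx hx8]
    · rw [Store.set_var, if_neg (by omega), hv' 8 (by omega), hS₁.level]
    · rw [Store.set_arr, hK.weight, ← hS₁.weight]; rfl
    · rw [Store.set_arr, hK.labels, ← hS₁.saved x hx]; rfl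
    · rw [Store.set_arr, hK.labels, ← hS₁.labels i hi]; rfl
    · rw [Store.set_arr, hK.low i hi, ← hS₁.slots i hi]; rfl
    · simp [hp₁]; omega
    · have e1 : (CWExpr.arcs a b hab X).Arc =
          fun u v => X.Arc u v ∨ ((X.label u : ℕ) = a ∧ (X.label v : ℕ) = b) := by
        funext u v
        simp only [CWExpr.Arc, Fin.ext_iff]
      rw [e1]
      exact hc.of_arr rfl
    · rw [potential_of_arr (Store.set_arr _ _ _)]
      rw [potential_of_arr (h := h₁) (h' := ((h₁.set 12 2).set 13 a).set 14 b) rfl] at ht'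
      omega
  | relabel a b X ih =>
    intro d p h g hs hd hdD hp hL hin
    simp only [CWExpr.size, CWExpr.leaves] at hdD hL hin ⊢
    have lX := X.length_code
    refine Iter.add ((ih d p h g hs hd hdD hp (by omega) fun i hi => ?_).mono ?_)
    · rw [hin i (by omega), CWExpr.code, List.getD_append _ _ _ _ (by omega)]
    rintro h₁ t₁ ⟨hS₁, hp₁, hc₁, ht₁⟩
    have hpos := X.leaves_pos
    have g₁ := g.of_level hS₁.var hS₁.weight
    have hop : ∀ i < 3, E.inp (3 * (p + X.size) + 3 + i) = [3, (a : ℕ), (b : ℕ)].getD i 0 := by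
      intro i hi
      have := hin (3 * X.size + i) (by omega)
      rw [CWExpr.code, List.getD_append_right _ _ _ _ (by omega), lX,
        Nat.add_sub_cancel_left] at this
      rw [← this]; congr 1; omega
    have i0 := hop 0 (by omega)
    have i1 := hop 1 (by omega)
    have i2 := hop 2 (by omega)
    simp only [List.getD_cons_zero, List.getD_cons_succ] at i0 i1 i2
    refine (stepProg_spec hp₁ (by omega) (by omega) i0 i1 i2 (Or.inr (Or.inr (Or.inr ⟨rfl, rfl⟩)))
      (relabelProg_spec (d := d + 1) (h := ((h₁.set 12 3).set 13 a).set 14 b) hR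
        (g₁.congr (fun x hx => ?_) rfl) (by simpa using hS₁.level)
        (by omega) (hc₁.of_arr rfl) a.2 b.2 (by simp) (by simp))).mono ?_
    · simp [show x ≠ 12 by omega, show x ≠ 13 by omega, show x ≠ 14 by omega]
    rintro h₂ t₂ ⟨t₂', ⟨hK, hc, ht'⟩, ht⟩
    have hv' : ∀ x < 12, h₂.var x = h₁.var x := fun x hx => by
      rw [hK.var x (by omega)]
      simp [show x ≠ 12 by omega, show x ≠ 13 by omega, show x ≠ 14 by omega]
    refine ⟨hv' 11 (by omega), hv' 4 (by omega), ⟨fun x hx hx8 => ?_, ?_, ?_, fun x hx => ?_,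
      fun i hi => ?_, fun i hi => ?_⟩, ?_, ?_, ?_⟩
    · rw [Store.set_var, if_neg (by omega), hv' x (by omega), hS₁.var x hx hx8]
    · rw [Store.set_var, if_neg (by omega), hv' 8 (by omega), hS₁.level]
    · rw [Store.set_arr, hK.weight, ← hS₁.weight]; rfl
    · rw [Store.set_arr, hK.labels, ← hS₁.saved x hx]; rfl
    · rw [Store.set_arr, hK.labels, ← hS₁.labels i hi]; rfl
    · rw [Store.set_arr, hK.low i hi, ← hS₁.slots i hi]; rfl
    · simp [hp₁]; omega
    · have e1 : (fun v => (((CWExpr.relabel a b X).label v : Fin k) : ℕ)) =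
          fun v => if (X.label v : ℕ) = a then (b : ℕ) else X.label v := by
        funext v
        simp only [CWExpr.label, Fin.ext_iff]
        split_ifs <;> rfl
      rw [e1]
      exact hc.of_arr rfl
    · rw [potential_of_arr (Store.set_arr _ _ _)]
      rw [potential_of_arr (h := h₁) (h' := ((h₁.set 12 3).set 13 a).set 14 b) rfl] at ht'
      omega

/-! ### Initialization and answer -/

/-- The computation of the constants. -/
def initProg : Prog :=
  .seq (assign 2 (.inp (.lit 0))) (.seq (assign 3 (.inp (.lit 1))) (.seq (assign 4 (.inp (.lit 2)))
    (.seq (assign 9 (.var 3 + .lit 1)) (.seq (assign 10 (.var 9 * .var 9))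
    (.seq (assign 7 (.lit 1)) (.seq (forLoop 20 2 (assign 7 (.var 7 + .var 7)))
    (.seq (assign 6 (.lit 1))
    (.seq (forLoop 20 3 (.seq (write 0 (.var 20) (.var 6)) (assign 6 (.var 6 * .var 7))))
    (.seq (assign 5 (.var 6)) (.seq (forLoop 20 2 (forLoop 21 20 (assign 5 (.var 5 + .var 5))))
    resetProg))))))))))

theorem tsize_eq (r k : ℕ) : tsize r k = 2 ^ (r * k + tri r) := rfl

set_option maxHeartbeats 1000000 in
theorem initProg_spec (hR : Room E r k D) (hD : 0 < D) (hL : 3 ≤ E.L) {m : ℕ} (h0 : E.inp 0 = r)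
    (h1 : E.inp 1 = k) (h2 : E.inp 2 = m) (hv : ∀ x, h.var x = 0) (ha : ∀ i, h.arr 0 i = 0) :
    Tri E initProg h fun h' t => t ≤ nodeTime r k ∧ Glob r k h' ∧ SlotOk k h' ∧ h'.var 8 = 0 ∧
      h'.var 4 = m ∧ h'.var 0 = 0 := by
  have hroom := hR.room
  have hroom' := hR.sq_le
  have hkk : k + 1 ≤ (k + 1) * (k + 1) := Nat.le_mul_of_pos_right _ (by omega)
  have hS := hR.tsize_le hD
  have hM := sets_le r k
  have hRM := two_pow_colors_le (r := r) hR.one_le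
  refine .seq (.assign (by omega) (by simp; omega) (.seq (.assign (by omega) (by simp; omega)
    (.seq (.assign (by omega) (by simp; omega) ?_)))))
  simp only [Expr.val_inp, Expr.val_lit, h0, h1, h2]
  refine .seq (.assign (by omega) (by simp; omega) (.seq (.assign (by omega) (by simp; omega)
    (.seq (.assign (by omega) (by simp; omega) ?_)))))
  set h₁ := (((((h.set 2 r).set 3 k).set 4 m).set 9 _).set 10 _).set 7 _ with hh₁
  have v2 : h₁.var 2 = r := by simp [hh₁]
  have v3 : h₁.var 3 = k := by simp [hh₁]
  have v4 : h₁.var 4 = m := by simp [hh₁]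
  have v9 : h₁.var 9 = k + 1 := by simp [hh₁]
  have v10 : h₁.var 10 = (k + 1) * (k + 1) := by simp [hh₁]
  have v7 : h₁.var 7 = 1 := by simp [hh₁]
  have v8 : h₁.var 8 = 0 := by simp [hh₁, hv]
  have v0 : h₁.var 0 = 0 := by simp [hh₁, hv]
  have a0 : ∀ i, h₁.arr 0 i = 0 := ha
  clear_value h₁
  refine .seq (Tri.for (fun i h' => h'.arr = h₁.arr ∧ h'.var 7 = 2 ^ i ∧
    ∀ x < 20, x ≠ 7 → h'.var x = h₁.var x) 10 r v2 (by omega) (by omega) (by omega) ?_ ?_ ?_)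
  · exact ⟨rfl, by simp [v7], fun x hx _ => by rw [Store.set_var, if_neg (by omega)]⟩
  · rintro i hi h' ⟨e, e7, ev⟩ h20 h2'
    have hle : 2 ^ i + 2 ^ i ≤ 2 ^ r := by
      rw [← Nat.two_mul, ← pow_succ']; exact Nat.pow_le_pow_right (by norm_num) (by omega)
    refine .assign (by omega) (by simp [e7]; omega) ⟨by simp, by simp [h20], by simp [h2'], e, ?_,
      fun x hx hx7 => ?_⟩
    · simp [e7]; ring
    · rw [Store.set_var, if_neg (by omega), Store.set_var, if_neg hx7, ev x hx hx7]
  rintro h₂ t₂ ⟨e₂, e7, ev₂⟩ - - ht₂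
  refine .seq (.assign (by omega) (by simp; omega) ?_)
  -- Only the entries below `k` are written. Entry `k` stays 0 from the start, the weight of the
  -- absent slot.
  refine .seq (Tri.for (fun i h' => h'.var 6 = 2 ^ (r * i) ∧
    (∀ x < 20, x ≠ 6 → h'.var x = h₂.var x) ∧ (∀ a, h'.arr 0 a = if a < i then 2 ^ (r * a) else 0))
    20 k (by simp [ev₂, v3]) (by omega) (by omega) (by omega) ?_ ?_ ?_)
  · refine ⟨by simp, fun x hx hx6 => ?_, fun a => by simp [e₂, a0]⟩
    rw [Store.set_var, if_neg (by omega), Store.set_var, if_neg hx6]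
  · rintro i hi h' ⟨e6, ev, ea⟩ h20 h3'
    have e7' : h'.var 7 = 2 ^ r := by rw [ev 7 (by omega) (by omega), e7]
    have hle : 2 ^ (r * i) * 2 ^ r ≤ 2 ^ (r * k) := by
      rw [← pow_add, ← Nat.mul_succ]
      exact Nat.pow_le_pow_right (by norm_num) (Nat.mul_le_mul_left _ hi)
    refine .seq (.write (by omega) (by simp) (by simp) (by simp [h20]; omega)
      (.assign (by omega) (by simp [e6, e7']; omega) ⟨by simp, by simp [h20], by simp [h3'], ?_,
      fun x hx hx6 => ?_, fun a => ?_⟩))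
    · simp [e6, e7', ← pow_add]; ring
    · rw [Store.set_var, if_neg (by omega), Store.set_var, if_neg hx6, Store.put_var, ev x hx hx6]
    · simp only [Store.set_arr, Store.put_arr_apply, Expr.val_var, h20, e6, ea a, true_and]
      rcases lt_trichotomy a i with hai | rfl | hai
      · rw [if_neg (by omega), if_pos hai, if_pos (by omega)]
      · rw [if_pos rfl, if_pos (Nat.lt_succ_self _)]
      · rw [if_neg (by omega), if_neg (by omega), if_neg (by omega)]
  rintro h₃ t₃ ⟨e6, ev₃, ea⟩ - - ht₃
  refine .seq (.assign (by omega) (by simp) ?_)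
  -- The nested loops double variable `5` once for every pair of colors, from `2 ^ (r * k)` up to
  -- `tsize r k`.
  refine .seq (Tri.for (fun j h' => h'.arr = h₃.arr ∧ h'.var 5 = 2 ^ (r * k + tri j) ∧
    ∀ x < 20, x ≠ 5 → h'.var x = h₃.var x) (r * 22 + 9) r (by simp [ev₃, ev₂, v2]) (by omega)
    (by omega) (by omega) ?_ ?_ ?_)
  · exact ⟨rfl, by simp [e6, tri], fun x hx hx5 => by
      rw [Store.set_var, if_neg (by omega), Store.set_var, if_neg hx5]⟩
  · rintro j hj h' ⟨e, e5, ev⟩ h20 h2'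
    refine Tri.for (fun i h'' => h''.arr = h₃.arr ∧ h''.var 5 = 2 ^ (r * k + (tri j + i)) ∧
      ∀ x < 20, x ≠ 5 → h''.var x = h₃.var x) 10 j h20 (by omega) (by omega) (by omega) ?_ ?_ ?_
    · exact ⟨e, by simp [e5], fun x hx hx5 => by rw [Store.set_var, if_neg (by omega), ev x hx hx5]⟩
    · rintro i hi h'' ⟨e', e5', ev'⟩ h21 h20'
      have hle : 2 ^ (r * k + (tri j + i)) + 2 ^ (r * k + (tri j + i)) ≤ tsize r k := by
        rw [← Nat.two_mul, ← pow_succ']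
        have := tri_add_lt hi hj
        exact Nat.pow_le_pow_right (by norm_num) (by omega)
      refine .assign (by omega) (by simp [e5']; omega) ⟨by simp, by simp [h21], by simp [h20'], e',
        ?_, fun x hx hx5 => ?_⟩
      · simp [e5']; ring
      · rw [Store.set_var, if_neg (by omega), Store.set_var, if_neg hx5, ev' x hx hx5]
    · rintro h'' t'' ⟨e', e5', ev'⟩ - h20' ht''
      refine ⟨ht''.trans (by gcongr), h20', ?_, e', ?_, fun x hx hx5 => ?_⟩
      · rw [ev' 2 (by omega) (by omega), ev₃ 2 (by omega) (by omega), ev₂ 2 (by omega) (by omega),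
          v2]
      · simpa [tri] using e5'
      · rw [Store.set_var, if_neg (by omega), ev' x hx hx5]
  rintro h₄ t₄ ⟨e₄, e5, ev₄⟩ - - ht₄
  have hv₄ : ∀ x < 20, x ≠ 5 → x ≠ 6 → x ≠ 7 → h₄.var x = h₁.var x := fun x hx h5 h6 h7 => by
    rw [ev₄ x hx h5, ev₃ x hx h6, ev₂ x hx h7]
  have e7₄ : h₄.var 7 = 2 ^ r := by
    rw [ev₄ 7 (by omega) (by omega), ev₃ 7 (by omega) (by omega), e7]
  have e6₄ : h₄.var 6 = 2 ^ (r * k) := by rw [ev₄ 6 (by omega) (by omega), e6]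
  have v3' : h₄.var 3 = k := by rw [hv₄ 3 (by omega) (by omega) (by omega) (by omega), v3]
  have v10' : h₄.var 10 = (k + 1) * (k + 1) := by
    rw [hv₄ 10 (by omega) (by omega) (by omega) (by omega), v10]
  refine (resetProg_spec hR v3' v10').mono ?_
  rintro h₅ t₅ ⟨ht₅, hv₅, harr₅, hs₅, -⟩
  have hv₅' : ∀ x < 20, x ≠ 5 → x ≠ 6 → x ≠ 7 → h₅.var x = h₁.var x := fun x hx h5 h6 h7 => by
    rw [hv₅ x (by omega), hv₄ x hx h5 h6 h7]
  refine ⟨?_, ⟨?_, ?_, ?_, ?_, ?_, ?_, ?_, fun a hak => ?_⟩, slotOk_of_id hs₅, ?_, ?_, ?_⟩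
  · have b1 := timeUnit_pos r k
    have b2 : (r + 1) * (r + 1) ≤ timeUnit r k := Nat.le_mul_of_pos_right _ (tsize_pos r k)
    have b3 : (k + 1) * (k + 1) ≤ timeUnit r k * ((k + 1) * (k + 1)) :=
      Nat.le_mul_of_pos_left _ b1
    have b4 : timeUnit r k ≤ timeUnit r k * ((k + 1) * (k + 1)) :=
      Nat.le_mul_of_pos_right _ (by positivity)
    have b5 : r * (r * 22 + 9 + 12) ≤ 22 * ((r + 1) * (r + 1)) := by nlinarith
    have b6 : r + 1 ≤ (r + 1) * (r + 1) := Nat.le_mul_of_pos_right _ (by omega)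
    unfold nodeTime
    simp
    omega
  · rw [hv₅' 2 (by omega) (by omega) (by omega) (by omega), v2]
  · rw [hv₅' 3 (by omega) (by omega) (by omega) (by omega), v3]
  · rw [hv₅ 5 (by omega), e5, tsize_eq]
  · rw [hv₅ 6 (by omega), e6₄]
  · rw [hv₅ 7 (by omega), e7₄]
  · rw [hv₅' 9 (by omega) (by omega) (by omega) (by omega), v9]
  · rw [hv₅' 10 (by omega) (by omega) (by omega) (by omega), v10]
  · rw [harr₅ 0 (by omega) (by omega), e₄, ea, weight]
  · rw [hv₅' 8 (by omega) (by omega) (by omega) (by omega), v8]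
  · rw [hv₅' 4 (by omega) (by omega) (by omega) (by omega), v4]
  · rw [hv₅' 0 (by omega) (by omega) (by omega) (by omega), v0]

/-- The search for a tournament into which there is a homomorphism. -/
def answerProg : Prog :=
  .seq (assign 21 (.var 5 / .var 6)) (forLoop 20 21
    (cond (.rd 3 (entry (.var 8) (.var 6 * .var 20 + (.var 6 - .lit 1)))) (assign 0 (.lit 1)) .skip))

theorem answerProg_spec (hR : Room E r k D) (g : Glob r k h) (hd : h.var 8 = d) (hdD : d < D)
    (h0 : h.var 0 = 0) (hT : ∀ x < tsize r k, h.arr 3 (d * tsize r k + x) ≤ 1) :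
    Tri E answerProg h fun h' t => t ≤ nodeTime r k ∧
      h'.var 0 = ind (∃ t < 2 ^ tri r, h.arr 3 (d * tsize r k + fullEntry r k t) = 1) := by
  have hroom := hR.room
  have hlev := level_le (r := r) (k := k) hdD
  have hdiv : tsize r k / 2 ^ (r * k) = 2 ^ tri r := by
    rw [tsize_eq, pow_add, Nat.mul_div_cancel_left _ (Nat.two_pow_pos _)]
  refine .seq (.assign (by omega) (by simp) ?_)
  refine Tri.for (fun n h' => h'.arr = h.arr ∧ (∀ x < 20, x ≠ 0 → h'.var x = h.var x) ∧
    h'.var 0 = ind (∃ t < n, h.arr 3 (d * tsize r k + fullEntry r k t) = 1)) 40 (2 ^ tri r)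
    (by simp [g.size, g.sets, hdiv]) (by omega) (by omega) (by omega) ?_ ?_ ?_
  · refine ⟨rfl, fun x hx _ => ?_, ?_⟩
    · rw [Store.set_var, if_neg (by omega), Store.set_var, if_neg (by omega)]
    · rw [ind_of_not (by simp)]; simp [h0]
  · rintro n hn h' ⟨e, ev, e0⟩ h20 h21
    have e8 : h'.var 8 = d := by rw [ev 8 (by omega) (by omega), hd]
    have e5 : h'.var 5 = tsize r k := by rw [ev 5 (by omega) (by omega), g.size]
    have e6 : h'.var 6 = 2 ^ (r * k) := by rw [ev 6 (by omega) (by omega), g.sets]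
    have hlt := fullEntry_lt (k := k) hn
    have hfull : 2 ^ (r * k) * n + (2 ^ (r * k) - 1) = fullEntry r k n := rfl
    have hTn := hT _ hlt
    refine .cond ?_ (fun hc => .assign (by omega) (by simp; omega) ?_) (fun hc => .skip ?_)
    · simp [entry, e8, e5, e6, h20, hfull]; omega
    · have hc' : h.arr 3 (d * tsize r k + fullEntry r k n) ≠ 0 := by
        simpa [entry, e8, e5, e6, h20, hfull, e] using hc
      refine ⟨by simp [entry], by simp [h20], by simp [h21], e, fun x hx hx0 => ?_, ?_⟩
      · rw [Store.set_var, if_neg (by omega), Store.set_var, if_neg hx0, ev x hx hx0]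
      · rw [ind_of ⟨n, by omega, by omega⟩]; simp
    · have hc' : h.arr 3 (d * tsize r k + fullEntry r k n) = 0 := by
        simpa [entry, e8, e5, e6, h20, hfull, e] using hc
      refine ⟨by simp [entry], h20, h21, e, fun x hx hx0 => ?_, ?_⟩
      · rw [Store.set_var, if_neg (by omega), ev x hx hx0]
      · rw [Store.set_var, if_neg (by omega), e0]
        refine ind_congr ⟨fun ⟨t, ht, h1⟩ => ⟨t, by omega, h1⟩, fun ⟨t, ht, h1⟩ => ⟨t, ?_, h1⟩⟩
        rcases Nat.lt_succ_iff_lt_or_eq.1 ht with ht | rfl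
        · exact ht
        · omega
  · rintro h' t ⟨-, -, e0⟩ - - ht
    refine ⟨?_, e0⟩
    have b0 : 2 ^ tri r ≤ tsize r k := Nat.pow_le_pow_right (by norm_num) (Nat.le_add_left _ _)
    have b1 := timeUnit_pos r k
    have b2 := tsize_le_timeUnit r k
    have b4 : timeUnit r k ≤ timeUnit r k * ((k + 1) * (k + 1)) :=
      Nat.le_mul_of_pos_right _ (by positivity)
    unfold nodeTime
    simp
    omega

/-! ### The whole program -/

/-- The program that decides the existence of an oriented coloring. -/
def mainProg : Prog :=
  .seq (.const 51 2) (.seq (.load 51 51) (.seq (.const 52 3) (.seq (.arith .mul 51 51 52)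
    (.seq (.arith .add 50 51 52) (.seq initProg (.seq (forLoop 11 4 stepProg) answerProg))))))

theorem hasOrientedColoring_iff_of_equiv {V V' : Type} {G : Digraph V} {G' : Digraph V'}
    (e : V' ≃ V) (he : ∀ u v, G.Adj (e u) (e v) ↔ G'.Adj u v) (r : ℕ) :
    HasOrientedColoring G r ↔ HasOrientedColoring G' r := by
  constructor
  · rintro ⟨c, h1, h2⟩
    exact ⟨c ∘ e, fun u v huv => h1 _ _ ((he u v).2 huv), fun u v x y huv hxy =>
      h2 _ _ _ _ ((he u v).2 huv) ((he x y).2 hxy)⟩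
  · rintro ⟨c, h1, h2⟩
    have he' : ∀ u v, G.Adj u v → G'.Adj (e.symm u) (e.symm v) := fun u v huv => by
      rw [← he]; simpa using huv
    exact ⟨c ∘ e.symm, fun u v huv => h1 _ _ (he' u v huv), fun u v x y huv hxy =>
      h2 _ _ _ _ (he' u v huv) (he' x y hxy)⟩

theorem mainProg_answers (X : CWExpr k) (E : Env) (hL : E.L = 3 * X.size + 3)
    (hinp : E.inp = fun i => (ocnInput r X).getD i 0)
    (hR : Room E r k (X.leaves + 1)) (hrW : r ≤ E.W) {T : ℕ}
    (hT : 500 * X.size + (2 * X.leaves + 1) * nodeTime r k + 14 ≤ T) :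
    Answers E.W mainProg (ocnInput r X) T (HasOrientedColoring (Digraph.mk X.Arc) r) := by
  have h5 := E.five_le
  have hroom := hR.room
  have hkk : k + 1 ≤ (k + 1) * (k + 1) := Nat.le_mul_of_pos_right _ (by omega)
  have hlen : (ocnInput r X).length = 3 * X.size + 3 := by
    simp [ocnInput, X.length_code]
  have hle : ∀ a ∈ ocnInput r X, a ≤ E.W := by
    -- The kinds of operations are at most 3 and the labels are less than `k`.
    have hcode : ∀ (Y : CWExpr k), ∀ a ∈ Y.code, a ≤ k + 3 := by
      intro Y
      induction Y with
      | vertex a => simp [CWExpr.code]; omega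
      | union X Y hX hY =>
        intro a ha
        simp only [CWExpr.code, List.mem_append, List.mem_cons, List.not_mem_nil, or_false] at ha
        rcases ha with (ha | ha) | ha
        · exact hX a ha
        · exact hY a ha
        · omega
      | arcs a b hab X hX =>
        intro c hc
        simp only [CWExpr.code, List.mem_append, List.mem_cons, List.not_mem_nil, or_false] at hc
        rcases hc with hc | hc
        · exact hX c hc
        · omega
      | relabel a b X hX =>
        intro c hc
        simp only [CWExpr.code, List.mem_append, List.mem_cons, List.not_mem_nil, or_false] at hc
        rcases hc with hc | hc
        · exact hX c hc
        · omega
    intro a ha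
    simp only [ocnInput, List.mem_cons] at ha
    rcases ha with rfl | rfl | rfl | ha
    · exact hrW
    · omega
    · omega
    · have := hcode X a ha; omega
  have hmem : ∀ i, (ocnInput r X).getD i 0 ≤ E.W := by
    intro i
    by_cases hi : i < (ocnInput r X).length
    · rw [List.getD_eq_getElem _ _ hi]; exact hle _ (List.getElem_mem hi)
    · rw [List.getD_eq_default _ _ (by omega)]; omega
  have hsize : (initial (ocnInput r X)).mem 2 = X.size := rfl
  -- Register `50` must hold the length of the input before any array is accessed, so it is computed
  -- by plain machine instructions.
  set s₅ := (((((initial (ocnInput r X)).setReg 51 2).setReg 51 X.size).setReg 52 3).setReg 51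
    (X.size * 3)).setReg 50 (X.size * 3 + 3) with hs₅
  have hrep : Rep E s₅ ⟨fun _ => 0, fun _ _ => 0⟩ := by
    refine ⟨fun x hx => ?_, ?_, fun x => ?_, fun ρ hρ i => ?_, fun i hi => ?_, fun i => ?_⟩
    · simp [hs₅, initial, show x ≠ 50 by omega, show x ≠ 51 by omega, show x ≠ 52 by omega]
    · simp [hs₅, hL]; omega
    · simp only [hs₅, State.setReg_reg, initial]
      split_ifs <;> omega
    · simp only [hs₅, State.setReg_mem, initial]
      exact List.getD_eq_default _ _ (by omega)
    · simp only [hs₅, State.setReg_mem, initial, hinp]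
    · simp only [hs₅, State.setReg_mem, initial]; exact hmem i
  -- The bound says `t + 5 ≤ T`: five steps have gone into register `50`, and the 9 are the overhead
  -- of the main loop.
  have hrun : Tri E (.seq initProg (.seq (forLoop 11 4 stepProg) answerProg))
      ⟨fun _ => 0, fun _ _ => 0⟩ fun h' t => t + 14 ≤ T + 9 ∧
        h'.var 0 = ind (HasOrientedColoring (Digraph.mk X.Arc) r) := by
    refine .seq ((initProg_spec (m := X.size) hR (by omega) (by omega) (by rw [hinp]; rfl)
      (by rw [hinp]; rfl) (by rw [hinp]; rfl) (fun _ => rfl) (fun _ => rfl)).mono ?_)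
    rintro h₁ t₁ ⟨ht₁, g₁, hs₁, e8, e4, e0⟩
    refine .seq (.iter (by omega) (by omega) (by omega) ?_)
    rw [e4]
    refine (iter_stepProg hR X 0 0 (h₁.set 11 0) (g₁.congr (fun x hx => ?_) rfl) (hs₁.of_arr rfl)
      (by simpa using e8) (by omega) (by simp) (by omega) (fun i _ => ?_)).mono ?_
    · rw [Store.set_var, if_neg (by omega)]
    · rw [hinp]
      change (ocnInput r X).getD (3 + i) 0 = _
      rw [Nat.add_comm]; rfl
    rintro h₂ t₂ ⟨hS₂, -, hc₂, ht₂⟩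
    have g₂ := g₁.of_level (h' := h₂) (fun x hx hx8 => by
      rw [hS₂.var x hx hx8, Store.set_var, if_neg (by omega)]) hS₂.weight
    refine (answerProg_spec hR g₂ hS₂.level (by have := X.leaves_pos; omega) (by
      rw [hS₂.var 0 (by omega) (by omega), Store.set_var, if_neg (by omega), e0])
      fun x hx => hc₂.table.le_one hx).mono ?_
    rintro h₃ t₃ ⟨ht₃, e0₃⟩
    refine ⟨?_, ?_⟩
    · have : 2 * X.leaves + 1 = (2 * X.leaves - 1) + 1 + 1 := by have := X.leaves_pos; omega
      rw [this, Nat.add_mul, Nat.add_mul] at hT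
      omega
    · rw [e0₃]
      -- The last table is read in terms of slots: with all colors allowed everywhere, no
      -- translation to labels is needed.
      exact ind_congr (hasOrientedColoring_iff (Digraph.mk X.Arc) hc₂.alive hc₂.table).symm
  obtain ⟨s', h', t, hex, hrep', ht, h0⟩ := hrun s₅ hrep
  refine ⟨s', 1 + (1 + (1 + (1 + (1 + t)))), .seq (.const 51 2 _ (by omega)) (.seq
    (.load_eq (a := 2) (v := X.size) (by simp) (by rw [State.setReg_mem, hsize]) (by omega)
      (by omega)) (.seq (.const 52 3 _ (by omega)) (.seq
    (.arith_eq (v := X.size * 3) (by simp [ArithOp.eval]) (by omega)) (.seq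
    (.arith_eq (v := X.size * 3 + 3) (by simp [ArithOp.eval]) (by omega)) hex)))), by omega,
    fun hQ => ?_, fun hQ => ?_⟩
  · rw [hrep'.var 0 (by omega), h0, ind_of hQ]
  · rw [hrep'.var 0 (by omega), h0, ind_of_not hQ]

/-! ### Numerical estimates and the theorem -/

theorem tri_add_le (r : ℕ) : tri r + 2 * r ≤ r * r + 2 := by
  induction r with
  | zero => simp [tri]
  | succ n ih =>
    rcases Nat.eq_zero_or_pos n with rfl | hn
    · simp [tri]
    · simp only [tri]
      nlinarith

theorem tri_le (r : ℕ) : tri r ≤ r * r := by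
  induction r with
  | zero => simp [tri]
  | succ n ih => simp only [tri]; nlinarith

theorem tsize_le (r k : ℕ) : tsize r k ≤ 2 ^ (r * (r + k)) := by
  refine Nat.pow_le_pow_right (by norm_num) ?_
  have := tri_le r
  rw [Nat.mul_add]; omega

/-- The factor `(r + 1) * (r + 1)` is at most 2^(2r), and r(r-1)/2 + 2r exceeds r^2 by at most 2, so
a constant factor 4 suffices. -/
theorem timeUnit_le (r k : ℕ) : timeUnit r k ≤ 4 * 2 ^ (r * (r + k)) := by
  have h1 : r + 1 ≤ 2 ^ r := Nat.lt_two_pow_self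
  calc timeUnit r k ≤ 2 ^ r * 2 ^ r * tsize r k := by unfold timeUnit; gcongr
    _ = 2 ^ (r + r + (r * k + tri r)) := by rw [tsize_eq, pow_add 2 (r + r), pow_add 2 r]
    _ ≤ 2 ^ (2 + r * (r + k)) := by
        refine Nat.pow_le_pow_right (by norm_num) ?_
        have := tri_add_le r
        rw [Nat.mul_add]; omega
    _ = 4 * 2 ^ (r * (r + k)) := by rw [pow_add]; norm_num

end OrientedColoring

open OrientedColoring in
theorem theorem6p9 :
    ∃ (P : WordRAM.Prog) (C : ℕ), ∀ (k r : ℕ) (X : CWExpr k) (V : Type) [Fintype V]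
      (G : Digraph V), X.Defines G →
        WordRAM.Answers
          (C * (X.size + Fintype.card V * k ^ 2 * 2 ^ (r * (r + k)))) P (ocnInput r X)
          (C * (X.size + Fintype.card V * k ^ 2 * 2 ^ (r * (r + k))))
          (HasOrientedColoring G r) := by
  refine ⟨mainProg, 200000, fun k r X V _ G ⟨e, he⟩ => ?_⟩
  have hcard : Fintype.card V = X.leaves := by
    rw [← Nat.card_eq_fintype_card, ← Nat.card_congr e, X.finite_vertex_and_card.2]
  -- Every expression creates a vertex, and the label of this vertex shows that there are labels.
  have hk : 1 ≤ k := by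
    have hn : 0 < Nat.card X.Vertex := by
      rw [X.finite_vertex_and_card.2]; exact X.leaves_pos
    obtain ⟨v⟩ := (Nat.card_pos_iff.1 hn).1
    have := (X.label v).2
    omega
  rw [hcard]
  have hn := X.leaves_pos
  have hns := X.leaves_le_size
  set n := X.leaves with hndef
  set B := 2 ^ (r * (r + k)) with hB
  have hBpos : 0 < B := Nat.two_pow_pos _
  have hkk : (k + 1) * (k + 1) ≤ 4 * k ^ 2 := by nlinarith
  have hk2 : 1 ≤ k ^ 2 := Nat.one_le_pow _ _ hk
  set A := n * k ^ 2 * B with hA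
  have hkA : k ^ 2 ≤ A := by
    rw [hA, Nat.mul_assoc, Nat.mul_left_comm]
    exact Nat.le_mul_of_pos_right _ (Nat.mul_pos hn hBpos)
  have hnB : n * B ≤ A := by
    rw [hA, Nat.mul_assoc, Nat.mul_left_comm]
    exact Nat.le_mul_of_pos_left _ hk2
  have hBA : B ≤ A := (Nat.le_mul_of_pos_left _ hn).trans hnB
  have hrB : r ≤ B := by
    refine (Nat.lt_two_pow_self (n := r)).le.trans (Nat.pow_le_pow_right (by norm_num) ?_)
    exact Nat.le_mul_of_pos_right _ (by omega)
  have hS := tsize_le r k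
  have hnS : (n + 1) * tsize r k ≤ 2 * A := by
    calc (n + 1) * tsize r k ≤ (n + n) * B := Nat.mul_le_mul (by omega) hS
      _ = 2 * (n * B) := by ring
      _ ≤ 2 * A := by omega
  have hU := timeUnit_le r k
  -- The factor is `2 * n - 1` for creations and unions, plus one each for initialization and
  -- answer. The constant is 3 · 3000 · 4 · 4, the last factor from `(k + 1) * (k + 1) ≤ 4 * k ^ 2`.
  have hnode : (2 * n + 1) * nodeTime r k ≤ 144000 * A := by
    calc (2 * n + 1) * nodeTime r k ≤ (3 * n) * (3000 * (4 * B * (4 * k ^ 2))) := by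
          unfold nodeTime; gcongr; omega
      _ = 144000 * A := by rw [hA]; ring
  have hAns := mainProg_answers (r := r) X
    ⟨200000 * (X.size + A), 3 * X.size + 3, fun i => (ocnInput r X).getD i 0, by omega⟩ rfl rfl
    ⟨hk, by rw [← hndef]; simp only; omega⟩ (by simp only; omega) (T := 200000 * (X.size + A))
    (by rw [← hndef]; omega)
  obtain ⟨s, t, h1, h2, h3, h4⟩ := hAns
  have hiff := hasOrientedColoring_iff_of_equiv (G' := Digraph.mk X.Arc) e he r
  exact ⟨s, t, h1, h2, fun hQ => h3 (hiff.1 hQ), fun hQ => h4 fun hQ' => hQ (hiff.2 hQ')⟩
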